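/- Let $m\ge 0$, $\alpha,\beta\in\mathbb{R}$, and $\tau_*>0$. For $(z_1,z_2)\in\mathbb{C}^2$ and $s\ge0$ let $\Phi_s(z_1,z_2)=(U(s),V(s))$, where $(U,V)$ is the unique solution on $[0,s]$ of $$U'=imV+i\alpha U|V|^2+2i\beta(\overline UV+U\overline V)V,\qquad V'=imU+i\alpha V|U|^2+2i\beta(\overline UV+U\overline V)U,$$ with $(U,V)(0)=(z_1,z_2)$. For pairs of functions on $\mathbb{R}$ put $S^1_t(f,g)(x)=(f(x-t),g(x+t))$ and $S^2_t(f,g)(x)=\Phi_t(f(x),g(x))$. Let $u_0,v_0\in L^2(\mathbb{R})$. For every $\tau\in(0,\tau_*)$ let $f^{(\tau)},g^{(\tau)}\in L^2(\mathbb{R})$ be complex-valued and constant on each cell $[j\tau,(j+1)\tau)$, $j\in\mathbb{Z}$, with $$\lim_{\tau\to0+}\big(\|f^{(\tau)}-u_0\|_{L^2(\mathbb{R})}+\|g^{(\tau)}-v_0\|_{L^2(\mathbb{R})}\big)=0 .$$ Let $(u^{(\tau)},v^{(\tau)})$ be the time-splitting solution of the nonlinear Dirac equation $$u_t+u_x=imv+i\alpha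 u|v|^2+2i\beta(\overline uv+u\overline v)v,\qquad v_t-v_x=imu+i\alpha v|u|^2+2i\beta(\overline uv+u\overline v)u$$ with mesh size $\tau$, that is, $$(u^{(\tau)},v^{(\tau)})(\cdot,t)=S^1_{t-n\tau}\big(S^2_\tau S^1_\tau\big)^n(f^{(\tau)},g^{(\tau)}),\qquad t\in[n\tau,(n+1)\tau),\ n=0,1,2,\dots$$ Then, for every $T>0$, the family $S_T=\{(u^{(\tau)},v^{(\tau)})|_{\mathbb{R}\times[0,T]}:\tau\in(0,\tau_*)\}$ consists of maps $[0,T]\to L^2(\mathbb{R})\times L^2(\mathbb{R})$ and is precompact in $C([0,T];L^2(\mathbb{R}))$ as the mesh size vanishes: for every sequence $(\tau_k)\subset(0,\tau_*)$ with $\tau_k\to0$ there are a subsequence $(\tau_{k_l})$ and $u,v\in C([0,T];L^2(\mathbb{R}))$ such that $$\lim_{l\to\infty}\ \sup_{0\le t\le T}\Big(\|u^{(\tau_{k_l})}(\cdot,t)-u(\cdot,t)\|_{L^2(\mathbb{R})}+\|v^{(\tau_{k_l})}(\cdot,t)-v(\cdot,t)\|_{L^2(\mathbb{R})}\Big)=0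 .$$ -/

import Mathlib

open MeasureTheory Filter Topology Set
open scoped ENNReal NNReal

noncomputable section

namespace NLDirac

/-- Right-hand side of the nonlinear subproblem
`u' = i m v + i α u |v|² + 2 i β (ū v + u v̄) v`,
`v' = i m u + i α v |u|² + 2 i β (ū v + u v̄) u`, with `z = (u, v)`. -/
def field (m α β : ℝ) (z : ℂ × ℂ) : ℂ × ℂ :=
  (Complex.I * (m : ℂ) * z.2 + Complex.I * (α : ℂ) * z.1 * ((‖z.2‖ ^ 2 : ℝ) : ℂ)
      + Complex.I * 2 * (β : ℂ)
        * ((starRingEnd ℂ) z.1 * z.2 + z.1 * (starRingEnd ℂ) z.2) * z.2,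
    Complex.I * (m : ℂ) * z.1 + Complex.I * (α : ℂ) * z.2 * ((‖z.1‖ ^ 2 : ℝ) : ℂ)
      + Complex.I * 2 * (β : ℂ)
        * ((starRingEnd ℂ) z.1 * z.2 + z.1 * (starRingEnd ℂ) z.2) * z.1)

/-- `w` solves the initial value problem `w' = field w`, `w 0 = z` on `[0, s]`. -/
def IsSol (m α β s : ℝ) (z : ℂ × ℂ) (w : ℝ → ℂ × ℂ) : Prop :=
  w 0 = z ∧ ∀ r ∈ Icc 0 s, HasDerivWithinAt w (field m α β (w r)) (Icc 0 s) r

theorem contDiff_field (m α β : ℝ) : ContDiff ℝ 1 (field m α β) := by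
  have h1 : ContDiff ℝ 1 (fun z : ℂ × ℂ => z.1) := contDiff_fst
  have h2 : ContDiff ℝ 1 (fun z : ℂ × ℂ => z.2) := contDiff_snd
  have c1 : ContDiff ℝ 1 (fun z : ℂ × ℂ => (starRingEnd ℂ) z.1) :=
    Complex.conjCLE.contDiff.comp h1
  have c2 : ContDiff ℝ 1 (fun z : ℂ × ℂ => (starRingEnd ℂ) z.2) :=
    Complex.conjCLE.contDiff.comp h2
  have n1 : ContDiff ℝ 1 (fun z : ℂ × ℂ => ((‖z.1‖ ^ 2 : ℝ) : ℂ)) :=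
    Complex.ofRealCLM.contDiff.comp (h1.norm_sq ℝ)
  have n2 : ContDiff ℝ 1 (fun z : ℂ × ℂ => ((‖z.2‖ ^ 2 : ℝ) : ℂ)) :=
    Complex.ofRealCLM.contDiff.comp (h2.norm_sq ℝ)
  unfold field
  fun_prop

/-- If the velocity of a curve in `ℂ × ℂ` is a real multiple of `field`, then `|u|² + |v|²` is
constant along the curve. -/
theorem mass_const (m α β : ℝ) {s : ℝ} {c : ℝ → ℝ} {w : ℝ → ℂ × ℂ}
    (hw : ∀ r ∈ Icc 0 s, HasDerivWithinAt w (c r • field m α β (w r)) (Icc 0 s) r) :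
    ∀ r ∈ Icc 0 s, ‖(w r).1‖ ^ 2 + ‖(w r).2‖ ^ 2 = ‖(w 0).1‖ ^ 2 + ‖(w 0).2‖ ^ 2 := by
  have hd : ∀ r ∈ Icc 0 s,
      HasDerivWithinAt (fun r => ‖(w r).1‖ ^ 2 + ‖(w r).2‖ ^ 2) 0 (Icc 0 s) r := by
    intro r hr
    have h1 : HasDerivWithinAt (fun r => (w r).1) (c r • field m α β (w r)).1 (Icc 0 s) r :=
      (hw r hr).fst
    have h2 : HasDerivWithinAt (fun r => (w r).2) (c r • field m α β (w r)).2 (Icc 0 s) r :=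
      (hw r hr).snd
    have h3 := h1.norm_sq.add h2.norm_sq
    refine h3.congr_deriv ?_
    simp only [field, Complex.inner, ← Complex.normSq_eq_norm_sq, Complex.normSq_apply,
      Prod.smul_mk]
    simp
    ring
  refine constant_of_has_deriv_right_zero (fun r hr => (hd r hr).continuousWithinAt) ?_
  intro r hr
  exact ((hd r ⟨hr.1, hr.2.le⟩).mono_of_mem_nhdsWithin
    (Icc_mem_nhdsGE_of_mem hr))

/-- The initial value problem is globally solvable. -/
theorem exists_isSol (m α β : ℝ) {s : ℝ} (hs : 0 ≤ s) (z : ℂ × ℂ) :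
    ∃ w, IsSol m α β s z w := by
  set M : ℂ × ℂ → ℝ := fun z => ‖z.1‖ ^ 2 + ‖z.2‖ ^ 2 with hM
  have hMc : ContDiff ℝ 1 M := (contDiff_fst.norm_sq ℝ).add (contDiff_snd.norm_sq ℝ)
  set χ : ℂ × ℂ → ℝ := fun y => Real.smoothTransition (M z + 2 - M y) with hχ
  have hχc : ContDiff ℝ 1 χ := Real.smoothTransition.contDiff.comp (contDiff_const.sub hMc)
  set G : ℂ × ℂ → ℂ × ℂ := fun y => χ y • field m α β y with hG
  have hGc : ContDiff ℝ 1 G := hχc.smul (contDiff_field m α β)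
  have hGs : HasCompactSupport G := by
    refine HasCompactSupport.intro (isCompact_closedBall (0 : ℂ × ℂ) (M z + 3)) ?_
    intro y hy
    have hMz : 0 ≤ M z := by simp only [hM]; positivity
    have hy' : M z + 3 < ‖y‖ := by simpa using hy
    have hMy : M z + 2 ≤ M y := by
      simp only [hM] at *
      rcases le_total ‖y.1‖ ‖y.2‖ with h | h
      · rw [Prod.norm_def, max_eq_right h] at hy'
        nlinarith [sq_nonneg ‖y.1‖]
      · rw [Prod.norm_def, max_eq_left h] at hy'
        nlinarith [sq_nonneg ‖y.2‖]
    have : χ y = 0 := Real.smoothTransition.zero_of_nonpos (by linarith)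
    simp [hG, this]
  obtain ⟨K, hK⟩ := hGc.lipschitzWith_of_hasCompactSupport hGs (by simp)
  obtain ⟨L, hL⟩ := hGs.exists_bound_of_continuous hGc.continuous
  have hL0 : 0 ≤ L := (norm_nonneg _).trans (hL 0)
  have hpl : IsPicardLindelof (fun _ => G) (tmin := 0) (tmax := s) ⟨0, le_rfl, hs⟩ z
      (⟨L, hL0⟩ * ⟨s, hs⟩) 0 ⟨L, hL0⟩ K := by
    refine IsPicardLindelof.of_time_independent (fun y _ => hL y) hK.lipschitzOnWith ?_
    simp only [sub_zero, sub_self, max_eq_left hs, NNReal.coe_zero]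
    exact le_rfl
  obtain ⟨w, hw0, hw⟩ := hpl.exists_eq_forall_mem_Icc_hasDerivWithinAt₀
  have hw0' : w 0 = z := hw0
  refine ⟨w, hw0', fun r hr => ?_⟩
  have hmass := mass_const m α β (c := fun r => χ (w r)) hw r hr
  have h1 : χ (w r) = 1 := by
    refine Real.smoothTransition.one_of_one_le ?_
    have : M (w r) = M z := by simp only [hM]; rw [hmass, hw0']
    rw [this]; linarith
  have := hw r hr
  simpa [hG, h1] using this

/-- The solution of the initial value problem is unique. -/
theorem isSol_unique (m α β : ℝ) {s : ℝ} {z : ℂ × ℂ} {w w' : ℝ → ℂ × ℂ}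
    (h : IsSol m α β s z w) (h' : IsSol m α β s z w') : EqOn w w' (Icc 0 s) := by
  have hc : ContinuousOn w (Icc 0 s) := fun r hr => (h.2 r hr).continuousWithinAt
  have hc' : ContinuousOn w' (Icc 0 s) := fun r hr => (h'.2 r hr).continuousWithinAt
  obtain ⟨R, hR⟩ := (isCompact_Icc.image_of_continuousOn hc).isBounded.subset_closedBall 0
  obtain ⟨R', hR'⟩ := (isCompact_Icc.image_of_continuousOn hc').isBounded.subset_closedBall 0
  obtain ⟨K, hK⟩ := (contDiff_field m α β).contDiffOn.exists_lipschitzOnWith (by simp)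
    (convex_closedBall (0 : ℂ × ℂ) (max R R')) (isCompact_closedBall _ _)
  have hd : ∀ {y : ℝ → ℂ × ℂ}, IsSol m α β s z y → ∀ t ∈ Ico 0 s,
      HasDerivWithinAt y (field m α β (y t)) (Ici t) t := fun hy t ht =>
    (hy.2 t ⟨ht.1, ht.2.le⟩).mono_of_mem_nhdsWithin (Icc_mem_nhdsGE_of_mem ht)
  refine ODE_solution_unique_of_mem_Icc_right (v := fun _ => field m α β)
    (s := fun _ => Metric.closedBall 0 (max R R')) (K := K) (fun _ _ => hK) hc (hd h) ?_ hc'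
    (hd h') ?_ (h.1.trans h'.1.symm)
  · exact fun t ht => Metric.closedBall_subset_closedBall (le_max_left _ _)
      (hR ⟨t, ⟨ht.1, ht.2.le⟩, rfl⟩)
  · exact fun t ht => Metric.closedBall_subset_closedBall (le_max_right _ _)
      (hR' ⟨t, ⟨ht.1, ht.2.le⟩, rfl⟩)

open Classical in
/-- The flow of the nonlinear subproblem: the value at time `s ≥ 0` of the solution of
`w' = field w` on `[0, s]` with `w 0 = z` (which exists and is unique). For `s < 0`, where it is
not used, it is set to `z`. -/
def flow (m α β s : ℝ) (z : ℂ × ℂ) : ℂ × ℂ :=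
  if hs : 0 ≤ s then (exists_isSol m α β hs z).choose s else z

theorem flow_eq (m α β : ℝ) {s : ℝ} (hs : 0 ≤ s) {z : ℂ × ℂ} {w : ℝ → ℂ × ℂ}
    (h : IsSol m α β s z w) : flow m α β s z = w s := by
  rw [flow, dif_pos hs]
  exact isSol_unique m α β (exists_isSol m α β hs z).choose_spec h ⟨hs, le_rfl⟩

/-- The semigroup `S¹_t` of `∂ₜ u + ∂ₓ u = 0`, `∂ₜ v - ∂ₓ v = 0`. -/
def transport (t : ℝ) (w : ℝ → ℂ × ℂ) : ℝ → ℂ × ℂ :=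
  fun x => ((w (x - t)).1, (w (x + t)).2)

/-- The semigroup `S²_t` of the nonlinear subproblem, acting pointwise in `x`. -/
def interact (m α β t : ℝ) (w : ℝ → ℂ × ℂ) : ℝ → ℂ × ℂ :=
  fun x => flow m α β t (w x)

/-- The time-splitting solution with mesh size `τ` and initial data `w`:
`S¹_{t - nτ} (S²_τ S¹_τ)ⁿ w` for `t ∈ [nτ, (n+1)τ)`, evaluated at time `t ≥ 0`. -/
def splitting (m α β τ : ℝ) (w : ℝ → ℂ × ℂ) (t : ℝ) : ℝ → ℂ × ℂ :=
  transport (t - (⌊t / τ⌋₊ : ℝ) * τ)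
    ((fun y => interact m α β τ (transport τ y))^[⌊t / τ⌋₊] w)

/-- `f` is constant on each cell `[jτ, (j+1)τ)`, `j ∈ ℤ`. -/
def IsCellConstant (τ : ℝ) (f : ℝ → ℂ) : Prop :=
  ∀ j : ℤ, ∀ x ∈ Ico ((j : ℝ) * τ) (((j : ℝ) + 1) * τ), f x = f ((j : ℝ) * τ)

end NLDirac

end

/-!
The time-splitting solution is controlled by two facts about one step of the nonlinear flow. It
conserves `|u|² + |v|²`, so the mass crossing a characteristic is at most the total mass
(`IsScheme.sum_snd_le`). And along a right-going characteristic `|u|` grows at a rate proportional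
to `1 + |v|²` only, so that `1 + |u|` is dominated by a multiple of its value at the foot of the
characteristic (`IsScheme.exists_one_add_norm_fst_le`); symmetrically for `v`. The solution therefore
concentrates no more than its data do.

*Stability.* For two solutions with differences `A = u - u'`, `B = v - v'`, the one-step estimate
`exists_norm_flow_fst_sub_le`, the domination and Cauchy–Schwarz give, along each right-going
characteristic with foot `j`, a bound
`|A|² ≤ C (|A₀(j)|² + (1 + |u₀(j)|² + |u₀'(j)|²) ∑ τ |B|²)`, and symmetrically for `B`
(`IsScheme.exists_normSq_fst_sub_le`, `IsScheme.exists_normSq_snd_sub_le`). The sums of `|B|²` along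
right-going and of `|A|²` along left-going characteristics then bound each other, with a factor given
by the mass of the data on few cells. On a time interval so short that this factor is small, the
estimate closes (`sum_along_characteristic_le`, `sum_le_of_short_time`); how short depends only on
the concentration of the limit data, so finitely many such intervals, uniformly in `τ`, cover `[0,T]`
(`IsScheme.exists_stability`, `exists_splitting_stability`).

*Compactness.* By stability it suffices to treat data sampled from continuous functions of compact
support that approximate `u₀`, `v₀` in `L²`. Their splitting solutions are uniformly bounded,
compactly supported and equicontinuous up to an error vanishing with `τ`
(`isAsymptoticallyRegular_splitting_sample`). A diagonal subsequence converges at all rational points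
for all approximations at once, hence uniformly for each of them, and the original sequence is then
Cauchy in `L²` uniformly in time (`exists_subseq_tendsto_of_approx`).
-/

namespace NLDirac

/-! ### One step of the nonlinear flow -/

theorem field_swap (m α β : ℝ) (z : ℂ × ℂ) : field m α β z.swap = (field m α β z).swap := by
  apply Prod.ext <;> simp only [field, Prod.fst_swap, Prod.snd_swap] <;> ring

theorem field_zero (m α β : ℝ) : field m α β 0 = 0 := by
  ext <;> simp [field]

/-- Size of the coefficients of `field`. -/
def coupling (m α β : ℝ) : ℝ := |m| + |α| + 4 * |β|

theorem coupling_nonneg (m α β : ℝ) : 0 ≤ coupling m α β := by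
  unfold coupling; positivity

theorem norm_field_fst_sub_le (m α β : ℝ) (z y : ℂ × ℂ) :
    ‖(field m α β z).1 - (field m α β y).1‖ ≤
      coupling m α β * ((‖z.2‖ + ‖y.2‖) ^ 2 * ‖z.1 - y.1‖
        + (1 + (‖z.1‖ + ‖y.1‖) * (‖z.2‖ + ‖y.2‖)) * ‖z.2 - y.2‖) := by
  obtain ⟨u, v⟩ := z
  obtain ⟨u', v'⟩ := y
  set A : ℂ := u - u' with hA
  set B : ℂ := v - v' with hB
  let cj := starRingEnd ℂ
  have key : (field m α β (u, v)).1 - (field m α β (u', v')).1 =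
      Complex.I * m * B
      + (Complex.I * α + Complex.I * 2 * β) * (A * v * cj v + u' * (B * cj v + v' * cj B))
      + Complex.I * 2 * β * (cj A * v * v + cj u' * B * (v + v')) := by
    simp only [field, hA, hB, cj, map_sub, Complex.ofReal_pow, ← Complex.mul_conj']
    ring
  have e1 : ‖A * v * cj v + u' * (B * cj v + v' * cj B)‖ ≤
      ‖A‖ * ‖v‖ ^ 2 + ‖u'‖ * ‖B‖ * (‖v‖ + ‖v'‖) := by
    refine (norm_add_le _ _).trans ?_
    have := norm_add_le (B * cj v) (v' * cj B)
    simp only [norm_mul, cj, RCLike.norm_conj] at this ⊢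
    nlinarith [mul_le_mul_of_nonneg_left this (norm_nonneg u')]
  have e2 : ‖cj A * v * v + cj u' * B * (v + v')‖ ≤
      ‖A‖ * ‖v‖ ^ 2 + ‖u'‖ * ‖B‖ * (‖v‖ + ‖v'‖) := by
    refine (norm_add_le _ _).trans ?_
    have := norm_add_le v v'
    simp only [norm_mul, cj, RCLike.norm_conj] at this ⊢
    nlinarith [mul_le_mul_of_nonneg_left this (mul_nonneg (norm_nonneg u') (norm_nonneg B))]
  have e3 : ‖Complex.I * α + Complex.I * 2 * β‖ ≤ |α| + 2 * |β| := by
    refine (norm_add_le _ _).trans ?_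
    simp
  have hX : ‖A‖ * ‖v‖ ^ 2 + ‖u'‖ * ‖B‖ * (‖v‖ + ‖v'‖) ≤
      (‖v‖ + ‖v'‖) ^ 2 * ‖A‖ + (‖u‖ + ‖u'‖) * (‖v‖ + ‖v'‖) * ‖B‖ := by
    have h1 : ‖v‖ ^ 2 ≤ (‖v‖ + ‖v'‖) ^ 2 := by gcongr; linarith [norm_nonneg v']
    have h2 : 0 ≤ ‖u‖ * (‖v‖ + ‖v'‖) * ‖B‖ := by positivity
    nlinarith [mul_le_mul_of_nonneg_right h1 (norm_nonneg A)]
  rw [key]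
  refine (norm_add₃_le).trans ?_
  rw [norm_mul (Complex.I * α + _), norm_mul (Complex.I * 2 * β)]
  have n1 : ‖Complex.I * m * B‖ = |m| * ‖B‖ := by simp
  have n2 : ‖Complex.I * 2 * (β : ℂ)‖ = 2 * |β| := by simp
  rw [n1, n2]
  set X := (‖v‖ + ‖v'‖) ^ 2 * ‖A‖ + (‖u‖ + ‖u'‖) * (‖v‖ + ‖v'‖) * ‖B‖ with hXdef
  have hX0 : 0 ≤ X := by positivity
  have f1 := mul_le_mul e3 (e1.trans hX) (norm_nonneg _) (by positivity)
  have f2 := mul_le_mul_of_nonneg_left (e2.trans hX) (by positivity : 0 ≤ 2 * |β|)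
  have g : coupling m α β * ((‖v‖ + ‖v'‖) ^ 2 * ‖A‖
      + (1 + (‖u‖ + ‖u'‖) * (‖v‖ + ‖v'‖)) * ‖B‖) = coupling m α β * (X + ‖B‖) := by
    rw [hXdef]; ring
  show _ ≤ coupling m α β * ((‖v‖ + ‖v'‖) ^ 2 * ‖A‖
      + (1 + (‖u‖ + ‖u'‖) * (‖v‖ + ‖v'‖)) * ‖B‖)
  rw [g]
  unfold coupling
  nlinarith [mul_nonneg (abs_nonneg m) hX0, mul_nonneg (abs_nonneg α) (norm_nonneg B),
    mul_nonneg (abs_nonneg β) (norm_nonneg B)]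

theorem norm_field_snd_sub_le (m α β : ℝ) (z y : ℂ × ℂ) :
    ‖(field m α β z).2 - (field m α β y).2‖ ≤
      coupling m α β * ((‖z.1‖ + ‖y.1‖) ^ 2 * ‖z.2 - y.2‖
        + (1 + (‖z.2‖ + ‖y.2‖) * (‖z.1‖ + ‖y.1‖)) * ‖z.1 - y.1‖) := by
  simpa [field_swap] using norm_field_fst_sub_le m α β z.swap y.swap

theorem IsSol.swap {m α β s : ℝ} {z : ℂ × ℂ} {w : ℝ → ℂ × ℂ} (h : IsSol m α β s z w) :
    IsSol m α β s z.swap (fun r => (w r).swap) := by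
  refine ⟨by simp [h.1], fun r hr => ?_⟩
  have := h.2 r hr
  rw [field_swap]
  exact this.snd.prodMk this.fst

theorem exists_isSol_flow (m α β : ℝ) {s : ℝ} (hs : 0 ≤ s) (z : ℂ × ℂ) :
    ∃ w, IsSol m α β s z w ∧ w s = flow m α β s z := by
  obtain ⟨w, hw⟩ := exists_isSol m α β hs z
  exact ⟨w, hw, (flow_eq m α β hs hw).symm⟩

theorem flow_swap (m α β : ℝ) {s : ℝ} (hs : 0 ≤ s) (z : ℂ × ℂ) :
    flow m α β s z.swap = (flow m α β s z).swap := by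
  obtain ⟨w, hw, hws⟩ := exists_isSol_flow m α β hs z
  rw [flow_eq m α β hs hw.swap, hws]

theorem flow_zero (m α β : ℝ) {s : ℝ} (hs : 0 ≤ s) : flow m α β s 0 = 0 := by
  refine flow_eq m α β hs (w := fun _ => 0) ⟨rfl, fun r _ => ?_⟩
  rw [field_zero]
  exact hasDerivWithinAt_const _ _ _

theorem IsSol.mass {m α β s : ℝ} {z : ℂ × ℂ} {w : ℝ → ℂ × ℂ} (h : IsSol m α β s z w) :
    ∀ r ∈ Icc 0 s, ‖(w r).1‖ ^ 2 + ‖(w r).2‖ ^ 2 = ‖z.1‖ ^ 2 + ‖z.2‖ ^ 2 := by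
  have := mass_const m α β (s := s) (c := fun _ => 1) (w := w) (by simpa using h.2)
  simpa [h.1] using this

theorem mass_flow (m α β : ℝ) {s : ℝ} (hs : 0 ≤ s) (z : ℂ × ℂ) :
    ‖(flow m α β s z).1‖ ^ 2 + ‖(flow m α β s z).2‖ ^ 2 = ‖z.1‖ ^ 2 + ‖z.2‖ ^ 2 := by
  obtain ⟨w, hw, hws⟩ := exists_isSol_flow m α β hs z
  rw [← hws]
  exact hw.mass s ⟨hs, le_rfl⟩

/-- Grönwall's inequality with the explicit bound `exp (K s) (‖f 0‖ + ε s)`. -/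
theorem norm_le_exp_mul_of_norm_deriv_le {E : Type*} [NormedAddCommGroup E] [NormedSpace ℝ E]
    {f f' : ℝ → E} {s K ε : ℝ} (hK : 0 ≤ K) (hε : 0 ≤ ε)
    (hf : ∀ r ∈ Icc 0 s, HasDerivWithinAt f (f' r) (Icc 0 s) r)
    (hb : ∀ r ∈ Icc 0 s, ‖f' r‖ ≤ K * ‖f r‖ + ε) :
    ∀ r ∈ Icc 0 s, ‖f r‖ ≤ Real.exp (K * s) * (‖f 0‖ + ε * s) := by
  intro r hr
  have h := norm_le_gronwallBound_of_norm_deriv_right_le (f := f) (f' := f') (δ := ‖f 0‖)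
    (K := K) (ε := ε) (a := 0) (b := s) (fun r hr => (hf r hr).continuousWithinAt)
    (fun r hr => (hf r ⟨hr.1, hr.2.le⟩).mono_of_mem_nhdsWithin (Icc_mem_nhdsGE_of_mem hr))
    le_rfl (fun r hr => hb r ⟨hr.1, hr.2.le⟩) r hr
  refine h.trans ?_
  rw [sub_zero]
  have hrs : r ≤ s := hr.2
  have h1 : Real.exp (K * r) ≤ Real.exp (K * s) := by gcongr
  rcases hK.eq_or_lt with rfl | hK
  · rw [gronwallBound_K0]
    simp only [zero_mul, Real.exp_zero, one_mul]
    gcongr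
  · rw [gronwallBound_of_K_ne_0 hK.ne']
    have h2 : Real.exp (K * r) - 1 ≤ K * r * Real.exp (K * r) := by
      have := Real.add_one_le_exp (-(K * r))
      have h3 : Real.exp (-(K * r)) * Real.exp (K * r) = 1 := by
        rw [← Real.exp_add]; simp
      nlinarith [Real.exp_pos (K * r)]
    have h4 : ε / K * (Real.exp (K * r) - 1) ≤ ε * r * Real.exp (K * r) := by
      calc ε / K * (Real.exp (K * r) - 1) ≤ ε / K * (K * r * Real.exp (K * r)) := by gcongr
        _ = ε * r * Real.exp (K * r) := by field_simp
    have h5 : ε * r * Real.exp (K * r) ≤ ε * s * Real.exp (K * s) := by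
      have := hr.1
      have : 0 ≤ s := this.trans hrs
      gcongr
    nlinarith [mul_le_mul_of_nonneg_left h1 (norm_nonneg (f 0))]

/-- Within one time step whose cell carries mass at most `M`, each component stays comparable to
its initial value, up to an additive constant. -/
theorem exists_norm_le_of_isSol (m α β : ℝ) {τmax M : ℝ} (hτmax : 0 ≤ τmax) (hM : 0 ≤ M) :
    ∃ C, 1 ≤ C ∧ ∀ τ, 0 < τ → τ ≤ τmax → ∀ z w, IsSol m α β τ z w →
      τ * (‖z.1‖ ^ 2 + ‖z.2‖ ^ 2) ≤ M → ∀ r ∈ Icc 0 τ,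
        ‖(w r).1‖ ≤ C * (1 + ‖z.1‖) ∧ ‖(w r).2‖ ≤ C * (1 + ‖z.2‖) := by
  set c := coupling m α β with hc
  have hc0 : 0 ≤ c := coupling_nonneg m α β
  set C := Real.exp (2 * c * M) * (1 + c * (M + τmax)) with hC
  have hbase : ∀ τ, 0 < τ → τ ≤ τmax → ∀ z w, IsSol m α β τ z w →
      τ * (‖z.1‖ ^ 2 + ‖z.2‖ ^ 2) ≤ M → ∀ r ∈ Icc 0 τ, ‖(w r).2‖ ≤ C * (1 + ‖z.2‖) := by
    intro τ hτ hτ' z w hw hz r hr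
    set S := Real.sqrt (‖z.1‖ ^ 2 + ‖z.2‖ ^ 2) with hS
    have hS0 : 0 ≤ S := Real.sqrt_nonneg _
    have hS2 : S ^ 2 = ‖z.1‖ ^ 2 + ‖z.2‖ ^ 2 := Real.sq_sqrt (by positivity)
    -- `|u| ≤ S` by mass conservation, so `|v|` grows at rate `O(S²)` with a source `O(S)`; both have
    -- bounded effect because `τ S² ≤ M`
    have hU : ∀ r ∈ Icc 0 τ, ‖(w r).1‖ ≤ S := fun r hr => by
      apply Real.le_sqrt_of_sq_le
      rw [← hw.mass r hr]
      nlinarith [sq_nonneg ‖(w r).2‖]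
    have hg := norm_le_exp_mul_of_norm_deriv_le (f := fun r => (w r).2)
      (f' := fun r => (field m α β (w r)).2) (s := τ) (K := 2 * c * S ^ 2) (ε := c * S)
      (by positivity) (by positivity) (fun r hr => (hw.2 r hr).snd) (fun r hr => by
        have h1 := norm_field_snd_sub_le m α β (w r) 0
        simp only [field_zero, Prod.snd_zero, Prod.fst_zero, sub_zero, norm_zero, add_zero] at h1
        refine h1.trans ?_
        rw [← hc]
        have h2 := hU r hr
        have h3 : ‖(w r).1‖ ^ 2 ≤ S ^ 2 := by gcongr
        have h4 := mul_le_mul_of_nonneg_right h3 (norm_nonneg (w r).2)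
        have : ‖(w r).1‖ ^ 2 * ‖(w r).2‖ + (1 + ‖(w r).2‖ * ‖(w r).1‖) * ‖(w r).1‖ ≤
            2 * S ^ 2 * ‖(w r).2‖ + S := by nlinarith
        nlinarith [mul_le_mul_of_nonneg_left this hc0]) r hr
    refine hg.trans ?_
    simp only [hw.1]
    have h1 : Real.exp (2 * c * S ^ 2 * τ) ≤ Real.exp (2 * c * M) := by
      apply Real.exp_le_exp.2
      have : S ^ 2 * τ ≤ M := by rw [hS2]; linarith
      nlinarith [mul_le_mul_of_nonneg_left this hc0]
    have h2 : S * τ ≤ M + τmax := by nlinarith [sq_nonneg (S - 1)]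
    rw [hC, mul_assoc (Real.exp (2 * c * M))]
    have h3 := mul_le_mul_of_nonneg_left h2 hc0
    have h4 : 0 ≤ c * (M + τmax) * ‖z.2‖ := by positivity
    refine mul_le_mul h1 ?_ (by positivity) (by positivity)
    nlinarith [norm_nonneg z.2]
  refine ⟨C, ?_, fun τ hτ hτ' z w hw hz r hr =>
    ⟨?_, hbase τ hτ hτ' z w hw hz r hr⟩⟩
  · have h1 : 1 ≤ Real.exp (2 * c * M) := Real.one_le_exp (by positivity)
    have h2 : 0 ≤ c * (M + τmax) := by positivity
    rw [hC]
    nlinarith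
  · exact hbase τ hτ hτ' z.swap _ hw.swap (by simpa [add_comm] using hz) r hr

/-- The second-order term of the one-step expansion is absorbed into the exponential factor, since
`τ p²` is bounded. -/
theorem add_second_order_le {L C A B τ p q : ℝ} (hL0 : 0 ≤ L) (hC : 0 ≤ C) (hA0 : 0 ≤ A)
    (hB0 : 0 ≤ B) (hτ : 0 ≤ τ) (hp0 : 0 ≤ p) (hq0 : 0 ≤ q) (hτp : τ * p ^ 2 ≤ C) :
    A + (L * (τ * (p * q * B)) + L * A * (τ * (p * q)) ^ 2) ≤
      Real.exp (L * C * (τ * q ^ 2)) * (A + L * (τ * (p * q * B))) := by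
  have t1 : 1 + L * C * (τ * q ^ 2) ≤ Real.exp (L * C * (τ * q ^ 2)) := by
    linarith [Real.add_one_le_exp (L * C * (τ * q ^ 2))]
  have t2 : (τ * (p * q)) ^ 2 ≤ C * (τ * q ^ 2) := by
    have := mul_le_mul_of_nonneg_right hτp (by positivity : 0 ≤ τ * q ^ 2)
    linarith
  have t4 : L * A * (τ * (p * q)) ^ 2 ≤ L * A * (C * (τ * q ^ 2)) := by gcongr
  have t5 : 0 ≤ L * C * (τ * q ^ 2) * (L * (τ * (p * q * B))) := by positivity
  have t6 := mul_le_mul_of_nonneg_right t1 (by positivity : 0 ≤ A + L * (τ * (p * q * B)))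
  linarith

/-- Comparison of two solutions on one time step, in terms of upper bounds `p` and `q` of the first
and second components whose squares have bounded integral over the step. -/
theorem exists_norm_fst_sub_le_of_isSol (m α β : ℝ) {C₂ : ℝ} (hC₂0 : 0 ≤ C₂) :
    ∃ K, 0 ≤ K ∧ ∀ τ, 0 < τ → ∀ z y w w', IsSol m α β τ z w → IsSol m α β τ y w' →
      ∀ p q, 1 ≤ p → 1 ≤ q → τ * p ^ 2 ≤ C₂ → τ * q ^ 2 ≤ C₂ →
      (∀ r ∈ Icc 0 τ, ‖(w r).1‖ + ‖(w' r).1‖ ≤ p) →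
      (∀ r ∈ Icc 0 τ, ‖(w r).2‖ + ‖(w' r).2‖ ≤ q) →
      ‖(w τ).1 - (w' τ).1‖ ≤
        Real.exp (K * (τ * q ^ 2)) * (‖z.1 - y.1‖ + K * (τ * (p * q * ‖z.2 - y.2‖))) := by
  set c := coupling m α β with hc
  have hc0 : 0 ≤ c := coupling_nonneg m α β
  set C₃ := Real.exp (4 * c * C₂) with hC₃
  set C₄ := Real.exp (c * C₂) * (1 + 2 * c * C₃ * (C₂ + 1)) with hC₄
  have hC₃0 : 0 ≤ C₃ := (Real.exp_pos _).le
  have hC₄0 : 0 ≤ C₄ := by positivity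
  refine ⟨c + 2 * c * C₄ * C₂ + 2 * c * C₄, by positivity, ?_⟩
  intro τ hτ z y w w' hw hw' p q hp1 hq1 hτp hτq hup huq
  have hp0 : 0 ≤ p := zero_le_one.trans hp1
  have hq0 : 0 ≤ q := zero_le_one.trans hq1
  have hpq1 : 1 ≤ p * q := by nlinarith
  have hτpq : τ * (p * q) ≤ C₂ := by linarith [mul_nonneg hτ.le (sq_nonneg (p - q))]
  have hd : ∀ r ∈ Icc 0 τ, HasDerivWithinAt (fun r => w r - w' r)
      (field m α β (w r) - field m α β (w' r)) (Icc 0 τ) r := fun r hr =>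
    (hw.2 r hr).sub (hw'.2 r hr)
  have hd1 : ∀ r ∈ Icc 0 τ, ‖(field m α β (w r) - field m α β (w' r)).1‖ ≤
      c * (q ^ 2 * ‖(w r - w' r).1‖ + 2 * (p * q) * ‖(w r - w' r).2‖) := fun r hr => by
    refine (norm_field_fst_sub_le m α β (w r) (w' r)).trans ?_
    have h1 := hup r hr
    have h2 := huq r hr
    have h3 : 1 + (‖(w r).1‖ + ‖(w' r).1‖) * (‖(w r).2‖ + ‖(w' r).2‖) ≤ 2 * (p * q) := by
      have : (‖(w r).1‖ + ‖(w' r).1‖) * (‖(w r).2‖ + ‖(w' r).2‖) ≤ p * q := by gcongr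
      linarith
    rw [Prod.fst_sub, Prod.snd_sub]
    gcongr
  have hd2 : ∀ r ∈ Icc 0 τ, ‖(field m α β (w r) - field m α β (w' r)).2‖ ≤
      c * (p ^ 2 * ‖(w r - w' r).2‖ + 2 * (p * q) * ‖(w r - w' r).1‖) := fun r hr => by
    refine (norm_field_snd_sub_le m α β (w r) (w' r)).trans ?_
    have h1 := hup r hr
    have h2 := huq r hr
    have h3 : 1 + (‖(w r).2‖ + ‖(w' r).2‖) * (‖(w r).1‖ + ‖(w' r).1‖) ≤ 2 * (p * q) := by
      have : (‖(w r).2‖ + ‖(w' r).2‖) * (‖(w r).1‖ + ‖(w' r).1‖) ≤ q * p := by gcongr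
      linarith
    rw [Prod.fst_sub, Prod.snd_sub]
    gcongr
  have h00 : w 0 - w' 0 = z - y := by rw [hw.1, hw'.1]
  set A := ‖z.1 - y.1‖ with hA
  set B := ‖z.2 - y.2‖ with hB
  have hA0 : 0 ≤ A := norm_nonneg _
  have hB0 : 0 ≤ B := norm_nonneg _
  -- a crude bound for the whole difference, then a refined one for `v`, then the sharp one for `u`
  have hcrude : ∀ r ∈ Icc 0 τ, ‖w r - w' r‖ ≤ C₃ * (A + B) := fun r hr => by
    have h := norm_le_exp_mul_of_norm_deriv_le (K := 2 * c * (p ^ 2 + q ^ 2)) (ε := 0)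
      (by positivity) le_rfl hd (fun r hr => by
        have h1 := hd1 r hr
        have h2 := hd2 r hr
        have n1 := norm_fst_le (w r - w' r)
        have n2 := norm_snd_le (w r - w' r)
        set N := ‖w r - w' r‖ with hN
        have hN0 : 0 ≤ N := norm_nonneg _
        have hpq : 2 * (p * q) ≤ p ^ 2 + q ^ 2 := by nlinarith [sq_nonneg (p - q)]
        rw [Prod.norm_def, max_le_iff, add_zero]
        constructor
        · calc _ ≤ _ := h1
            _ ≤ c * (q ^ 2 * N + (p ^ 2 + q ^ 2) * N) := by gcongr
            _ ≤ _ := by linarith [mul_nonneg (mul_nonneg hc0 (sq_nonneg p)) hN0]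
        · calc _ ≤ _ := h2
            _ ≤ c * (p ^ 2 * N + (p ^ 2 + q ^ 2) * N) := by gcongr
            _ ≤ _ := by linarith [mul_nonneg (mul_nonneg hc0 (sq_nonneg q)) hN0]) r hr
    refine h.trans ?_
    rw [h00, zero_mul, add_zero]
    have h1 : ‖z - y‖ ≤ A + B := by
      rw [Prod.norm_def, max_le_iff, Prod.fst_sub, Prod.snd_sub]
      constructor <;> linarith
    have h2 : Real.exp (2 * c * (p ^ 2 + q ^ 2) * τ) ≤ C₃ := by
      apply Real.exp_le_exp.2
      linarith [mul_le_mul_of_nonneg_left (add_le_add hτp hτq) hc0]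
    gcongr
  have hY : ∀ r ∈ Icc 0 τ, ‖(w r - w' r).2‖ ≤ C₄ * (B + τ * (p * q) * A) := fun r hr => by
    have h := norm_le_exp_mul_of_norm_deriv_le (f := fun r => (w r - w' r).2)
      (K := c * p ^ 2) (ε := 2 * c * (p * q) * (C₃ * (A + B)))
      (by positivity) (by positivity) (fun r hr => (hd r hr).snd) (fun r hr => by
        refine (hd2 r hr).trans ?_
        have := mul_le_mul_of_nonneg_left ((norm_fst_le _).trans (hcrude r hr))
          (by positivity : 0 ≤ 2 * c * (p * q))
        linarith) r hr
    refine h.trans ?_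
    simp only [h00, Prod.snd_sub, ← hB]
    have h1 : Real.exp (c * p ^ 2 * τ) ≤ Real.exp (c * C₂) := by
      apply Real.exp_le_exp.2
      linarith [mul_le_mul_of_nonneg_left hτp hc0]
    rw [hC₄, mul_assoc (Real.exp (c * C₂))]
    refine mul_le_mul h1 ?_ (by positivity) (Real.exp_pos _).le
    have hk : 0 ≤ 2 * c * C₃ := by positivity
    have e1 : 2 * c * C₃ * (τ * (p * q)) * B ≤ 2 * c * C₃ * C₂ * B := by gcongr
    have e2 : 0 ≤ τ * (p * q) * A := by positivity
    have e3 : 0 ≤ 2 * c * C₃ * C₂ * (τ * (p * q) * A) := by positivity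
    have e4 : 0 ≤ 2 * c * C₃ * B := by positivity
    linarith
  have hX := norm_le_exp_mul_of_norm_deriv_le (f := fun r => (w r - w' r).1)
    (K := c * q ^ 2) (ε := 2 * c * (p * q) * (C₄ * (B + τ * (p * q) * A)))
    (by positivity) (by positivity) (fun r hr => (hd r hr).fst) (fun r hr => by
      refine (hd1 r hr).trans ?_
      have := mul_le_mul_of_nonneg_left (hY r hr) (by positivity : 0 ≤ 2 * c * (p * q))
      linarith) τ ⟨hτ.le, le_rfl⟩
  simp only [h00, Prod.fst_sub, ← hA] at hX
  refine hX.trans ?_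
  set L := 2 * c * C₄ with hL
  have hL0 : 0 ≤ L := by positivity
  have s1 := add_second_order_le (L := L) hL0 hC₂0 hA0 hB0 hτ.le hp0 hq0 hτp
  have s2 : A + 2 * c * (p * q) * (C₄ * (B + τ * (p * q) * A)) * τ =
      A + (L * (τ * (p * q * B)) + L * A * (τ * (p * q)) ^ 2) := by rw [hL]; ring
  rw [s2]
  calc Real.exp (c * q ^ 2 * τ) * (A + (L * (τ * (p * q * B)) + L * A * (τ * (p * q)) ^ 2))
      ≤ Real.exp (c * q ^ 2 * τ) *
        (Real.exp (L * C₂ * (τ * q ^ 2)) * (A + L * (τ * (p * q * B)))) := by gcongr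
    _ = Real.exp ((c + L * C₂) * (τ * q ^ 2)) * (A + L * (τ * (p * q * B))) := by
      rw [← mul_assoc, ← Real.exp_add]
      ring_nf
    _ ≤ _ := by
      have h1 : 0 ≤ L * C₂ := by positivity
      have h2 : c + L * C₂ ≤ c + L * C₂ + L := by linarith
      have h3 : L ≤ c + L * C₂ + L := by linarith
      gcongr

/-- Stability of one time step for two states of mass at most `M` in a cell. The growth rate of the
difference of the first components only involves the second components, and the second difference
enters with the product of the weights of both components. -/
theorem exists_norm_flow_fst_sub_le (m α β : ℝ) {τmax M : ℝ} (hτmax : 0 ≤ τmax) (hM : 0 ≤ M) :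
    ∃ K, 0 ≤ K ∧ ∀ τ, 0 < τ → τ ≤ τmax → ∀ z y : ℂ × ℂ,
      τ * (‖z.1‖ ^ 2 + ‖z.2‖ ^ 2) ≤ M → τ * (‖y.1‖ ^ 2 + ‖y.2‖ ^ 2) ≤ M →
      ‖(flow m α β τ z).1 - (flow m α β τ y).1‖ ≤
        Real.exp (K * (τ * (1 + ‖z.2‖ + ‖y.2‖) ^ 2)) * (‖z.1 - y.1‖
          + K * (τ * ((1 + ‖z.1‖ + ‖y.1‖) * (1 + ‖z.2‖ + ‖y.2‖) * ‖z.2 - y.2‖))) := by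
  obtain ⟨C, hC1, hC⟩ := exists_norm_le_of_isSol m α β hτmax hM
  obtain ⟨C, hC1, hC⟩ := exists_norm_le_of_isSol m α β hτmax hM
  have hC0 : 0 ≤ C := zero_le_one.trans hC1
  set C₂ := 12 * C ^ 2 * (τmax + 2 * M) with hC₂
  have hC₂0 : 0 ≤ C₂ := by positivity
  obtain ⟨K, hK0, hK⟩ := exists_norm_fst_sub_le_of_isSol m α β hC₂0
  refine ⟨4 * C ^ 2 * K, by positivity, ?_⟩
  intro τ hτ hτ' z y hz hy
  obtain ⟨w, hw, hwτ⟩ := exists_isSol_flow m α β hτ.le z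
  obtain ⟨w', hw', hwτ'⟩ := exists_isSol_flow m α β hτ.le y
  rw [← hwτ, ← hwτ']
  set P := 1 + ‖z.1‖ + ‖y.1‖ with hP
  set Q := 1 + ‖z.2‖ + ‖y.2‖ with hQ
  set p := 2 * C * P with hp
  set q := 2 * C * Q with hq
  have hP1 : 1 ≤ P := by rw [hP]; linarith [norm_nonneg z.1, norm_nonneg y.1]
  have hQ1 : 1 ≤ Q := by rw [hQ]; linarith [norm_nonneg z.2, norm_nonneg y.2]
  have hp1 : 1 ≤ p := by rw [hp]; nlinarith
  have hq1 : 1 ≤ q := by rw [hq]; nlinarith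
  have hup : ∀ r ∈ Icc 0 τ, ‖(w r).1‖ + ‖(w' r).1‖ ≤ p := fun r hr => by
    have h1 := (hC τ hτ hτ' z w hw hz r hr).1
    have h2 := (hC τ hτ hτ' y w' hw' hy r hr).1
    rw [hp, hP]
    nlinarith [mul_nonneg hC0 (norm_nonneg z.1), mul_nonneg hC0 (norm_nonneg y.1)]
  have huq : ∀ r ∈ Icc 0 τ, ‖(w r).2‖ + ‖(w' r).2‖ ≤ q := fun r hr => by
    have h1 := (hC τ hτ hτ' z w hw hz r hr).2
    have h2 := (hC τ hτ hτ' y w' hw' hy r hr).2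
    rw [hq, hQ]
    nlinarith [mul_nonneg hC0 (norm_nonneg z.2), mul_nonneg hC0 (norm_nonneg y.2)]
  have hsq : ∀ a b : ℝ, τ * a ^ 2 ≤ M → τ * b ^ 2 ≤ M → τ * (2 * C * (1 + a + b)) ^ 2 ≤ C₂ := by
    intro a b ha hb
    have h1 : (1 + a + b) ^ 2 ≤ 3 * (1 + a ^ 2 + b ^ 2) := by
      nlinarith [sq_nonneg (a - b), sq_nonneg (1 - b), sq_nonneg (1 - a)]
    have h2 : τ * (1 + a + b) ^ 2 ≤ 3 * (τmax + 2 * M) := by nlinarith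
    have h3 := mul_le_mul_of_nonneg_left h2 (by positivity : 0 ≤ 4 * C ^ 2)
    rw [hC₂]
    nlinarith
  have hτp : τ * p ^ 2 ≤ C₂ := hsq _ _
    (by nlinarith [mul_nonneg hτ.le (sq_nonneg ‖z.2‖)])
    (by nlinarith [mul_nonneg hτ.le (sq_nonneg ‖y.2‖)])
  have hτq : τ * q ^ 2 ≤ C₂ := hsq _ _
    (by nlinarith [mul_nonneg hτ.le (sq_nonneg ‖z.1‖)])
    (by nlinarith [mul_nonneg hτ.le (sq_nonneg ‖y.1‖)])
  have h := hK τ hτ z y w w' hw hw' p q hp1 hq1 hτp hτq hup huq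
  have hQ2 : q ^ 2 = 4 * C ^ 2 * Q ^ 2 := by rw [hq]; ring
  have hPQ : p * q = 4 * C ^ 2 * (P * Q) := by rw [hp, hq]; ring
  rw [hQ2, hPQ] at h
  refine h.trans (le_of_eq ?_)
  ring_nf

/-! ### Inequalities for nonnegative arrays -/

/-- Discrete Grönwall inequality with variable rates. -/
theorem le_exp_sum_mul_add_sum {a c d : ℕ → ℝ} (hc : ∀ n, 0 ≤ c n)
    (hd : ∀ n, 0 ≤ d n) {N : ℕ} (h : ∀ n < N, a (n + 1) ≤ Real.exp (c n) * (a n + d n)) :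
    ∀ n ≤ N, a n ≤ Real.exp (∑ i ∈ Finset.range n, c i) * (a 0 + ∑ i ∈ Finset.range n, d i) := by
  intro n
  induction n with
  | zero => intro _; simp
  | succ n ih =>
    intro hn
    have h0 : 1 ≤ Real.exp (∑ i ∈ Finset.range n, c i) :=
      Real.one_le_exp (Finset.sum_nonneg fun i _ => hc i)
    rw [Finset.sum_range_succ, Finset.sum_range_succ, Real.exp_add]
    calc a (n + 1) ≤ Real.exp (c n) * (a n + d n) := h n hn
      _ ≤ Real.exp (c n) * (Real.exp (∑ i ∈ Finset.range n, c i)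
            * (a 0 + ∑ i ∈ Finset.range n, d i)
          + Real.exp (∑ i ∈ Finset.range n, c i) * d n) := by
        gcongr
        · exact ih (by omega)
        · exact le_mul_of_one_le_left (hd n) h0
      _ = _ := by ring

/-- Finite sums along an injective family of cells are finite sums over cells. -/
theorem sum_comp_le_of_injective {ι : Type*} {x : ℤ → ℝ} {D : ℝ}
    (h : ∀ s : Finset ℤ, ∑ j ∈ s, x j ≤ D) (s : Finset ι) {e : ι → ℤ}
    (he : Function.Injective e) : ∑ i ∈ s, x (e i) ≤ D := by
  simpa using h (s.map ⟨e, he⟩)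

theorem sum_comp_le_of_card_le {ι : Type*} {x : ℤ → ℝ} {D : ℝ} {N : ℕ}
    (h : ∀ s : Finset ℤ, s.card ≤ N → ∑ j ∈ s, x j ≤ D) {s : Finset ι} (hs : s.card ≤ N)
    {e : ι → ℤ} (he : Function.Injective e) : ∑ i ∈ s, x (e i) ≤ D := by
  simpa using h (s.map ⟨e, he⟩) (by simpa using hs)

/-- Two families of sums along characteristics of opposite families control each other; a small
total weight along characteristics closes the estimate. -/
theorem sum_along_characteristic_le {τ K D ε : ℝ} {N : ℕ} {A B : ℕ → ℤ → ℝ} {P Q : ℤ → ℝ}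
    (hτ : 0 ≤ τ) (hK : 0 ≤ K)
    (hP0 : ∀ j, 0 ≤ P j) (hQ0 : ∀ j, 0 ≤ Q j)
    (hA : ∀ n ≤ N, ∀ j, A n (j + n) ≤
      K * (A 0 j + P j * ∑ i ∈ Finset.range n, τ * B i (j + i + 2)))
    (hB : ∀ n ≤ N, ∀ k, B n (k - n) ≤
      K * (B 0 k + Q k * ∑ i ∈ Finset.range n, τ * A i (k - i - 2)))
    (hAD : ∀ s : Finset ℤ, ∑ j ∈ s, τ * A 0 j ≤ D) (hBD : ∀ s : Finset ℤ, ∑ j ∈ s, τ * B 0 j ≤ D)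
    (hP : ∀ n ≤ N, ∀ k : ℤ, ∑ i ∈ Finset.range n, τ * P (k - 2 * i - 2) ≤ ε)
    (hQ : ∀ n ≤ N, ∀ j : ℤ, ∑ i ∈ Finset.range n, τ * Q (j + 2 * i + 2) ≤ ε)
    (hε : 2 * K * ε ≤ 1) :
    ∀ n ≤ N, (∀ j : ℤ, ∑ i ∈ Finset.range n, τ * B i (j + i + 2) ≤ 2 * K * D) ∧
      (∀ k : ℤ, ∑ i ∈ Finset.range n, τ * A i (k - i - 2) ≤ 2 * K * D) := by
  have hD : 0 ≤ D := by simpa using hAD ∅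
  intro n
  induction n using Nat.strong_induction_on with
  | _ n ih =>
    intro hn
    have hKD : 0 ≤ 2 * K * D := by positivity
    constructor
    · intro j
      have h1 : ∀ i ∈ Finset.range n, τ * B i (j + i + 2) ≤
          K * (τ * B 0 (j + 2 * i + 2)) + K * (2 * K * D) * (τ * Q (j + 2 * i + 2)) := by
        intro i hi
        have hi := Finset.mem_range.1 hi
        have h2 := hB i (by omega) (j + 2 * i + 2)
        have h3 := (ih i hi (by omega)).2 (j + 2 * i + 2)
        have h4 := mul_le_mul_of_nonneg_left h3 (hQ0 (j + 2 * i + 2))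
        have h5 : j + 2 * (i : ℤ) + 2 - i = j + i + 2 := by ring
        rw [h5] at h2
        have h6 := h2.trans (mul_le_mul_of_nonneg_left (add_le_add_right h4 _) hK)
        have h7 := mul_le_mul_of_nonneg_left h6 hτ
        linarith
      refine (Finset.sum_le_sum h1).trans ?_
      rw [Finset.sum_add_distrib, ← Finset.mul_sum _ _ K, ← Finset.mul_sum _ _ (K * (2 * K * D))]
      have h2 := sum_comp_le_of_injective hBD (Finset.range n) (e := fun i : ℕ => j + 2 * i + 2)
        (fun a b hab => by simp only at hab; omega)
      have h3 := hQ n hn j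
      have h4 := mul_le_mul_of_nonneg_left h2 hK
      have h5 := mul_le_mul_of_nonneg_left h3 (by positivity : 0 ≤ K * (2 * K * D))
      have h6 := mul_le_mul_of_nonneg_left hε (by positivity : 0 ≤ K * D)
      linarith
    · intro k
      have h1 : ∀ i ∈ Finset.range n, τ * A i (k - i - 2) ≤
          K * (τ * A 0 (k - 2 * i - 2)) + K * (2 * K * D) * (τ * P (k - 2 * i - 2)) := by
        intro i hi
        have hi := Finset.mem_range.1 hi
        have h2 := hA i (by omega) (k - 2 * i - 2)
        have h3 := (ih i hi (by omega)).1 (k - 2 * i - 2)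
        have h4 := mul_le_mul_of_nonneg_left h3 (hP0 (k - 2 * i - 2))
        have h5 : k - 2 * (i : ℤ) - 2 + i = k - i - 2 := by ring
        rw [h5] at h2
        have h6 := h2.trans (mul_le_mul_of_nonneg_left (add_le_add_right h4 _) hK)
        have h7 := mul_le_mul_of_nonneg_left h6 hτ
        linarith
      refine (Finset.sum_le_sum h1).trans ?_
      rw [Finset.sum_add_distrib, ← Finset.mul_sum _ _ K, ← Finset.mul_sum _ _ (K * (2 * K * D))]
      have h2 := sum_comp_le_of_injective hAD (Finset.range n) (e := fun i : ℕ => k - 2 * i - 2)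
        (fun a b hab => by simp only at hab; omega)
      have h3 := hP n hn k
      have h4 := mul_le_mul_of_nonneg_left h2 hK
      have h5 := mul_le_mul_of_nonneg_left h3 (by positivity : 0 ≤ K * (2 * K * D))
      have h6 := mul_le_mul_of_nonneg_left hε (by positivity : 0 ≤ K * D)
      linarith

/-- One half of the energy bound on a short time interval: the weight splits into a constant, whose
contribution is controlled by the energy at earlier times, and a summable part, whose contribution
is controlled by the sums along characteristics. -/
theorem sum_le_of_weight {τ K D E M κ : ℝ} {n : ℕ} {X : ℤ → ℝ} {X₀ W : ℤ → ℝ} {B : ℕ → ℤ → ℝ}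
    {e : ℤ → ℤ} {d : ℕ → ℤ → ℤ} (he : Function.Injective e) (hd : ∀ i, Function.Injective (d i))
    (hτ : 0 ≤ τ) (hK : 0 ≤ K) (hκ : 0 ≤ κ) (hD : 0 ≤ D)
    (hX : ∀ j, X j ≤ K * (X₀ (e j) + (κ + W (e j)) * ∑ i ∈ Finset.range n, τ * B i (d i j)))
    (hW0 : ∀ j, 0 ≤ W j)
    (hX₀ : ∀ s : Finset ℤ, ∑ j ∈ s, τ * X₀ j ≤ D) (hW : ∀ s : Finset ℤ, ∑ j ∈ s, τ * W j ≤ M)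
    (hchar : ∀ j, ∑ i ∈ Finset.range n, τ * B i (d i j) ≤ 2 * K * D)
    (hE : ∀ i < n, ∀ s : Finset ℤ, ∑ j ∈ s, τ * B i j ≤ E) (s : Finset ℤ) :
    ∑ j ∈ s, τ * X j ≤ K * (D + M * (2 * K * D) + κ * (n * τ) * E) := by
  have h1 : ∀ j ∈ s, τ * X j ≤ K * (τ * X₀ (e j)) + K * (2 * K * D) * (τ * W (e j))
      + K * κ * τ * ∑ i ∈ Finset.range n, τ * B i (d i j) := by
    intro j _
    have h4 := mul_le_mul_of_nonneg_left (hchar j) (mul_nonneg (mul_nonneg hK hτ) (hW0 (e j)))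
    have h6 := mul_le_mul_of_nonneg_left (hX j) hτ
    linarith
  refine (Finset.sum_le_sum h1).trans ?_
  rw [Finset.sum_add_distrib, Finset.sum_add_distrib, ← Finset.mul_sum _ _ K,
    ← Finset.mul_sum _ _ (K * (2 * K * D)), ← Finset.mul_sum _ _ (K * κ * τ),
    Finset.sum_comm (s := s)]
  have h2 := sum_comp_le_of_injective hX₀ s he
  have h3 := sum_comp_le_of_injective hW s he
  have h4 : ∑ i ∈ Finset.range n, ∑ j ∈ s, τ * B i (d i j) ≤ n * E := by
    refine (Finset.sum_le_card_nsmul _ _ E fun i hi => ?_).trans (by simp)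
    exact sum_comp_le_of_injective (hE i (Finset.mem_range.1 hi)) s (hd i)
  have h5 := mul_le_mul_of_nonneg_left h2 hK
  have h6 := mul_le_mul_of_nonneg_left h3 (by positivity : 0 ≤ K * (2 * K * D))
  have h7 := mul_le_mul_of_nonneg_left h4 (by positivity : 0 ≤ K * κ * τ)
  linarith

/-- Energy bound on a time interval so short that the weights are small along characteristics. -/
theorem sum_le_of_short_time {τ K D ε M κ : ℝ} {N : ℕ} {A B : ℕ → ℤ → ℝ} {P Q : ℤ → ℝ}
    (hτ : 0 ≤ τ) (hK : 0 ≤ K) (hκ : 0 ≤ κ)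
    (hP0 : ∀ j, 0 ≤ P j) (hQ0 : ∀ j, 0 ≤ Q j)
    (hA : ∀ n ≤ N, ∀ j, A n (j + n) ≤
      K * (A 0 j + (κ + P j) * ∑ i ∈ Finset.range n, τ * B i (j + i + 2)))
    (hB : ∀ n ≤ N, ∀ k, B n (k - n) ≤
      K * (B 0 k + (κ + Q k) * ∑ i ∈ Finset.range n, τ * A i (k - i - 2)))
    (hAD : ∀ s : Finset ℤ, ∑ j ∈ s, τ * A 0 j ≤ D) (hBD : ∀ s : Finset ℤ, ∑ j ∈ s, τ * B 0 j ≤ D)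
    (hPM : ∀ s : Finset ℤ, ∑ j ∈ s, τ * P j ≤ M) (hQM : ∀ s : Finset ℤ, ∑ j ∈ s, τ * Q j ≤ M)
    (hP : ∀ s : Finset ℤ, s.card ≤ N → ∑ j ∈ s, τ * (κ + P j) ≤ ε)
    (hQ : ∀ s : Finset ℤ, s.card ≤ N → ∑ j ∈ s, τ * (κ + Q j) ≤ ε)
    (hε : 2 * K * ε ≤ 1) (hκN : 2 * K * (κ * (N * τ)) ≤ 1) :
    ∀ n ≤ N, (∀ s : Finset ℤ, ∑ j ∈ s, τ * A n j ≤ 2 * K * (1 + 2 * K * M) * D) ∧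
      ∀ s : Finset ℤ, ∑ j ∈ s, τ * B n j ≤ 2 * K * (1 + 2 * K * M) * D := by
  have hD : 0 ≤ D := by simpa using hAD ∅
  have hM : 0 ≤ M := by simpa using hPM ∅
  have hchar := sum_along_characteristic_le (P := fun j => κ + P j) (Q := fun j => κ + Q j)
    hτ hK (fun j => add_nonneg hκ (hP0 j)) (fun j => add_nonneg hκ (hQ0 j)) hA hB hAD hBD
    (fun n hn k => sum_comp_le_of_card_le hP (by simpa using hn)
      (e := fun i : ℕ => k - 2 * i - 2) fun a b hab => by simp only at hab; omega)
    (fun n hn k => sum_comp_le_of_card_le hQ (by simpa using hn)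
      (e := fun i : ℕ => k + 2 * i + 2) fun a b hab => by simp only at hab; omega) hε
  intro n
  induction n using Nat.strong_induction_on with
  | _ n ih =>
    intro hn
    obtain ⟨cB, cA⟩ := hchar n hn
    have hE : K * (D + M * (2 * K * D) + κ * (n * τ) * (2 * K * (1 + 2 * K * M) * D)) ≤
        2 * K * (1 + 2 * K * M) * D := by
      have h1 : κ * (n * τ) ≤ κ * (N * τ) := by gcongr
      have h2 := mul_le_mul_of_nonneg_left
        ((mul_le_mul_of_nonneg_left h1 (by positivity : 0 ≤ 2 * K)).trans hκN)
        (by positivity : 0 ≤ K * (1 + 2 * K * M) * D)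
      linarith
    constructor
    · intro s
      refine (sum_le_of_weight (X := A n) (X₀ := A 0) (W := P) (B := B) (n := n)
        (e := fun j => j - n) (d := fun i j => j - n + i + 2) ?_ ?_ hτ hK hκ hD ?_ hP0 hAD hPM
        (fun j => cB (j - n)) (fun i hi => (ih i hi (by omega)).2) s).trans hE
      · intro a b hab; simpa using hab
      · intro i a b hab; simpa using hab
      · intro j
        simpa using hA n hn (j - n)
    · intro s
      refine (sum_le_of_weight (X := B n) (X₀ := B 0) (W := Q) (B := A) (n := n)
        (e := fun j => j + n) (d := fun i j => j + n - i - 2) ?_ ?_ hτ hK hκ hD ?_ hQ0 hBD hQM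
        (fun j => cA (j + n)) (fun i hi => (ih i hi (by omega)).1) s).trans hE
      · intro a b hab; simpa using hab
      · intro i a b hab; simpa using hab
      · intro j
        simpa using hB n hn (j + n)

/-- Energy bound on a long time interval, by iteration over short ones. -/
theorem sum_le_of_long_time {τ K D ε M κ : ℝ} {N N₀ : ℕ} {A B : ℕ → ℤ → ℝ} {P Q : ℤ → ℝ}
    (hτ : 0 ≤ τ) (hK : 1 ≤ K) (hκ : 0 ≤ κ)
    (hP0 : ∀ j, 0 ≤ P j) (hQ0 : ∀ j, 0 ≤ Q j)
    (hA : ∀ n₀ n, n₀ + n ≤ N → ∀ j, A (n₀ + n) (j + n₀ + n) ≤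
      K * (A n₀ (j + n₀) + (κ + P j) * ∑ i ∈ Finset.range n, τ * B (n₀ + i) (j + n₀ + i + 2)))
    (hB : ∀ n₀ n, n₀ + n ≤ N → ∀ k, B (n₀ + n) (k - n₀ - n) ≤
      K * (B n₀ (k - n₀) + (κ + Q k) * ∑ i ∈ Finset.range n, τ * A (n₀ + i) (k - n₀ - i - 2)))
    (hAD : ∀ s : Finset ℤ, ∑ j ∈ s, τ * A 0 j ≤ D) (hBD : ∀ s : Finset ℤ, ∑ j ∈ s, τ * B 0 j ≤ D)
    (hPM : ∀ s : Finset ℤ, ∑ j ∈ s, τ * P j ≤ M) (hQM : ∀ s : Finset ℤ, ∑ j ∈ s, τ * Q j ≤ M)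
    (hP : ∀ s : Finset ℤ, s.card ≤ N₀ → ∑ j ∈ s, τ * (κ + P j) ≤ ε)
    (hQ : ∀ s : Finset ℤ, s.card ≤ N₀ → ∑ j ∈ s, τ * (κ + Q j) ≤ ε)
    (hε : 2 * K * ε ≤ 1) (hκN : 2 * K * (κ * (N₀ * τ)) ≤ 1) (r : ℕ) :
    ∀ n ≤ N, n ≤ r * N₀ →
      (∀ s : Finset ℤ, ∑ j ∈ s, τ * A n j ≤ (2 * K * (1 + 2 * K * M)) ^ r * D) ∧
      ∀ s : Finset ℤ, ∑ j ∈ s, τ * B n j ≤ (2 * K * (1 + 2 * K * M)) ^ r * D := by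
  have hK0 : 0 ≤ K := zero_le_one.trans hK
  have hM : 0 ≤ M := by simpa using hPM ∅
  have hD : 0 ≤ D := by simpa using hAD ∅
  have hL : 1 ≤ 2 * K * (1 + 2 * K * M) := by nlinarith [mul_nonneg hK0 (mul_nonneg hK0 hM)]
  induction r with
  | zero =>
    intro n _ hn
    obtain rfl : n = 0 := by omega
    simpa using ⟨hAD, hBD⟩
  | succ r ih =>
    intro n hnN hn
    by_cases hnr : n ≤ r * N₀
    · obtain ⟨h1, h2⟩ := ih n hnN hnr
      have h3 : (2 * K * (1 + 2 * K * M)) ^ r * D ≤ (2 * K * (1 + 2 * K * M)) ^ (r + 1) * D := by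
        exact mul_le_mul_of_nonneg_right (pow_le_pow_right₀ hL (by omega)) hD
      exact ⟨fun s => (h1 s).trans h3, fun s => (h2 s).trans h3⟩
    · obtain ⟨k, rfl⟩ := Nat.exists_eq_add_of_le (not_le.1 hnr).le
      obtain ⟨h1, h2⟩ := ih (r * N₀) (by omega) le_rfl
      set n₀ := r * N₀ with hn₀
      have hk : k ≤ N₀ := by
        have : (r + 1) * N₀ = n₀ + N₀ := by rw [hn₀]; ring
        omega
      have h := sum_le_of_short_time (N := k) (A := fun i j => A (n₀ + i) j)
        (B := fun i j => B (n₀ + i) j) (P := fun j => P (j - n₀)) (Q := fun j => Q (j + n₀))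
        (M := M) (κ := κ) (ε := ε) hτ hK0 hκ
        (fun _ => hP0 _) (fun _ => hQ0 _)
        (fun i hi j => by simpa using hA n₀ i (by omega) (j - n₀))
        (fun i hi j => by simpa using hB n₀ i (by omega) (j + n₀)) h1 h2
        (fun s => sum_comp_le_of_injective hPM s (e := fun j => j - n₀) fun a b hab => by
          simpa using hab)
        (fun s => sum_comp_le_of_injective hQM s (e := fun j => j + n₀) fun a b hab => by
          simpa using hab)
        (fun s hs => sum_comp_le_of_card_le hP (hs.trans hk) (e := fun j => j - n₀)
          fun a b hab => by simpa using hab)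
        (fun s hs => sum_comp_le_of_card_le hQ (hs.trans hk) (e := fun j => j + n₀)
          fun a b hab => by simpa using hab) hε
        (by
          refine le_trans ?_ hκN
          gcongr) k le_rfl
      simpa only [pow_succ', mul_assoc] using h

/-! ### The scheme on cell values -/

/-- `u n j`, `v n j` are the values on the cell `[jτ, (j+1)τ)` at time `nτ` of a time-splitting
solution with mesh size `τ`. -/
def IsScheme (m α β τ : ℝ) (u v : ℕ → ℤ → ℂ) : Prop :=
  ∀ n j, flow m α β τ (u n (j - 1), v n (j + 1)) = (u (n + 1) j, v (n + 1) j)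

/-- The cell-constant functions with values `a`, `b` on cells of length `τ` have total squared
`L²` norm at most `M`. Finite sums avoid any summability side condition. -/
def MassLE (τ M : ℝ) (a b : ℤ → ℂ) : Prop :=
  ∀ s : Finset ℤ, ∑ j ∈ s, τ * (‖a j‖ ^ 2 + ‖b j‖ ^ 2) ≤ M

theorem MassLE.nonneg {τ M : ℝ} {a b : ℤ → ℂ} (h : MassLE τ M a b) : 0 ≤ M := by
  simpa using h ∅

theorem MassLE.reflect {τ M : ℝ} {a b : ℤ → ℂ} (h : MassLE τ M a b) :
    MassLE τ M (fun j => b (-j)) (fun j => a (-j)) := by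
  intro s
  have := sum_comp_le_of_injective h s (e := fun j => -j) neg_injective
  simpa only [add_comm] using this

theorem MassLE.single {τ M : ℝ} {a b : ℤ → ℂ} (h : MassLE τ M a b) (j : ℤ) :
    τ * (‖a j‖ ^ 2 + ‖b j‖ ^ 2) ≤ M := by
  simpa using h {j}

theorem MassLE.pair {τ M : ℝ} {a b : ℤ → ℂ} (hτ : 0 ≤ τ) (h : MassLE τ M a b) (j k : ℤ) :
    τ * (‖a j‖ ^ 2 + ‖b k‖ ^ 2) ≤ 2 * M := by
  have h1 := h.single j
  have h2 := h.single k
  have h3 := mul_nonneg hτ (sq_nonneg ‖b j‖)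
  have h4 := mul_nonneg hτ (sq_nonneg ‖a k‖)
  linarith

theorem MassLE.sum_add_sum_le {τ M : ℝ} {a b : ℤ → ℂ} (hτ : 0 ≤ τ) (h : MassLE τ M a b)
    (s t : Finset ℤ) : ∑ j ∈ s, τ * ‖a j‖ ^ 2 + ∑ j ∈ t, τ * ‖b j‖ ^ 2 ≤ M := by
  have h1 : ∑ j ∈ s, τ * ‖a j‖ ^ 2 ≤ ∑ j ∈ s ∪ t, τ * ‖a j‖ ^ 2 :=
    Finset.sum_le_sum_of_subset_of_nonneg Finset.subset_union_left fun _ _ _ => by positivity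
  have h2 : ∑ j ∈ t, τ * ‖b j‖ ^ 2 ≤ ∑ j ∈ s ∪ t, τ * ‖b j‖ ^ 2 :=
    Finset.sum_le_sum_of_subset_of_nonneg Finset.subset_union_right fun _ _ _ => by positivity
  have h3 := h (s ∪ t)
  simp only [mul_add, Finset.sum_add_distrib] at h3
  linarith

namespace IsScheme

variable {m α β τ : ℝ} {u v : ℕ → ℤ → ℂ}

theorem reflect (hτ : 0 ≤ τ) (h : IsScheme m α β τ u v) :
    IsScheme m α β τ (fun n j => v n (-j)) (fun n j => u n (-j)) := by
  intro n j
  have h1 := flow_swap m α β hτ (u n (-j - 1), v n (-j + 1))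
  rw [h n (-j)] at h1
  rw [show -j - 1 = -(j + 1) by ring, show -j + 1 = -(j - 1) by ring] at h1
  exact h1

theorem shift (h : IsScheme m α β τ u v) (k : ℕ) :
    IsScheme m α β τ (fun n => u (k + n)) (fun n => v (k + n)) :=
  fun n j => h (k + n) j

theorem normSq_add (hτ : 0 ≤ τ) (h : IsScheme m α β τ u v) (n : ℕ) (j : ℤ) :
    ‖u (n + 1) j‖ ^ 2 + ‖v (n + 1) j‖ ^ 2 = ‖u n (j - 1)‖ ^ 2 + ‖v n (j + 1)‖ ^ 2 := by
  have := mass_flow m α β hτ (u n (j - 1), v n (j + 1))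
  rwa [h n j] at this

theorem massLE (hτ : 0 ≤ τ) (h : IsScheme m α β τ u v) {M : ℝ} (h0 : MassLE τ M (u 0) (v 0)) :
    ∀ n, MassLE τ M (u n) (v n) := by
  intro n
  induction n with
  | zero => exact h0
  | succ n ih =>
    intro s
    have := ih.sum_add_sum_le hτ (s.map (Equiv.subRight (1 : ℤ)).toEmbedding)
      (s.map (Equiv.addRight (1 : ℤ)).toEmbedding)
    simp only [h.normSq_add hτ, mul_add, Finset.sum_add_distrib]
    simpa using this

/-- The mass crossing a right-going characteristic is at most the total mass. -/
theorem sum_snd_le (hτ : 0 ≤ τ) (h : IsScheme m α β τ u v) {M : ℝ}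
    (h0 : MassLE τ M (u 0) (v 0)) (j : ℤ) (n : ℕ) :
    ∑ i ∈ Finset.range n, τ * ‖v i (j + i + 2)‖ ^ 2 ≤ M := by
  -- the mass to the right of the characteristic at time `n` is included to make the sum decrease
  have key : ∀ n : ℕ, ∀ s t : Finset ℤ, (∀ k ∈ s, j + n + 1 ≤ k) → (∀ k ∈ t, j + n + 1 ≤ k) →
      ∑ i ∈ Finset.range n, τ * ‖v i (j + i + 2)‖ ^ 2
        + (∑ k ∈ s, τ * ‖u n k‖ ^ 2 + ∑ k ∈ t, τ * ‖v n k‖ ^ 2) ≤ M := by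
    intro n
    induction n with
    | zero =>
      intro s t _ _
      simpa using h0.sum_add_sum_le hτ s t
    | succ n ih =>
      intro s t hs ht
      have hsu : ∑ k ∈ s, τ * ‖u (n + 1) k‖ ^ 2 ≤ ∑ k ∈ s ∪ t, τ * ‖u (n + 1) k‖ ^ 2 :=
        Finset.sum_le_sum_of_subset_of_nonneg Finset.subset_union_left
          fun _ _ _ => by positivity
      have htu : ∑ k ∈ t, τ * ‖v (n + 1) k‖ ^ 2 ≤ ∑ k ∈ s ∪ t, τ * ‖v (n + 1) k‖ ^ 2 :=
        Finset.sum_le_sum_of_subset_of_nonneg Finset.subset_union_right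
          fun _ _ _ => by positivity
      have hst : ∀ k ∈ s ∪ t, j + n + 2 ≤ k := by
        intro k hk
        rcases Finset.mem_union.1 hk with hk | hk
        · have := hs k hk; push_cast at this; omega
        · have := ht k hk; push_cast at this; omega
      have hsum : ∑ k ∈ s ∪ t, τ * ‖u (n + 1) k‖ ^ 2 + ∑ k ∈ s ∪ t, τ * ‖v (n + 1) k‖ ^ 2 =
          ∑ k ∈ (s ∪ t).map (Equiv.subRight (1 : ℤ)).toEmbedding, τ * ‖u n k‖ ^ 2
            + ∑ k ∈ (s ∪ t).map (Equiv.addRight (1 : ℤ)).toEmbedding, τ * ‖v n k‖ ^ 2 := by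
        rw [← Finset.sum_add_distrib]
        simp only [← mul_add, h.normSq_add hτ]
        simp [mul_add, Finset.sum_add_distrib]
      have hnot : j + n + 2 ∉ (s ∪ t).map (Equiv.addRight (1 : ℤ)).toEmbedding := by
        intro hk
        obtain ⟨k, hk, hk'⟩ := Finset.mem_map.1 hk
        have := hst k hk
        simp at hk'
        omega
      have := ih ((s ∪ t).map (Equiv.subRight (1 : ℤ)).toEmbedding)
        (insert (j + n + 2) ((s ∪ t).map (Equiv.addRight (1 : ℤ)).toEmbedding))
        (by
          intro k hk
          obtain ⟨l, hl, rfl⟩ := Finset.mem_map.1 hk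
          have := hst l hl
          simp
          omega)
        (by
          intro k hk
          rcases Finset.mem_insert.1 hk with rfl | hk
          · omega
          · obtain ⟨l, hl, rfl⟩ := Finset.mem_map.1 hk
            have := hst l hl
            simp
            omega)
      rw [Finset.sum_insert hnot] at this
      rw [Finset.sum_range_succ]
      linarith
  simpa using key n ∅ ∅ (by simp) (by simp)

/-- Pointwise domination along right-going characteristics. -/
theorem exists_one_add_norm_fst_le (m α β : ℝ) {τmax M T : ℝ} (hτmax : 0 ≤ τmax) (hM : 0 ≤ M)
    (hT : 0 ≤ T) :
    ∃ D, 1 ≤ D ∧ ∀ τ, 0 < τ → τ ≤ τmax → ∀ u v, IsScheme m α β τ u v → MassLE τ M (u 0) (v 0) →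
      ∀ n : ℕ, n * τ ≤ T → ∀ j : ℤ, 1 + ‖u n (j + n)‖ ≤ D * (1 + ‖u 0 j‖) := by
  obtain ⟨K, hK0, hK⟩ := exists_norm_flow_fst_sub_le m α β hτmax (by positivity : 0 ≤ 2 * M)
  refine ⟨Real.exp (4 * K * (T + M)), Real.one_le_exp (by positivity), ?_⟩
  intro τ hτ hτ' u v h h0 n hn j
  have hmass := h.massLE hτ.le h0
  -- one step, compared with the zero solution; the source term is absorbed by the weight `1 + |u|`
  have hstep : ∀ i < n, 1 + ‖u (i + 1) (j + (i + 1 : ℕ))‖ ≤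
      Real.exp (2 * K * (τ * (1 + ‖v i (j + i + 2)‖) ^ 2)) * (1 + ‖u i (j + i)‖ + 0) := by
    intro i _
    have h1 := hK τ hτ hτ' (u i (j + i), v i (j + i + 2)) 0
      ((hmass i).pair hτ.le _ _) (by simpa using by positivity)
    have h2 := h i (j + i + 1)
    rw [show j + (i : ℤ) + 1 - 1 = j + i by ring, show j + (i : ℤ) + 1 + 1 = j + i + 2 by ring]
      at h2
    rw [h2, flow_zero m α β hτ.le] at h1
    simp only [Prod.fst_zero, Prod.snd_zero, sub_zero, norm_zero, add_zero] at h1 ⊢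
    rw [show j + ((i + 1 : ℕ) : ℤ) = j + i + 1 by push_cast; ring]
    set a := ‖u i (j + i)‖
    set b := ‖v i (j + i + 2)‖
    have ha : 0 ≤ a := norm_nonneg _
    have hb : 0 ≤ b := norm_nonneg _
    set X := K * (τ * (1 + b) ^ 2) with hX
    have hX0 : 0 ≤ X := by positivity
    have h3 : K * (τ * ((1 + a) * (1 + b) * b)) ≤ X * (1 + a) := by
      have : 0 ≤ K * (τ * ((1 + a) * (1 + b))) := by positivity
      rw [hX]
      linarith
    have h4 : 1 ≤ Real.exp X := Real.one_le_exp hX0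
    have h5 : 1 + X ≤ Real.exp X := by linarith [Real.add_one_le_exp X]
    calc 1 + ‖u (i + 1) (j + i + 1)‖ ≤ Real.exp X * 1 + Real.exp X * (a + X * (1 + a)) := by
          have := mul_le_mul_of_nonneg_left h3 (Real.exp_pos X).le
          linarith
      _ = Real.exp X * ((1 + X) * (1 + a)) := by ring
      _ ≤ Real.exp X * (Real.exp X * (1 + a)) := by gcongr
      _ = Real.exp (2 * K * (τ * (1 + b) ^ 2)) * (1 + a) := by
        rw [← mul_assoc, ← Real.exp_add, hX]; ring_nf
  have hg := le_exp_sum_mul_add_sum (a := fun i => 1 + ‖u i (j + i)‖)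
    (c := fun i => 2 * K * (τ * (1 + ‖v i (j + i + 2)‖) ^ 2)) (d := fun _ => 0)
    (fun _ => by positivity) (fun _ => le_rfl) hstep n le_rfl
  simp only [Finset.sum_const_zero, add_zero, Nat.cast_zero] at hg
  refine hg.trans ?_
  have hsum : ∑ i ∈ Finset.range n, 2 * K * (τ * (1 + ‖v i (j + i + 2)‖) ^ 2) ≤
      4 * K * (T + M) := by
    have h1 : ∀ i ∈ Finset.range n, 2 * K * (τ * (1 + ‖v i (j + i + 2)‖) ^ 2) ≤
        4 * K * (τ + τ * ‖v i (j + i + 2)‖ ^ 2) := by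
      intro i _
      have h2 : (1 + ‖v i (j + i + 2)‖) ^ 2 ≤ 2 * (1 + ‖v i (j + i + 2)‖ ^ 2) := by
        nlinarith [sq_nonneg (1 - ‖v i (j + i + 2)‖)]
      have := mul_le_mul_of_nonneg_left h2 (by positivity : 0 ≤ 2 * K * τ)
      linarith
    refine (Finset.sum_le_sum h1).trans ?_
    rw [← Finset.mul_sum, Finset.sum_add_distrib]
    have h3 := h.sum_snd_le hτ.le h0 j n
    have h4 : ∑ i ∈ Finset.range n, τ ≤ T := by simpa using hn
    gcongr
  gcongr

/-- Duhamel estimate along right-going characteristics for the difference of two solutions: the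
weight in front of the interaction term is frozen at its initial value. -/
theorem exists_normSq_fst_sub_le (m α β : ℝ) {τmax M T : ℝ} (hτmax : 0 ≤ τmax) (hM : 0 ≤ M)
    (hT : 0 ≤ T) :
    ∃ C, 1 ≤ C ∧ ∀ τ, 0 < τ → τ ≤ τmax → ∀ u v u' v', IsScheme m α β τ u v →
      IsScheme m α β τ u' v' → MassLE τ M (u 0) (v 0) → MassLE τ M (u' 0) (v' 0) →
      ∀ n₀ n : ℕ, (n₀ + n : ℕ) * τ ≤ T → ∀ j : ℤ,
        ‖u (n₀ + n) (j + n₀ + n) - u' (n₀ + n) (j + n₀ + n)‖ ^ 2 ≤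
          C * (‖u n₀ (j + n₀) - u' n₀ (j + n₀)‖ ^ 2
            + (3 + 3 * (‖u 0 j‖ ^ 2 + ‖u' 0 j‖ ^ 2)) * ∑ i ∈ Finset.range n,
              τ * ‖v (n₀ + i) (j + n₀ + i + 2) - v' (n₀ + i) (j + n₀ + i + 2)‖ ^ 2) := by
  obtain ⟨K, hK0, hK⟩ := exists_norm_flow_fst_sub_le m α β hτmax (by positivity : 0 ≤ 2 * M)
  obtain ⟨D, hD1, hD⟩ := exists_one_add_norm_fst_le m α β hτmax hM hT
  have hD0 : 0 ≤ D := zero_le_one.trans hD1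
  set S := 3 * (T + 2 * M) with hS
  have hS0 : 0 ≤ S := by positivity
  refine ⟨2 * Real.exp (K * S) ^ 2 * (1 + 4 * K ^ 2 * D ^ 2 * S), ?_, ?_⟩
  · have h1 : 1 ≤ Real.exp (K * S) := Real.one_le_exp (by positivity)
    have h2 : 0 ≤ 4 * K ^ 2 * D ^ 2 * S := by positivity
    nlinarith
  intro τ hτ hτ' u v u' v' h h' h0 h0' n₀ n hn j
  have hmass := h.massLE hτ.le h0
  have hmass' := h'.massLE hτ.le h0'
  set a : ℕ → ℝ := fun i => ‖u (n₀ + i) (j + n₀ + i) - u' (n₀ + i) (j + n₀ + i)‖ with ha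
  set b : ℕ → ℝ := fun i => ‖v (n₀ + i) (j + n₀ + i + 2) - v' (n₀ + i) (j + n₀ + i + 2)‖ with hb
  set Q : ℕ → ℝ := fun i =>
    1 + ‖v (n₀ + i) (j + n₀ + i + 2)‖ + ‖v' (n₀ + i) (j + n₀ + i + 2)‖ with hQ
  set p : ℝ := D * (2 + ‖u 0 j‖ + ‖u' 0 j‖) with hp
  have hb0 : ∀ i, 0 ≤ b i := fun i => norm_nonneg _
  have hQ0 : ∀ i, 0 ≤ Q i := fun i => by positivity
  have hp0 : 0 ≤ p := by positivity
  have hstep : ∀ i < n, a (i + 1) ≤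
      Real.exp (K * (τ * Q i ^ 2)) * (a i + K * (τ * (p * Q i * b i))) := by
    intro i hi
    have h1 := hK τ hτ hτ' (u (n₀ + i) (j + n₀ + i), v (n₀ + i) (j + n₀ + i + 2))
      (u' (n₀ + i) (j + n₀ + i), v' (n₀ + i) (j + n₀ + i + 2))
      ((hmass _).pair hτ.le _ _) ((hmass' _).pair hτ.le _ _)
    have e1 : j + n₀ + (i : ℤ) + 1 - 1 = j + n₀ + i := by ring
    have e2 : j + n₀ + (i : ℤ) + 1 + 1 = j + n₀ + i + 2 := by ring
    have h2 := h (n₀ + i) (j + n₀ + i + 1)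
    have h2' := h' (n₀ + i) (j + n₀ + i + 1)
    rw [e1, e2] at h2 h2'
    rw [h2, h2'] at h1
    have hle : ((n₀ + i : ℕ) : ℝ) * τ ≤ T := by
      refine le_trans ?_ hn
      gcongr
    have d1 := hD τ hτ hτ' u v h h0 (n₀ + i) hle j
    have d2 := hD τ hτ hτ' u' v' h' h0' (n₀ + i) hle j
    push_cast at d1 d2
    rw [← add_assoc] at d1 d2
    have hP : 1 + ‖u (n₀ + i) (j + n₀ + i)‖ + ‖u' (n₀ + i) (j + n₀ + i)‖ ≤ p := by
      rw [hp]
      linarith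
    have e3 : a (i + 1) =
        ‖u (n₀ + i + 1) (j + n₀ + i + 1) - u' (n₀ + i + 1) (j + n₀ + i + 1)‖ := by
      simp only [ha]
      push_cast
      simp only [add_assoc]
    rw [e3]
    refine h1.trans ?_
    simp only [ha, hQ, hb]
    gcongr
  have hQsum : ∑ i ∈ Finset.range n, τ * Q i ^ 2 ≤ S := by
    have h1 : ∀ i ∈ Finset.range n, τ * Q i ^ 2 ≤
        3 * (τ + τ * ‖v (n₀ + i) (j + n₀ + i + 2)‖ ^ 2
          + τ * ‖v' (n₀ + i) (j + n₀ + i + 2)‖ ^ 2) := by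
      intro i _
      set x := ‖v (n₀ + i) (j + n₀ + i + 2)‖ with hx
      set y := ‖v' (n₀ + i) (j + n₀ + i + 2)‖ with hy
      have h2 : Q i ^ 2 ≤ 3 * (1 + x ^ 2 + y ^ 2) := by
        simp only [hQ]
        nlinarith [sq_nonneg (1 - x), sq_nonneg (1 - y), sq_nonneg (x - y)]
      have := mul_le_mul_of_nonneg_left h2 hτ.le
      linarith
    refine (Finset.sum_le_sum h1).trans ?_
    rw [← Finset.mul_sum, Finset.sum_add_distrib, Finset.sum_add_distrib]
    have h3 := (h.shift n₀).sum_snd_le hτ.le (hmass n₀) (j + n₀) n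
    have h3' := (h'.shift n₀).sum_snd_le hτ.le (hmass' n₀) (j + n₀) n
    have h4 : ∑ i ∈ Finset.range n, τ ≤ T := by
      refine le_trans ?_ hn
      simp only [Finset.sum_const, Finset.card_range, nsmul_eq_mul]
      gcongr
      omega
    rw [hS]
    linarith
  have hg := le_exp_sum_mul_add_sum (a := a) (c := fun i => K * (τ * Q i ^ 2))
    (d := fun i => K * (τ * (p * Q i * b i))) (fun _ => by positivity)
    (fun i => by have := hb0 i; have := hQ0 i; positivity) hstep n le_rfl
  set Y := ∑ i ∈ Finset.range n, τ * b i ^ 2 with hY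
  have hY0 : 0 ≤ Y := Finset.sum_nonneg fun i _ => by positivity
  set Z := ∑ i ∈ Finset.range n, τ * (Q i * b i) with hZ
  have hZ0 : 0 ≤ Z := Finset.sum_nonneg fun i _ => by
    have := hb0 i; have := hQ0 i; positivity
  -- Cauchy–Schwarz, with the mass crossing the characteristic as the bounded factor
  have hZY : Z ^ 2 ≤ S * Y := by
    have hcs := Finset.sum_mul_sq_le_sq_mul_sq (Finset.range n) (fun i => √τ * Q i)
      (fun i => √τ * b i)
    have e1 : ∀ i, √τ * Q i * (√τ * b i) = τ * (Q i * b i) := fun i => by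
      linear_combination (Q i * b i) * Real.mul_self_sqrt hτ.le
    simp only [e1, mul_pow, Real.sq_sqrt hτ.le] at hcs
    exact hcs.trans (mul_le_mul_of_nonneg_right hQsum hY0)
  have hdsum : ∑ i ∈ Finset.range n, K * (τ * (p * Q i * b i)) = K * p * Z := by
    rw [hZ, Finset.mul_sum]
    exact Finset.sum_congr rfl fun i _ => by ring
  rw [hdsum, ← Finset.mul_sum] at hg
  have hE : Real.exp (K * ∑ i ∈ Finset.range n, τ * Q i ^ 2) ≤ Real.exp (K * S) := by gcongr
  have han : a n ≤ Real.exp (K * S) * (a 0 + K * p * Z) := by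
    refine hg.trans ?_
    have : 0 ≤ a 0 := norm_nonneg _
    gcongr
  have ha0 : a 0 = ‖u n₀ (j + n₀) - u' n₀ (j + n₀)‖ := by simp [ha]
  have hp2 : p ^ 2 ≤ 4 * D ^ 2 * (3 + 3 * (‖u 0 j‖ ^ 2 + ‖u' 0 j‖ ^ 2)) := by
    have : (2 + ‖u 0 j‖ + ‖u' 0 j‖) ^ 2 ≤ 4 * (3 + 3 * (‖u 0 j‖ ^ 2 + ‖u' 0 j‖ ^ 2)) := by
      nlinarith [sq_nonneg (2 - ‖u 0 j‖), sq_nonneg (2 - ‖u' 0 j‖),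
        sq_nonneg (‖u 0 j‖ - ‖u' 0 j‖), sq_nonneg ‖u 0 j‖, sq_nonneg ‖u' 0 j‖]
    rw [hp, mul_pow]
    linarith [mul_le_mul_of_nonneg_left this (sq_nonneg D)]
  show a n ^ 2 ≤ _ * (_ + _ * Y)
  rw [← ha0]
  set W := 3 + 3 * (‖u 0 j‖ ^ 2 + ‖u' 0 j‖ ^ 2) with hW
  have hW0 : 0 ≤ W := by positivity
  have ha00 : 0 ≤ a 0 := norm_nonneg _
  have hann : 0 ≤ a n := norm_nonneg _
  calc a n ^ 2 ≤ (Real.exp (K * S) * (a 0 + K * p * Z)) ^ 2 := by gcongr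
    _ = Real.exp (K * S) ^ 2 * (a 0 + K * p * Z) ^ 2 := by ring
    _ ≤ Real.exp (K * S) ^ 2 * (2 * (a 0 ^ 2 + K ^ 2 * p ^ 2 * Z ^ 2)) := by
      gcongr
      nlinarith [sq_nonneg (a 0 - K * p * Z)]
    _ ≤ Real.exp (K * S) ^ 2 * (2 * (a 0 ^ 2 + K ^ 2 * (4 * D ^ 2 * W) * (S * Y))) := by gcongr
    _ = 2 * Real.exp (K * S) ^ 2 * (a 0 ^ 2 + 4 * K ^ 2 * D ^ 2 * S * (W * Y)) := by ring
    _ ≤ 2 * Real.exp (K * S) ^ 2 * ((1 + 4 * K ^ 2 * D ^ 2 * S) * (a 0 ^ 2 + W * Y)) := by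
      have h1 : 0 ≤ W * Y := by positivity
      have h2 : 0 ≤ 4 * K ^ 2 * D ^ 2 * S * a 0 ^ 2 := by positivity
      gcongr
      linarith
    _ = _ := by ring

/-- Duhamel estimate along left-going characteristics, by reflection. -/
theorem exists_normSq_snd_sub_le (m α β : ℝ) {τmax M T : ℝ} (hτmax : 0 ≤ τmax) (hM : 0 ≤ M)
    (hT : 0 ≤ T) :
    ∃ C, 1 ≤ C ∧ ∀ τ, 0 < τ → τ ≤ τmax → ∀ u v u' v', IsScheme m α β τ u v →
      IsScheme m α β τ u' v' → MassLE τ M (u 0) (v 0) → MassLE τ M (u' 0) (v' 0) →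
      ∀ n₀ n : ℕ, (n₀ + n : ℕ) * τ ≤ T → ∀ k : ℤ,
        ‖v (n₀ + n) (k - n₀ - n) - v' (n₀ + n) (k - n₀ - n)‖ ^ 2 ≤
          C * (‖v n₀ (k - n₀) - v' n₀ (k - n₀)‖ ^ 2
            + (3 + 3 * (‖v 0 k‖ ^ 2 + ‖v' 0 k‖ ^ 2)) * ∑ i ∈ Finset.range n,
              τ * ‖u (n₀ + i) (k - n₀ - i - 2) - u' (n₀ + i) (k - n₀ - i - 2)‖ ^ 2) := by
  obtain ⟨C, hC1, hC⟩ := exists_normSq_fst_sub_le m α β hτmax hM hT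
  refine ⟨C, hC1, fun τ hτ hτ' u v u' v' h h' h0 h0' n₀ n hn k => ?_⟩
  have := hC τ hτ hτ' _ _ _ _ (h.reflect hτ.le) (h'.reflect hτ.le) h0.reflect h0'.reflect n₀ n hn
    (-k)
  simpa only [neg_add, neg_neg, ← sub_eq_add_neg] using this

/-- Stability of the scheme in `L²`. The constants only depend on the total mass and on a scale `δ`
below which the initial mass does not concentrate. -/
theorem exists_stability (m α β : ℝ) {τmax M T : ℝ} (hτmax : 0 ≤ τmax) (hM : 0 ≤ M)
    (hT : 0 ≤ T) :
    ∃ ε, 0 < ε ∧ ∀ δ, 0 < δ → ∃ τ₀, 0 < τ₀ ∧ ∃ C, 0 ≤ C ∧ ∀ τ, 0 < τ → τ ≤ τmax → τ ≤ τ₀ →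
      ∀ u v u' v', IsScheme m α β τ u v → IsScheme m α β τ u' v' →
      MassLE τ M (u 0) (v 0) → MassLE τ M (u' 0) (v' 0) →
      (∀ s : Finset ℤ, s.card * τ ≤ δ → ∑ j ∈ s, τ * (‖u 0 j‖ ^ 2 + ‖v 0 j‖ ^ 2) ≤ ε) →
      (∀ s : Finset ℤ, s.card * τ ≤ δ → ∑ j ∈ s, τ * (‖u' 0 j‖ ^ 2 + ‖v' 0 j‖ ^ 2) ≤ ε) →
      ∀ D, MassLE τ D (fun j => u 0 j - u' 0 j) (fun j => v 0 j - v' 0 j) →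
      ∀ n : ℕ, n * τ ≤ T →
        MassLE τ (C * D) (fun j => u n j - u' n j) (fun j => v n j - v' n j) := by
  obtain ⟨K₁, hK₁, hfst⟩ := exists_normSq_fst_sub_le m α β hτmax hM hT
  obtain ⟨K₂, hK₂, hsnd⟩ := exists_normSq_snd_sub_le m α β hτmax hM hT
  set K := max K₁ K₂ with hKdef
  have hK1 : 1 ≤ K := hK₁.trans (le_max_left _ _)
  have hK : 0 < K := zero_lt_one.trans_le hK1
  refine ⟨1 / (24 * K), by positivity, fun δ hδ => ?_⟩
  -- `δ₁` is the length of the short time intervals over which the block estimate closes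
  set δ₁ := min δ (1 / (12 * K)) with hδ₁
  have hδ₁0 : 0 < δ₁ := lt_min hδ (by positivity)
  have hδ₁K : K * δ₁ ≤ 1 / 12 := by
    calc K * δ₁ ≤ K * (1 / (12 * K)) := by gcongr; exact min_le_right _ _
      _ = 1 / 12 := by field_simp
  set r := ⌈2 * T / δ₁⌉₊ with hr
  refine ⟨δ₁, hδ₁0, 2 * (2 * K * (1 + 2 * K * (6 * M))) ^ r, by positivity, ?_⟩
  intro τ hτ hτ' hτδ u v u' v' h h' h0 h0' hs hs' D hD n hn
  set N₀ := ⌊δ₁ / τ⌋₊ with hN₀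
  have hN₀le : N₀ * τ ≤ δ₁ := by
    have := Nat.floor_le (by positivity : 0 ≤ δ₁ / τ)
    rwa [← hN₀, le_div_iff₀ hτ] at this
  have hN₀ge : δ₁ ≤ 2 * (N₀ * τ) := by
    have h1 := Nat.lt_floor_add_one (δ₁ / τ)
    have h2 : 1 ≤ N₀ := Nat.le_floor (by rw [Nat.cast_one]; exact (one_le_div hτ).2 hτδ)
    have h3 : (1 : ℝ) ≤ N₀ := by exact_mod_cast h2
    rw [← hN₀, div_lt_iff₀ hτ] at h1
    nlinarith
  have hnr : n ≤ r * N₀ := by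
    have h1 : 2 * T / δ₁ ≤ r := Nat.le_ceil _
    rw [div_le_iff₀ hδ₁0] at h1
    have h2 : (r : ℝ) * δ₁ ≤ r * (2 * (N₀ * τ)) := by gcongr
    have h3 : (n : ℝ) * τ ≤ (r * N₀ : ℕ) * τ := by push_cast; linarith
    exact_mod_cast le_of_mul_le_mul_right h3 hτ
  have half : ∀ {a b a' b' : ℤ → ℂ} {X : ℝ} {s : Finset ℤ},
      ∑ j ∈ s, τ * (‖a j‖ ^ 2 + ‖b j‖ ^ 2) ≤ X → ∑ j ∈ s, τ * (‖a' j‖ ^ 2 + ‖b' j‖ ^ 2) ≤ X →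
      ∑ j ∈ s, τ * (3 * (‖a j‖ ^ 2 + ‖a' j‖ ^ 2)) ≤ 6 * X ∧
      ∑ j ∈ s, τ * (3 * (‖b j‖ ^ 2 + ‖b' j‖ ^ 2)) ≤ 6 * X := by
    intro a b a' b' X s h1 h2
    have h3 : 6 * X ≥ ∑ j ∈ s, 3 * (τ * (‖a j‖ ^ 2 + ‖b j‖ ^ 2) +
        τ * (‖a' j‖ ^ 2 + ‖b' j‖ ^ 2)) := by
      rw [← Finset.mul_sum, Finset.sum_add_distrib]
      linarith
    constructor <;> refine le_trans (Finset.sum_le_sum fun j _ => ?_) h3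
    · have := mul_nonneg hτ.le (add_nonneg (sq_nonneg ‖b j‖) (sq_nonneg ‖b' j‖))
      linarith
    · have := mul_nonneg hτ.le (add_nonneg (sq_nonneg ‖a j‖) (sq_nonneg ‖a' j‖))
      linarith
  have hcard : ∀ {X : ℤ → ℝ} {s : Finset ℤ}, s.card ≤ N₀ →
      ∑ j ∈ s, τ * X j ≤ 6 * (1 / (24 * K)) → ∑ j ∈ s, τ * (3 + X j) ≤ 1 / (2 * K) := by
    intro X s hsN hX
    have h1 : (s.card : ℝ) * τ ≤ δ₁ := le_trans (by gcongr) hN₀le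
    have h2 : δ₁ ≤ 1 / (12 * K) := min_le_right _ _
    have h3 : 6 * (1 / (24 * K)) + 3 * (1 / (12 * K)) = 1 / (2 * K) := by field_simp; norm_num
    simp only [mul_add, Finset.sum_add_distrib, Finset.sum_const, nsmul_eq_mul]
    linarith
  have hsδ : ∀ s : Finset ℤ, s.card ≤ N₀ → s.card * τ ≤ δ := fun s hsN =>
    le_trans (by gcongr) (hN₀le.trans (min_le_left _ _))
  have hτn : ∀ k ≤ n, (k : ℝ) * τ ≤ T := fun k hk => le_trans (by gcongr) hn
  have hAD : ∀ s : Finset ℤ, ∑ j ∈ s, τ * ‖u 0 j - u' 0 j‖ ^ 2 ≤ D := fun s => by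
    simpa using hD.sum_add_sum_le hτ.le s ∅
  have hBD : ∀ s : Finset ℤ, ∑ j ∈ s, τ * ‖v 0 j - v' 0 j‖ ^ 2 ≤ D := fun s => by
    simpa using hD.sum_add_sum_le hτ.le ∅ s
  obtain ⟨r1, r2⟩ := sum_le_of_long_time (N := n) (N₀ := N₀) (κ := 3) (M := 6 * M)
    (ε := 1 / (2 * K)) (A := fun n j => ‖u n j - u' n j‖ ^ 2)
    (B := fun n j => ‖v n j - v' n j‖ ^ 2) (P := fun j => 3 * (‖u 0 j‖ ^ 2 + ‖u' 0 j‖ ^ 2))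
    (Q := fun j => 3 * (‖v 0 j‖ ^ 2 + ‖v' 0 j‖ ^ 2)) hτ.le hK1 (by norm_num)
    (fun _ => by positivity) (fun _ => by positivity)
    (fun n₀ k hk j => (hfst τ hτ hτ' u v u' v' h h' h0 h0' n₀ k (hτn _ hk) j).trans (by
      have : 0 ≤ ∑ i ∈ Finset.range k,
        τ * ‖v (n₀ + i) (j + n₀ + i + 2) - v' (n₀ + i) (j + n₀ + i + 2)‖ ^ 2 :=
        Finset.sum_nonneg fun i _ => by positivity
      gcongr
      exact le_max_left _ _))
    (fun n₀ k hk j => (hsnd τ hτ hτ' u v u' v' h h' h0 h0' n₀ k (hτn _ hk) j).trans (by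
      have : 0 ≤ ∑ i ∈ Finset.range k,
        τ * ‖u (n₀ + i) (j - n₀ - i - 2) - u' (n₀ + i) (j - n₀ - i - 2)‖ ^ 2 :=
        Finset.sum_nonneg fun i _ => by positivity
      gcongr
      exact le_max_right _ _))
    hAD hBD (fun s => (half (h0 s) (h0' s)).1) (fun s => (half (h0 s) (h0' s)).2)
    (fun s hsN => hcard hsN (half (hs s (hsδ s hsN)) (hs' s (hsδ s hsN))).1)
    (fun s hsN => hcard hsN (half (hs s (hsδ s hsN)) (hs' s (hsδ s hsN))).2)
    (le_of_eq (by field_simp))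
    (by nlinarith [mul_le_mul_of_nonneg_left hN₀le hK.le]) r n le_rfl hnr
  intro s
  have h1 := r1 s
  have h2 := r2 s
  simp only [mul_add τ, Finset.sum_add_distrib]
  linarith

end IsScheme

/-! ### Bounded cell values: uniform bounds and moduli of continuity -/

/-- On bounded states one step of the flow moves each component by `O(τ)`. -/
theorem norm_flow_fst_sub_self_le (m α β : ℝ) {S τ : ℝ} (hS : 0 ≤ S) (hτ : 0 ≤ τ) {z : ℂ × ℂ}
    (hz₁ : ‖z.1‖ ≤ S) (hz₂ : ‖z.2‖ ≤ S) :
    ‖(flow m α β τ z).1 - z.1‖ ≤ coupling m α β * (16 * S ^ 3 + 2 * S) * τ := by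
  obtain ⟨w, hw, hwτ⟩ := exists_isSol_flow m α β hτ z
  have hb : ∀ r ∈ Icc 0 τ, ‖(w r).1‖ ≤ 2 * S ∧ ‖(w r).2‖ ≤ 2 * S := by
    intro r hr
    have h := hw.mass r hr
    have h1 : ‖z.1‖ ^ 2 ≤ S ^ 2 := by gcongr
    have h2 : ‖z.2‖ ^ 2 ≤ S ^ 2 := by gcongr
    constructor
    · refine le_of_sq_le_sq ?_ (by positivity)
      nlinarith [sq_nonneg ‖(w r).2‖]
    · refine le_of_sq_le_sq ?_ (by positivity)
      nlinarith [sq_nonneg ‖(w r).1‖]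
  have h := (convex_Icc (0 : ℝ) τ).norm_image_sub_le_of_norm_hasDerivWithin_le
    (f := fun r => (w r).1) (f' := fun r => (field m α β (w r)).1)
    (C := coupling m α β * (16 * S ^ 3 + 2 * S)) (fun r hr => (hw.2 r hr).fst)
    (fun r hr => by
      have h1 := norm_field_fst_sub_le m α β (w r) 0
      simp only [field_zero, Prod.snd_zero, Prod.fst_zero, sub_zero, norm_zero, add_zero] at h1
      refine h1.trans (mul_le_mul_of_nonneg_left ?_ (coupling_nonneg m α β))
      obtain ⟨h2, h3⟩ := hb r hr
      calc ‖(w r).2‖ ^ 2 * ‖(w r).1‖ + (1 + ‖(w r).1‖ * ‖(w r).2‖) * ‖(w r).2‖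
          ≤ (2 * S) ^ 2 * (2 * S) + (1 + 2 * S * (2 * S)) * (2 * S) := by gcongr
        _ = 16 * S ^ 3 + 2 * S := by ring)
    (left_mem_Icc.2 hτ) (right_mem_Icc.2 hτ)
  simpa [hw.1, hwτ, abs_of_nonneg hτ] using h

namespace IsScheme

theorem exists_norm_le (m α β : ℝ) {τmax M T : ℝ} (hτmax : 0 ≤ τmax) (hM : 0 ≤ M)
    (hT : 0 ≤ T) {S : ℝ} (hS : 0 ≤ S) :
    ∃ S', 0 ≤ S' ∧ ∀ τ, 0 < τ → τ ≤ τmax → ∀ u v, IsScheme m α β τ u v →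
      MassLE τ M (u 0) (v 0) → (∀ j, ‖u 0 j‖ ≤ S) → (∀ j, ‖v 0 j‖ ≤ S) →
      ∀ n : ℕ, n * τ ≤ T → ∀ j, ‖u n j‖ ≤ S' ∧ ‖v n j‖ ≤ S' := by
  obtain ⟨D, hD1, hD⟩ := exists_one_add_norm_fst_le m α β hτmax hM hT
  have hD0 : 0 ≤ D := zero_le_one.trans hD1
  refine ⟨D * (1 + S), by positivity, fun τ hτ hτ' u v h h0 hu hv n hn j => ⟨?_, ?_⟩⟩
  · have h1 := hD τ hτ hτ' u v h h0 n hn (j - n)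
    have h2 := mul_le_mul_of_nonneg_left (hu (j - n)) hD0
    rw [sub_add_cancel] at h1
    linarith
  · have h1 := hD τ hτ hτ' _ _ (h.reflect hτ.le) h0.reflect n hn (-j - n)
    have h2 := mul_le_mul_of_nonneg_left (hv (-(-j - n))) hD0
    rw [sub_add_cancel, neg_neg] at h1
    linarith

/-- Bounded solutions of the scheme depend in a Lipschitz way on the data in the supremum norm. -/
theorem exists_norm_sub_le_of_norm_le (m α β : ℝ) {τmax M T : ℝ} (hτmax : 0 ≤ τmax) (hM : 0 ≤ M)
    {S : ℝ} (hS : 0 ≤ S) :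
    ∃ L, 0 ≤ L ∧ ∀ τ, 0 < τ → τ ≤ τmax → ∀ u v u' v', IsScheme m α β τ u v →
      IsScheme m α β τ u' v' → MassLE τ M (u 0) (v 0) → MassLE τ M (u' 0) (v' 0) →
      (∀ n : ℕ, n * τ ≤ T → ∀ j, ‖u n j‖ ≤ S ∧ ‖v n j‖ ≤ S) →
      (∀ n : ℕ, n * τ ≤ T → ∀ j, ‖u' n j‖ ≤ S ∧ ‖v' n j‖ ≤ S) →
      ∀ d, 0 ≤ d → (∀ j, ‖u 0 j - u' 0 j‖ ≤ d ∧ ‖v 0 j - v' 0 j‖ ≤ d) →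
      ∀ n : ℕ, n * τ ≤ T → ∀ j, ‖u n j - u' n j‖ ≤ L * d ∧ ‖v n j - v' n j‖ ≤ L * d := by
  obtain ⟨K, hK0, hK⟩ := exists_norm_flow_fst_sub_le m α β hτmax (by positivity : 0 ≤ 2 * M)
  set c := 2 * K * (1 + S + S) ^ 2 with hc
  have hc0 : 0 ≤ c := by positivity
  have hone : ∀ τ, 0 < τ → τ ≤ τmax → ∀ u v u' v', IsScheme m α β τ u v →
      IsScheme m α β τ u' v' → MassLE τ M (u 0) (v 0) → MassLE τ M (u' 0) (v' 0) →
      ∀ n : ℕ, (∀ j, ‖u n j‖ ≤ S ∧ ‖v n j‖ ≤ S) → (∀ j, ‖u' n j‖ ≤ S ∧ ‖v' n j‖ ≤ S) →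
      ∀ d, 0 ≤ d → (∀ j, ‖u n j - u' n j‖ ≤ d ∧ ‖v n j - v' n j‖ ≤ d) →
      ∀ j, ‖u (n + 1) j - u' (n + 1) j‖ ≤ Real.exp (c * τ) * d := by
    intro τ hτ hτ' u v u' v' h h' h0 h0' n hb hb' d hd hdiff j
    have h1 := hK τ hτ hτ' (u n (j - 1), v n (j + 1)) (u' n (j - 1), v' n (j + 1))
      ((h.massLE hτ.le h0 n).pair hτ.le _ _) ((h'.massLE hτ.le h0' n).pair hτ.le _ _)
    rw [h n j, h' n j] at h1
    refine h1.trans ?_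
    have b1 := (hb (j - 1)).1
    have b2 := (hb (j + 1)).2
    have b3 := (hb' (j - 1)).1
    have b4 := (hb' (j + 1)).2
    have d1 := (hdiff (j - 1)).1
    have d2 := (hdiff (j + 1)).2
    set X := K * (τ * (1 + S + S) ^ 2) with hX
    have hX1 : 1 + X ≤ Real.exp X := by linarith [Real.add_one_le_exp X]
    calc _ ≤ Real.exp X * (d + K * (τ * ((1 + S + S) * (1 + S + S) * d))) := by
          rw [hX]; gcongr
      _ = Real.exp X * ((1 + X) * d) := by rw [hX]; ring
      _ ≤ Real.exp X * (Real.exp X * d) := by gcongr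
      _ = Real.exp (c * τ) * d := by rw [← mul_assoc, ← Real.exp_add, hX, hc]; ring_nf
  refine ⟨Real.exp (c * T), (Real.exp_pos _).le, ?_⟩
  intro τ hτ hτ' u v u' v' h h' h0 h0' hb hb' d hd hdiff
  have key : ∀ n : ℕ, n * τ ≤ T → ∀ j,
      ‖u n j - u' n j‖ ≤ Real.exp (c * (n * τ)) * d ∧
      ‖v n j - v' n j‖ ≤ Real.exp (c * (n * τ)) * d := by
    intro n
    induction n with
    | zero => intro _ j; simpa using hdiff j
    | succ n ih =>
      intro hn j
      have hn' : n * τ ≤ T := le_trans (by gcongr; simp) hn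
      have e : Real.exp (c * ((n + 1 : ℕ) * τ)) * d =
          Real.exp (c * τ) * (Real.exp (c * (n * τ)) * d) := by
        rw [show c * ((n + 1 : ℕ) * τ) = c * τ + c * (n * τ) by push_cast; ring, Real.exp_add,
          mul_assoc]
      rw [e]
      have hd' : 0 ≤ Real.exp (c * (n * τ)) * d := by positivity
      constructor
      · exact hone τ hτ hτ' u v u' v' h h' h0 h0' n (hb n hn') (hb' n hn') _ hd' (ih hn') j
      · have := hone τ hτ hτ' _ _ _ _ (h.reflect hτ.le) (h'.reflect hτ.le) h0.reflect h0'.reflect n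
          (fun j => (hb n hn' (-j)).symm) (fun j => (hb' n hn' (-j)).symm) _ hd'
          (fun j => (ih hn' (-j)).symm) (-j)
        simpa using this
  intro n hn j
  obtain ⟨h1, h2⟩ := key n hn j
  have h3 : Real.exp (c * (n * τ)) * d ≤ Real.exp (c * T) * d := by gcongr
  exact ⟨h1.trans h3, h2.trans h3⟩

theorem translate {m α β τ : ℝ} {u v : ℕ → ℤ → ℂ} (h : IsScheme m α β τ u v) (k : ℤ) :
    IsScheme m α β τ (fun n j => u n (j + k)) (fun n j => v n (j + k)) := by
  intro n j
  have := h n (j + k)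
  rwa [show j + k - 1 = j - 1 + k by ring, show j + k + 1 = j + 1 + k by ring] at this

theorem eq_zero_of_lt_abs {m α β τ : ℝ} {u v : ℕ → ℤ → ℂ} (hτ : 0 ≤ τ)
    (h : IsScheme m α β τ u v) {J : ℝ} (h0 : ∀ j : ℤ, J < |(j : ℝ)| → u 0 j = 0 ∧ v 0 j = 0) :
    ∀ (n : ℕ) (j : ℤ), J + n < |(j : ℝ)| → u n j = 0 ∧ v n j = 0 := by
  intro n
  induction n with
  | zero => intro j hj; exact h0 j (by simpa using hj)
  | succ n ih =>
    intro j hj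
    push_cast at hj
    have h1 : J + n < |((j - 1 : ℤ) : ℝ)| := by
      have := abs_add_le ((j : ℝ) - 1) 1
      push_cast
      simp at this
      linarith
    have h2 : J + n < |((j + 1 : ℤ) : ℝ)| := by
      have := abs_add_le ((j : ℝ) + 1) (-1)
      push_cast
      simp at this
      linarith
    have h3 := h n j
    rw [(ih _ h1).1, (ih _ h2).2, show ((0, 0) : ℂ × ℂ) = 0 from rfl, flow_zero m α β hτ] at h3
    exact ⟨(congrArg Prod.fst h3).symm, (congrArg Prod.snd h3).symm⟩

/-- Space-time modulus of continuity of the first component of bounded solutions of the scheme. -/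
theorem exists_modulus_fst (m α β : ℝ) {τmax M T : ℝ} (hτmax : 0 ≤ τmax) (hM : 0 ≤ M)
    (hT : 0 ≤ T) {S : ℝ} (hS : 0 ≤ S) :
    ∃ L, 0 ≤ L ∧ ∀ τ, 0 < τ → τ ≤ τmax → ∀ u v, IsScheme m α β τ u v →
      MassLE τ M (u 0) (v 0) → (∀ j, ‖u 0 j‖ ≤ S) → (∀ j, ‖v 0 j‖ ≤ S) →
      ∀ d δ, (∀ j k : ℤ, |(j : ℝ) - k| * τ ≤ 2 * δ → ‖u 0 j - u 0 k‖ ≤ d ∧ ‖v 0 j - v 0 k‖ ≤ d) →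
      ∀ n n' : ℕ, n * τ ≤ T → n' * τ ≤ T → |(n : ℝ) - n'| * τ ≤ δ →
      ∀ j j' : ℤ, |(j : ℝ) - j'| * τ ≤ δ → ‖u n j - u n' j'‖ ≤ L * (d + δ) := by
  obtain ⟨S', hS'0, hS'⟩ := exists_norm_le m α β hτmax hM hT hS
  obtain ⟨L, hL0, hL⟩ := exists_norm_sub_le_of_norm_le m α β (T := T) hτmax hM hS'0
  set C := coupling m α β * (16 * S' ^ 3 + 2 * S') with hC
  have hC0 : 0 ≤ C := by have := coupling_nonneg m α β; positivity
  refine ⟨L + C, by positivity, ?_⟩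
  intro τ hτ hτ' u v h h0 hu hv d δ hmod
  have hb := hS' τ hτ hτ' u v h h0 hu hv
  have htime : ∀ n k : ℕ, (n + k : ℕ) * τ ≤ T → ∀ j : ℤ,
      ‖u n j - u (n + k) (j + k)‖ ≤ C * (k * τ) := by
    intro n k
    induction k with
    | zero => intro _ j; simp
    | succ k ih =>
      intro hk j
      have hk' : ((n + k : ℕ) : ℝ) * τ ≤ T := le_trans (by gcongr; simp) hk
      have h1 := ih hk' j
      have h2 := norm_flow_fst_sub_self_le m α β hS'0 hτ.le
        (z := (u (n + k) (j + k), v (n + k) (j + k + 2))) (hb _ hk' _).1 (hb _ hk' _).2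
      have h3 := h (n + k) (j + k + 1)
      rw [show j + (k : ℤ) + 1 - 1 = j + k by ring,
        show j + (k : ℤ) + 1 + 1 = j + k + 2 by ring] at h3
      rw [h3, norm_sub_rev] at h2
      have h4 := norm_sub_le_norm_sub_add_norm_sub (u n j) (u (n + k) (j + k))
        (u (n + k + 1) (j + k + 1))
      push_cast
      rw [← add_assoc, ← add_assoc j]
      simp only at h2
      linarith
  have hspace : 0 ≤ d → ∀ n : ℕ, n * τ ≤ T → ∀ j k : ℤ, |(j : ℝ) - k| * τ ≤ 2 * δ →
      ‖u n j - u n k‖ ≤ L * d := by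
    intro hd n hn j k hjk
    have h1 := hL τ hτ hτ' u v _ _ h (h.translate (k - j)) h0
      (fun s => sum_comp_le_of_injective h0 s (e := fun i => i + (k - j)) (add_left_injective _))
      hb (fun n hn i => hb n hn _) d hd (fun i => hmod _ _ (by
        push_cast
        rwa [show (i : ℝ) - (i + (k - j)) = j - k by ring])) n hn j
    simpa using h1.1
  have hle : ∀ n n' : ℕ, n ≤ n' → n' * τ ≤ T → |(n : ℝ) - n'| * τ ≤ δ →
      ∀ j j' : ℤ, |(j : ℝ) - j'| * τ ≤ δ → ‖u n j - u n' j'‖ ≤ (L + C) * (d + δ) := by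
    intro n n' hnn' hn' hδ j j' hj
    obtain ⟨k, rfl⟩ := Nat.exists_eq_add_of_le hnn'
    have hδ0 : 0 ≤ δ := le_trans (by positivity) hδ
    have hd : 0 ≤ d := (norm_nonneg _).trans (hmod 0 0 (by simpa using hδ0)).1
    have hkτ : (k : ℝ) * τ ≤ δ := by simpa using hδ
    have hnT : (n : ℝ) * τ ≤ T := le_trans (by gcongr) hn'
    have h1 := htime n k hn' (j' - k)
    rw [sub_add_cancel] at h1
    have h2 := hspace hd n hnT j (j' - k) (by
      have := abs_add_le ((j : ℝ) - j') k
      rw [abs_of_nonneg (Nat.cast_nonneg k : (0 : ℝ) ≤ k)] at this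
      push_cast
      rw [show (j : ℝ) - (j' - k) = j - j' + k by ring]
      nlinarith)
    have h3 := norm_sub_le_norm_sub_add_norm_sub (u n j) (u n (j' - k)) (u (n + k) j')
    have h4 := mul_le_mul_of_nonneg_left hkτ hC0
    have h5 : 0 ≤ C * d := by positivity
    have h6 : 0 ≤ L * δ := by positivity
    linarith
  intro n n' hn hn' hδ j j' hj
  rcases le_total n n' with hnn | hnn
  · exact hle n n' hnn hn' hδ j j' hj
  · rw [norm_sub_rev]
    exact hle n' n hnn hn (by rwa [abs_sub_comm]) j' j (by rwa [abs_sub_comm])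

theorem exists_modulus_snd (m α β : ℝ) {τmax M T : ℝ} (hτmax : 0 ≤ τmax) (hM : 0 ≤ M)
    (hT : 0 ≤ T) {S : ℝ} (hS : 0 ≤ S) :
    ∃ L, 0 ≤ L ∧ ∀ τ, 0 < τ → τ ≤ τmax → ∀ u v, IsScheme m α β τ u v →
      MassLE τ M (u 0) (v 0) → (∀ j, ‖u 0 j‖ ≤ S) → (∀ j, ‖v 0 j‖ ≤ S) →
      ∀ d δ, (∀ j k : ℤ, |(j : ℝ) - k| * τ ≤ 2 * δ → ‖u 0 j - u 0 k‖ ≤ d ∧ ‖v 0 j - v 0 k‖ ≤ d) →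
      ∀ n n' : ℕ, n * τ ≤ T → n' * τ ≤ T → |(n : ℝ) - n'| * τ ≤ δ →
      ∀ j j' : ℤ, |(j : ℝ) - j'| * τ ≤ δ → ‖v n j - v n' j'‖ ≤ L * (d + δ) := by
  obtain ⟨L, hL0, hL⟩ := exists_modulus_fst m α β hτmax hM hT hS
  refine ⟨L, hL0, ?_⟩
  intro τ hτ hτ' u v h h0 hu hv d δ hmod n n' hn hn' hδ j j' hj
  have := hL τ hτ hτ' _ _ (h.reflect hτ.le) h0.reflect (fun j => hv _) (fun j => hu _) d δ
    (fun j k hjk => (hmod (-j) (-k) (by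
      push_cast
      rwa [← neg_sub', abs_neg])).symm) n n' hn hn' hδ (-j) (-j') (by
      push_cast
      rwa [← neg_sub', abs_neg])
  simpa using this

end IsScheme

/-! ### Cell-constant functions and their `L²` norms -/

/-- The function on `ℝ` with value `c j` on the cell `[jτ, (j+1)τ)`. -/
noncomputable def cellFun (τ : ℝ) (c : ℤ → ℂ) : ℝ → ℂ := fun x => c ⌊x / τ⌋

theorem measurable_floor_div (τ : ℝ) : Measurable fun x : ℝ => ⌊x / τ⌋ :=
  (measurable_id.div_const τ).floor

theorem measurable_cellFun (τ : ℝ) (c : ℤ → ℂ) : Measurable (cellFun τ c) :=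
  (measurable_of_countable c).comp (measurable_floor_div τ)

theorem map_floor_div {τ : ℝ} (hτ : 0 < τ) :
    Measure.map (fun x : ℝ => ⌊x / τ⌋) volume = ENNReal.ofReal τ • Measure.count := by
  refine Measure.ext_of_singleton fun j => ?_
  rw [Measure.map_apply (measurable_floor_div τ) (measurableSet_singleton j)]
  have : (fun x : ℝ => ⌊x / τ⌋) ⁻¹' {j} = Ico (j * τ) ((j + 1) * τ) := by
    ext x
    simp [Int.floor_eq_iff, le_div_iff₀ hτ, div_lt_iff₀ hτ]
  rw [this, Real.volume_Ico]
  simp only [Measure.smul_apply, Measure.count_singleton, smul_eq_mul, mul_one]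
  congr 1
  ring

theorem lintegral_floor_div {τ : ℝ} (hτ : 0 < τ) (F : ℤ → ℝ≥0∞) :
    ∫⁻ x : ℝ, F ⌊x / τ⌋ = ENNReal.ofReal τ * ∑' j, F j := by
  rw [← lintegral_map (measurable_of_countable F) (measurable_floor_div τ), map_floor_div hτ,
    lintegral_smul_measure, lintegral_count, smul_eq_mul]

theorem eLpNorm_two_sq {f : ℝ → ℂ} : eLpNorm f 2 volume ^ 2 = ∫⁻ x, ‖f x‖ₑ ^ 2 := by
  have := eLpNorm_nnreal_pow_eq_lintegral (f := f) (μ := volume) (p := 2) two_ne_zero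
  simpa using this

theorem eLpNorm_cellFun_sq {τ : ℝ} (hτ : 0 < τ) (c : ℤ → ℂ) :
    eLpNorm (cellFun τ c) 2 volume ^ 2 = ∑' j, ENNReal.ofReal (τ * ‖c j‖ ^ 2) := by
  rw [eLpNorm_two_sq]
  refine (lintegral_floor_div hτ fun j => ‖c j‖ₑ ^ 2).trans ?_
  rw [← ENNReal.tsum_mul_left]
  refine tsum_congr fun j => ?_
  rw [ENNReal.ofReal_mul hτ.le, ENNReal.ofReal_pow (norm_nonneg _), ofReal_norm]

theorem sum_le_of_eLpNorm_cellFun_indicator_le {τ : ℝ} (hτ : 0 < τ) {c : ℤ → ℂ} {s : Finset ℤ}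
    {r : ℝ} (hr : 0 ≤ r)
    (h : eLpNorm (((fun x : ℝ => ⌊x / τ⌋) ⁻¹' s).indicator (cellFun τ c)) 2 volume ≤
      ENNReal.ofReal r) : ∑ j ∈ s, τ * ‖c j‖ ^ 2 ≤ r ^ 2 := by
  have e : ((fun x : ℝ => ⌊x / τ⌋) ⁻¹' s).indicator (cellFun τ c) =
      cellFun τ ((s : Set ℤ).indicator c) := by
    ext x
    by_cases hx : ⌊x / τ⌋ ∈ s <;> simp [cellFun, indicator, hx]
  have h1 : eLpNorm (cellFun τ ((s : Set ℤ).indicator c)) 2 volume ^ 2 ≤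
      ENNReal.ofReal (r ^ 2) := by
    rw [ENNReal.ofReal_pow hr, ← e]
    gcongr
  rw [eLpNorm_cellFun_sq hτ] at h1
  have h2 := (ENNReal.sum_le_tsum s).trans h1
  rw [← ENNReal.ofReal_sum_of_nonneg (fun j _ => by positivity),
    ENNReal.ofReal_le_ofReal_iff (by positivity)] at h2
  refine le_trans (le_of_eq (Finset.sum_congr rfl fun j hj => ?_)) h2
  rw [indicator_of_mem (Finset.mem_coe.2 hj)]

theorem sum_le_of_eLpNorm_cellFun_le {τ : ℝ} (hτ : 0 < τ) {c : ℤ → ℂ} {r : ℝ} (hr : 0 ≤ r)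
    (h : eLpNorm (cellFun τ c) 2 volume ≤ ENNReal.ofReal r) (s : Finset ℤ) :
    ∑ j ∈ s, τ * ‖c j‖ ^ 2 ≤ r ^ 2 :=
  sum_le_of_eLpNorm_cellFun_indicator_le hτ hr ((eLpNorm_indicator_le _).trans h)

theorem eLpNorm_cellFun_le_of_sum_le {τ : ℝ} (hτ : 0 < τ) {c : ℤ → ℂ} {r : ℝ} (hr : 0 ≤ r)
    (h : ∀ s : Finset ℤ, ∑ j ∈ s, τ * ‖c j‖ ^ 2 ≤ r ^ 2) :
    eLpNorm (cellFun τ c) 2 volume ≤ ENNReal.ofReal r := by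
  have h1 : eLpNorm (cellFun τ c) 2 volume ^ 2 ≤ ENNReal.ofReal r ^ 2 := by
    rw [eLpNorm_cellFun_sq hτ, ENNReal.tsum_eq_iSup_sum, ← ENNReal.ofReal_pow hr]
    refine iSup_le fun s => ?_
    rw [← ENNReal.ofReal_sum_of_nonneg (fun j _ => by positivity)]
    exact ENNReal.ofReal_le_ofReal (h s)
  exact (ENNReal.pow_le_pow_left_iff two_ne_zero).1 h1

theorem volume_preimage_floor_div {τ : ℝ} (hτ : 0 < τ) (s : Finset ℤ) :
    volume ((fun x : ℝ => ⌊x / τ⌋) ⁻¹' s) = ENNReal.ofReal (s.card * τ) := by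
  rw [← Measure.map_apply (measurable_floor_div τ) s.measurableSet, map_floor_div hτ]
  simp only [Measure.smul_apply, Measure.count_apply_finset, smul_eq_mul]
  rw [mul_comm, ENNReal.ofReal_mul (by positivity), ENNReal.ofReal_natCast]

theorem IsCellConstant.eq_cellFun {τ : ℝ} (hτ : 0 < τ) {f : ℝ → ℂ} (h : IsCellConstant τ f) :
    f = cellFun τ (fun j => f (j * τ)) := by
  ext x
  refine h ⌊x / τ⌋ x ⟨?_, ?_⟩
  · rw [← le_div_iff₀ hτ]; exact Int.floor_le _
  · rw [← div_lt_iff₀ hτ]; exact Int.lt_floor_add_one _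

theorem isCellConstant_cellFun {τ : ℝ} (hτ : 0 < τ) (c : ℤ → ℂ) :
    IsCellConstant τ (cellFun τ c) := by
  intro j x hx
  have h1 : ⌊x / τ⌋ = j := by
    rw [Int.floor_eq_iff, le_div_iff₀ hτ, div_lt_iff₀ hτ]
    exact hx
  simp only [cellFun, h1]
  rw [mul_div_cancel_right₀ _ hτ.ne', Int.floor_intCast]

/-! ### Splitting solutions with cell-constant data -/

/-- One step `S²_τ S¹_τ` acting on cell values. -/
noncomputable def cellStep (m α β τ : ℝ) (w : ℤ → ℂ × ℂ) : ℤ → ℂ × ℂ :=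
  fun j => flow m α β τ ((w (j - 1)).1, (w (j + 1)).2)

/-- Cell values at time `nτ` of the first component of the splitting solution with cell values `w`
at time `0`. -/
noncomputable def cellFst (m α β τ : ℝ) (w : ℤ → ℂ × ℂ) (n : ℕ) (j : ℤ) : ℂ := ((cellStep m α β τ)^[n] w j).1

/-- Cell values at time `nτ` of the second component of the splitting solution with cell values `w`
at time `0`. -/
noncomputable def cellSnd (m α β τ : ℝ) (w : ℤ → ℂ × ℂ) (n : ℕ) (j : ℤ) : ℂ := ((cellStep m α β τ)^[n] w j).2

theorem isScheme_cell (m α β τ : ℝ) (w : ℤ → ℂ × ℂ) :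
    IsScheme m α β τ (cellFst m α β τ w) (cellSnd m α β τ w) := by
  intro n j
  simp only [cellFst, cellSnd, Function.iterate_succ_apply', Prod.mk.eta]
  rfl

theorem iterate_interact_transport (m α β : ℝ) {τ : ℝ} (hτ : 0 < τ) {w : ℝ → ℂ × ℂ}
    {c : ℤ → ℂ × ℂ} (h : ∀ x, w x = c ⌊x / τ⌋) (n : ℕ) (x : ℝ) :
    (fun y => interact m α β τ (transport τ y))^[n] w x = (cellStep m α β τ)^[n] c ⌊x / τ⌋ := by
  induction n generalizing x with
  | zero => exact h x
  | succ n ih =>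
    rw [Function.iterate_succ_apply', Function.iterate_succ_apply']
    simp only [interact, transport, cellStep, ih]
    rw [sub_div, add_div, div_self hτ.ne', Int.floor_sub_one, Int.floor_add_one]

theorem splitting_eq (m α β : ℝ) {τ : ℝ} (hτ : 0 < τ) {f g : ℝ → ℂ} (hf : IsCellConstant τ f)
    (hg : IsCellConstant τ g) (t x : ℝ) :
    splitting m α β τ (fun y => (f y, g y)) t x =
      (cellFst m α β τ (fun j => (f (j * τ), g (j * τ))) ⌊t / τ⌋₊
        ⌊(x - (t - ⌊t / τ⌋₊ * τ)) / τ⌋,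
      cellSnd m α β τ (fun j => (f (j * τ), g (j * τ))) ⌊t / τ⌋₊
        ⌊(x + (t - ⌊t / τ⌋₊ * τ)) / τ⌋) := by
  have h : ∀ x, (fun y => (f y, g y)) x =
      (fun j : ℤ => (f (j * τ), g (j * τ))) ⌊x / τ⌋ := fun x => by
    exact Prod.ext (congrFun (hf.eq_cellFun hτ) x) (congrFun (hg.eq_cellFun hτ) x)
  have hit := iterate_interact_transport m α β hτ (w := fun y => (f y, g y))
    (c := fun j : ℤ => (f (j * τ), g (j * τ))) h ⌊t / τ⌋₊
  have h1 := congrArg Prod.fst (hit (x - (t - ⌊t / τ⌋₊ * τ)))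
  have h2 := congrArg Prod.snd (hit (x + (t - ⌊t / τ⌋₊ * τ)))
  exact Prod.ext h1 h2

theorem splitting_fst_eq (m α β : ℝ) {τ : ℝ} (hτ : 0 < τ) {f g : ℝ → ℂ}
    (hf : IsCellConstant τ f) (hg : IsCellConstant τ g) (t : ℝ) :
    (fun x => (splitting m α β τ (fun y => (f y, g y)) t x).1) =
      cellFun τ (cellFst m α β τ (fun j => (f (j * τ), g (j * τ))) ⌊t / τ⌋₊) ∘
        fun x => x - (t - ⌊t / τ⌋₊ * τ) := by
  ext x
  rw [splitting_eq m α β hτ hf hg]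
  rfl

theorem splitting_snd_eq (m α β : ℝ) {τ : ℝ} (hτ : 0 < τ) {f g : ℝ → ℂ}
    (hf : IsCellConstant τ f) (hg : IsCellConstant τ g) (t : ℝ) :
    (fun x => (splitting m α β τ (fun y => (f y, g y)) t x).2) =
      cellFun τ (cellSnd m α β τ (fun j => (f (j * τ), g (j * τ))) ⌊t / τ⌋₊) ∘
        fun x => x + (t - ⌊t / τ⌋₊ * τ) := by
  ext x
  rw [splitting_eq m α β hτ hf hg]
  rfl

theorem natFloor_div_mul_le {τ t T : ℝ} (hτ : 0 < τ) (ht : t ∈ Icc 0 T) : ⌊t / τ⌋₊ * τ ≤ T := by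
  have h1 := Nat.floor_le (div_nonneg ht.1 hτ.le)
  rw [le_div_iff₀ hτ] at h1
  exact h1.trans ht.2

theorem eLpNorm_comp_sub (f : ℝ → ℂ) (hf : Measurable f) (a : ℝ) :
    eLpNorm (f ∘ fun x => x - a) 2 volume = eLpNorm f 2 volume :=
  eLpNorm_comp_measurePreserving hf.aestronglyMeasurable (measurePreserving_sub_right volume a)

theorem eLpNorm_comp_add (f : ℝ → ℂ) (hf : Measurable f) (a : ℝ) :
    eLpNorm (f ∘ fun x => x + a) 2 volume = eLpNorm f 2 volume :=
  eLpNorm_comp_measurePreserving hf.aestronglyMeasurable (measurePreserving_add_right volume a)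

theorem massLE_of_eLpNorm_le {τ : ℝ} (hτ : 0 < τ) {f g : ℝ → ℂ} (hf : IsCellConstant τ f)
    (hg : IsCellConstant τ g) {r s : ℝ} (hr : 0 ≤ r) (hs : 0 ≤ s)
    (hfr : eLpNorm f 2 volume ≤ ENNReal.ofReal r) (hgs : eLpNorm g 2 volume ≤ ENNReal.ofReal s) :
    MassLE τ (r ^ 2 + s ^ 2) (fun j => f (j * τ)) (fun j => g (j * τ)) := by
  rw [hf.eq_cellFun hτ] at hfr
  rw [hg.eq_cellFun hτ] at hgs
  intro t
  have h1 := sum_le_of_eLpNorm_cellFun_le hτ hr hfr t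
  have h2 := sum_le_of_eLpNorm_cellFun_le hτ hs hgs t
  simp only [mul_add, Finset.sum_add_distrib]
  exact add_le_add h1 h2

/-- The splitting solution stays in `L²`. -/
theorem memLp_splitting (m α β : ℝ) {τ : ℝ} (hτ : 0 < τ) {f g : ℝ → ℂ}
    (hf : IsCellConstant τ f) (hg : IsCellConstant τ g) (hf2 : MemLp f 2 volume)
    (hg2 : MemLp g 2 volume) (t : ℝ) :
    MemLp (fun x => (splitting m α β τ (fun y => (f y, g y)) t x).1) 2 volume ∧
      MemLp (fun x => (splitting m α β τ (fun y => (f y, g y)) t x).2) 2 volume := by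
  have hM := massLE_of_eLpNorm_le hτ hf hg ENNReal.toReal_nonneg ENNReal.toReal_nonneg
    (ENNReal.ofReal_toReal hf2.2.ne).ge (ENNReal.ofReal_toReal hg2.2.ne).ge
  set M := (eLpNorm f 2 volume).toReal ^ 2 + (eLpNorm g 2 volume).toReal ^ 2
  have hn := (isScheme_cell m α β τ (fun j => (f (j * τ), g (j * τ)))).massLE hτ.le hM ⌊t / τ⌋₊
  have hM0 : √M ^ 2 = M := Real.sq_sqrt hM.nonneg
  rw [splitting_fst_eq m α β hτ hf hg, splitting_snd_eq m α β hτ hf hg]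
  constructor
  · refine MemLp.comp_measurePreserving ⟨(measurable_cellFun _ _).aestronglyMeasurable, ?_⟩
      (measurePreserving_sub_right volume _)
    refine (eLpNorm_cellFun_le_of_sum_le hτ (Real.sqrt_nonneg M) fun s => ?_).trans_lt
      ENNReal.ofReal_lt_top
    rw [hM0]
    simpa using hn.sum_add_sum_le hτ.le s ∅
  · refine MemLp.comp_measurePreserving ⟨(measurable_cellFun _ _).aestronglyMeasurable, ?_⟩
      (measurePreserving_add_right volume _)
    refine (eLpNorm_cellFun_le_of_sum_le hτ (Real.sqrt_nonneg M) fun s => ?_).trans_lt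
      ENNReal.ofReal_lt_top
    rw [hM0]
    simpa using hn.sum_add_sum_le hτ.le ∅ s

/-- Cell-constant functions close to a fixed `L²` function do not concentrate, uniformly in the mesh
size. -/
theorem exists_sum_le_of_card_mul_le {u₀ : ℝ → ℂ} (hu₀ : MemLp u₀ 2 volume) {η : ℝ} (hη : 0 < η) :
    ∃ δ, 0 < δ ∧ ∀ τ, 0 < τ → ∀ f, IsCellConstant τ f → MemLp f 2 volume →
      eLpNorm (f - u₀) 2 volume ≤ ENNReal.ofReal η → ∀ s : Finset ℤ, s.card * τ ≤ δ →
      ∑ j ∈ s, τ * ‖f (j * τ)‖ ^ 2 ≤ (2 * η) ^ 2 := by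
  obtain ⟨δ, hδ, h⟩ := hu₀.eLpNorm_indicator_le one_le_two ENNReal.ofNat_ne_top hη
  refine ⟨δ, hδ, fun τ hτ f hf hf2 hfu s hs => ?_⟩
  refine sum_le_of_eLpNorm_cellFun_indicator_le (c := fun j => f (j * τ)) hτ (by positivity) ?_
  rw [← hf.eq_cellFun hτ]
  set A := (fun x : ℝ => ⌊x / τ⌋) ⁻¹' (s : Set ℤ) with hA
  have hAm : MeasurableSet A := measurable_floor_div τ s.measurableSet
  have e : A.indicator f = A.indicator (f - u₀) + A.indicator u₀ := by
    rw [← indicator_add', sub_add_cancel]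
  rw [e]
  refine (eLpNorm_add_le ((hf2.sub hu₀).1.indicator hAm) (hu₀.1.indicator hAm) one_le_two).trans ?_
  rw [two_mul, ENNReal.ofReal_add hη.le hη.le]
  refine add_le_add ((eLpNorm_indicator_le _).trans hfu) (h A hAm ?_)
  rw [hA, volume_preimage_floor_div hτ]
  exact ENNReal.ofReal_le_ofReal hs

/-- Stability in `L²`, uniform in the mesh size, near given `L²` data. -/
theorem exists_splitting_stability (m α β : ℝ) {u₀ v₀ : ℝ → ℂ} (hu₀ : MemLp u₀ 2 volume)
    (hv₀ : MemLp v₀ 2 volume) {τmax T : ℝ} (hτmax : 0 ≤ τmax) (hT : 0 ≤ T) :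
    ∃ η, 0 < η ∧ ∃ τ₀, 0 < τ₀ ∧ ∃ C, 0 ≤ C ∧ ∀ τ, 0 < τ → τ ≤ τmax → τ ≤ τ₀ → ∀ f g f' g',
      IsCellConstant τ f → IsCellConstant τ g → IsCellConstant τ f' → IsCellConstant τ g' →
      MemLp f 2 volume → MemLp g 2 volume → MemLp f' 2 volume → MemLp g' 2 volume →
      eLpNorm (f - u₀) 2 volume ≤ ENNReal.ofReal η → eLpNorm (g - v₀) 2 volume ≤ ENNReal.ofReal η →
      eLpNorm (f' - u₀) 2 volume ≤ ENNReal.ofReal η →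
      eLpNorm (g' - v₀) 2 volume ≤ ENNReal.ofReal η →
      ∀ ρ, 0 ≤ ρ → eLpNorm (f - f') 2 volume ≤ ENNReal.ofReal ρ →
      eLpNorm (g - g') 2 volume ≤ ENNReal.ofReal ρ → ∀ t ∈ Icc 0 T,
        eLpNorm (fun x => (splitting m α β τ (fun y => (f y, g y)) t x).1
          - (splitting m α β τ (fun y => (f' y, g' y)) t x).1) 2 volume ≤ ENNReal.ofReal (C * ρ) ∧
        eLpNorm (fun x => (splitting m α β τ (fun y => (f y, g y)) t x).2
          - (splitting m α β τ (fun y => (f' y, g' y)) t x).2) 2 volume ≤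
            ENNReal.ofReal (C * ρ) := by
  set a := (eLpNorm u₀ 2 volume).toReal with ha
  set b := (eLpNorm v₀ 2 volume).toReal with hb
  have ha0 : 0 ≤ a := ENNReal.toReal_nonneg
  have hb0 : 0 ≤ b := ENNReal.toReal_nonneg
  set M := (1 + a) ^ 2 + (1 + b) ^ 2 with hM
  obtain ⟨ε, hε, hstab⟩ := IsScheme.exists_stability m α β hτmax (by positivity : 0 ≤ M) hT
  -- `η` makes both the perturbation and the local mass of the limit data small compared with `ε`
  set η := min 1 (√(ε / 8)) with hη
  have hη0 : 0 < η := lt_min one_pos (by positivity)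
  have hη1 : η ≤ 1 := min_le_left _ _
  have hη2 : (2 * η) ^ 2 + (2 * η) ^ 2 ≤ ε := by
    have h1 : η ^ 2 ≤ √(ε / 8) ^ 2 := by gcongr; exact min_le_right _ _
    rw [Real.sq_sqrt (by positivity)] at h1
    linarith
  obtain ⟨δ₁, hδ₁, hsmall₁⟩ := exists_sum_le_of_card_mul_le hu₀ hη0
  obtain ⟨δ₂, hδ₂, hsmall₂⟩ := exists_sum_le_of_card_mul_le hv₀ hη0
  obtain ⟨τ₀, hτ₀, C, hC, hstab⟩ := hstab (min δ₁ δ₂) (lt_min hδ₁ hδ₂)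
  have hbound : ∀ {w f : ℝ → ℂ}, MemLp w 2 volume → MemLp f 2 volume →
      eLpNorm (f - w) 2 volume ≤ ENNReal.ofReal η →
      eLpNorm f 2 volume ≤ ENNReal.ofReal (1 + (eLpNorm w 2 volume).toReal) := by
    intro w f hw hf hfw
    rw [ENNReal.ofReal_add zero_le_one ENNReal.toReal_nonneg, ENNReal.ofReal_toReal hw.2.ne]
    calc eLpNorm f 2 volume = eLpNorm ((f - w) + w) 2 volume := by rw [sub_add_cancel]
      _ ≤ eLpNorm (f - w) 2 volume + eLpNorm w 2 volume :=
        eLpNorm_add_le (hf.sub hw).1 hw.1 one_le_two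
      _ ≤ _ := by
        gcongr
        exact hfw.trans (ENNReal.ofReal_le_ofReal hη1)
  refine ⟨η, hη0, τ₀, hτ₀, √(2 * C), by positivity, ?_⟩
  intro τ hτ hτ' hττ₀ f g f' g' hf hg hf' hg' hf2 hg2 hf2' hg2' hfu hgv hfu' hgv' ρ hρ hff hgg t ht
  have hmass := massLE_of_eLpNorm_le hτ hf hg (by positivity) (by positivity) (hbound hu₀ hf2 hfu)
    (hbound hv₀ hg2 hgv)
  have hmass' := massLE_of_eLpNorm_le hτ hf' hg' (by positivity) (by positivity)
    (hbound hu₀ hf2' hfu') (hbound hv₀ hg2' hgv')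
  have hloc : ∀ {f g : ℝ → ℂ}, IsCellConstant τ f → IsCellConstant τ g → MemLp f 2 volume →
      MemLp g 2 volume → eLpNorm (f - u₀) 2 volume ≤ ENNReal.ofReal η →
      eLpNorm (g - v₀) 2 volume ≤ ENNReal.ofReal η → ∀ s : Finset ℤ, s.card * τ ≤ min δ₁ δ₂ →
      ∑ j ∈ s, τ * (‖f (j * τ)‖ ^ 2 + ‖g (j * τ)‖ ^ 2) ≤ ε := by
    intro f g hf hg hf2 hg2 hfu hgv s hs
    have h1 := hsmall₁ τ hτ f hf hf2 hfu s (hs.trans (min_le_left _ _))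
    have h2 := hsmall₂ τ hτ g hg hg2 hgv s (hs.trans (min_le_right _ _))
    simp only [mul_add τ, Finset.sum_add_distrib]
    exact (add_le_add h1 h2).trans hη2
  have hdiff : ∀ {f f' : ℝ → ℂ}, IsCellConstant τ f → IsCellConstant τ f' →
      IsCellConstant τ (f - f') := by
    intro f f' hf hf' j x hx
    simp only [Pi.sub_apply, hf j x hx, hf' j x hx]
  have hD := massLE_of_eLpNorm_le hτ (hdiff hf hf') (hdiff hg hg') hρ hρ hff hgg
  have key := hstab τ hτ hτ' hττ₀ _ _ _ _
    (isScheme_cell m α β τ (fun j => (f (j * τ), g (j * τ))))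
    (isScheme_cell m α β τ (fun j => (f' (j * τ), g' (j * τ)))) hmass hmass'
    (hloc hf hg hf2 hg2 hfu hgv) (hloc hf' hg' hf2' hg2' hfu' hgv') _ hD _
    (natFloor_div_mul_le hτ ht)
  have hCρ : (√(2 * C) * ρ) ^ 2 = C * (ρ ^ 2 + ρ ^ 2) := by
    rw [mul_pow, Real.sq_sqrt (by positivity)]; ring
  constructor
  · have e1 := splitting_fst_eq m α β hτ hf hg t
    have e2 := splitting_fst_eq m α β hτ hf' hg' t
    have e : (fun x => (splitting m α β τ (fun y => (f y, g y)) t x).1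
        - (splitting m α β τ (fun y => (f' y, g' y)) t x).1) =
        cellFun τ (fun j => cellFst m α β τ (fun j => (f (j * τ), g (j * τ))) ⌊t / τ⌋₊ j
          - cellFst m α β τ (fun j => (f' (j * τ), g' (j * τ))) ⌊t / τ⌋₊ j) ∘
          fun x => x - (t - ⌊t / τ⌋₊ * τ) := by
      ext x
      exact congrArg₂ (· - ·) (congrFun e1 x) (congrFun e2 x)
    rw [e, eLpNorm_comp_sub _ (measurable_cellFun _ _)]
    refine eLpNorm_cellFun_le_of_sum_le hτ (by positivity) fun s => ?_
    rw [hCρ]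
    simpa using key.sum_add_sum_le hτ.le s ∅
  · have e1 := splitting_snd_eq m α β hτ hf hg t
    have e2 := splitting_snd_eq m α β hτ hf' hg' t
    have e : (fun x => (splitting m α β τ (fun y => (f y, g y)) t x).2
        - (splitting m α β τ (fun y => (f' y, g' y)) t x).2) =
        cellFun τ (fun j => cellSnd m α β τ (fun j => (f (j * τ), g (j * τ))) ⌊t / τ⌋₊ j
          - cellSnd m α β τ (fun j => (f' (j * τ), g' (j * τ))) ⌊t / τ⌋₊ j) ∘
          fun x => x + (t - ⌊t / τ⌋₊ * τ) := by
      ext x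
      exact congrArg₂ (· - ·) (congrFun e1 x) (congrFun e2 x)
    rw [e, eLpNorm_comp_add _ (measurable_cellFun _ _)]
    refine eLpNorm_cellFun_le_of_sum_le hτ (by positivity) fun s => ?_
    rw [hCρ]
    simpa using key.sum_add_sum_le hτ.le ∅ s

/-! ### A compactness criterion in `C([0,T]; L²)` -/

theorem eLpNorm_le_of_bounded_of_support {f : ℝ → ℂ} {S R : ℝ} (hS : 0 ≤ S) (hR : 0 ≤ R)
    (hb : ∀ x, ‖f x‖ ≤ S) (hs : ∀ x, R < |x| → f x = 0) :
    eLpNorm f 2 volume ≤ ENNReal.ofReal (S * √(2 * R)) := by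
  have h1 : eLpNorm f 2 volume ≤ eLpNorm ((Icc (-R) R).indicator fun _ => S) 2 volume := by
    refine eLpNorm_mono_real fun x => ?_
    by_cases hx : x ∈ Icc (-R) R
    · rw [indicator_of_mem hx]; exact hb x
    · rw [indicator_of_notMem hx, hs x (by rwa [mem_Icc, ← abs_le, not_le] at hx), norm_zero]
  refine h1.trans ((eLpNorm_indicator_const_le _ _).trans ?_)
  rw [Real.volume_Icc, Real.enorm_of_nonneg hS, ENNReal.ofReal_mul hS, Real.sqrt_eq_rpow,
    ENNReal.ofReal_rpow_of_nonneg (by linarith) (by positivity)]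
  simp [two_mul]

theorem eLpNorm_sub_le_add {f g h : ℝ → ℂ} (hf : AEStronglyMeasurable f volume)
    (hg : AEStronglyMeasurable g volume) (hh : AEStronglyMeasurable h volume) :
    eLpNorm (f - h) 2 volume ≤ eLpNorm (f - g) 2 volume + eLpNorm (g - h) 2 volume := by
  rw [← sub_add_sub_cancel f g h]
  exact eLpNorm_add_le (hf.sub hg) (hg.sub hh) one_le_two

/-- A sequence of functions `G k t x` on `[0,T] × ℝ` that is uniformly bounded, uniformly supported
in a compact set, and equicontinuous up to an error vanishing as `k → ∞`. -/
structure IsAsymptoticallyRegular (T : ℝ) (G : ℕ → ℝ → ℝ → ℂ) : Prop where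
  measurable : ∀ k, ∀ t ∈ Icc 0 T, AEStronglyMeasurable (G k t) volume
  bounded : ∃ S, ∀ k, ∀ t ∈ Icc 0 T, ∀ x, ‖G k t x‖ ≤ S
  support : ∃ R, 0 ≤ R ∧ ∀ k, ∀ t ∈ Icc 0 T, ∀ x, R < |x| → G k t x = 0
  equicontinuous : ∀ ε, 0 < ε → ∃ δ, 0 < δ ∧ ∃ K, ∀ k, K ≤ k → ∀ s ∈ Icc 0 T, ∀ t ∈ Icc 0 T,
    ∀ x y, |s - t| < δ → |x - y| < δ → ‖G k s x - G k t y‖ ≤ ε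

/-- A common subsequence along which countably many regular sequences converge at rational points,
by compactness of a countable product of balls. -/
theorem exists_subseq_tendsto_rat {T : ℝ} (hT : 0 ≤ T) {G : ℕ → ℕ → ℝ → ℝ → ℂ}
    (hG : ∀ p, IsAsymptoticallyRegular T (G p)) :
    ∃ φ : ℕ → ℕ, StrictMono φ ∧ ∀ (p : ℕ) (q r : ℚ), (q : ℝ) ∈ Icc 0 T →
      CauchySeq fun k => G p (φ k) q r := by
  choose S hS using fun p => (hG p).bounded
  -- clamping the time to `[0,T]` makes every coordinate bounded
  let H : ℕ → (ℕ × ℚ × ℚ → ℂ) := fun k i => G i.1 k (max 0 (min (i.2.1 : ℝ) T)) i.2.2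
  obtain ⟨a, -, φ, hφ, hlim⟩ := IsCompact.tendsto_subseq (x := H)
    (isCompact_univ_pi fun i : ℕ × ℚ × ℚ => isCompact_closedBall (0 : ℂ) (S i.1))
    (fun k i _ => by
      rw [mem_closedBall_zero_iff]
      exact hS _ _ _ ⟨le_max_left _ _, max_le hT (min_le_right _ _)⟩ _)
  refine ⟨φ, hφ, fun p q r hq => ?_⟩
  have h := (tendsto_pi_nhds.1 hlim (p, q, r)).cauchySeq
  have e : max 0 (min (q : ℝ) T) = q := by rw [min_eq_left hq.2, max_eq_right hq.1]
  simpa only [Function.comp_def, H, e] using h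

theorem exists_nat_div_near {N : ℕ} (hN : 0 < N) {δ : ℝ} (hδ : 1 / (N : ℝ) < δ) (x : ℝ) :
    |x - ⌊x * N⌋ / N| < δ := by
  have hN' : (0 : ℝ) < N := by exact_mod_cast hN
  have h1 : x - ⌊x * N⌋ / N = Int.fract (x * N) / N := by
    rw [Int.fract]; field_simp
  rw [h1, abs_of_nonneg (div_nonneg (Int.fract_nonneg _) hN'.le)]
  refine lt_of_le_of_lt ?_ hδ
  gcongr
  exact (Int.fract_lt_one _).le

/-- Convergence at rational points improves to uniform convergence. -/
theorem IsAsymptoticallyRegular.uniformCauchy {T : ℝ} {G : ℕ → ℝ → ℝ → ℂ}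
    (hG : IsAsymptoticallyRegular T G) {φ : ℕ → ℕ} (hφ : StrictMono φ)
    (hc : ∀ q r : ℚ, (q : ℝ) ∈ Icc 0 T → CauchySeq fun k => G (φ k) q r) {ε : ℝ} (hε : 0 < ε) :
    ∃ K, ∀ k, K ≤ k → ∀ l, K ≤ l → ∀ t ∈ Icc 0 T, ∀ x, ‖G (φ k) t x - G (φ l) t x‖ ≤ ε := by
  obtain ⟨R, hR0, hR⟩ := hG.support
  obtain ⟨δ, hδ, K₀, hK₀⟩ := hG.equicontinuous (ε / 3) (by positivity)
  obtain ⟨n, hn⟩ := exists_nat_one_div_lt hδ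
  set N := n + 1 with hNdef
  have hN : 0 < N := Nat.succ_pos n
  have hN' : (0 : ℝ) < N := by exact_mod_cast hN
  have hNδ : 1 / (N : ℝ) < δ := by rw [hNdef]; push_cast; exact hn
  have hev : ∀ᶠ K in atTop, ∀ i ∈ Finset.Icc (0 : ℤ) ⌊T * N⌋, ∀ j ∈ Finset.Icc ⌊-R * N⌋ ⌊R * N⌋,
      ((i / N : ℚ) : ℝ) ∈ Icc 0 T → ∀ k ≥ K, ∀ l ≥ K,
      dist (G (φ k) (i / N : ℚ) (j / N : ℚ)) (G (φ l) (i / N : ℚ) (j / N : ℚ)) < ε / 3 := by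
    rw [Filter.eventually_all_finset]
    intro i _
    rw [Filter.eventually_all_finset]
    intro j _
    by_cases hi : ((i / N : ℚ) : ℝ) ∈ Icc 0 T
    · obtain ⟨K, hK⟩ := Metric.cauchySeq_iff.1 (hc (i / N) (j / N) hi) (ε / 3) (by positivity)
      exact eventually_atTop.2 ⟨K, fun K' hK' _ k hk l hl =>
        hK k (le_trans hK' hk) l (le_trans hK' hl)⟩
    · exact Eventually.of_forall fun _ h => absurd h hi
  obtain ⟨K₁, hK₁⟩ := hev.exists
  refine ⟨max K₀ K₁, fun k hk l hl t ht x => ?_⟩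
  rcases lt_or_ge R |x| with hx | hx
  · rw [hR _ t ht x hx, hR _ t ht x hx]
    simpa using hε.le
  have hx' := abs_le.1 hx
  have ht1 := exists_nat_div_near hN hNδ t
  have hx1 := exists_nat_div_near hN hNδ x
  set i := ⌊t * N⌋ with hi
  set j := ⌊x * N⌋ with hj
  have hi0 : 0 ≤ i := Int.floor_nonneg.2 (mul_nonneg ht.1 hN'.le)
  have hiI : i ∈ Finset.Icc (0 : ℤ) ⌊T * N⌋ := by
    rw [Finset.mem_Icc]
    exact ⟨hi0, Int.floor_le_floor (mul_le_mul_of_nonneg_right ht.2 hN'.le)⟩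
  have hjI : j ∈ Finset.Icc ⌊-R * N⌋ ⌊R * N⌋ := by
    rw [Finset.mem_Icc]
    exact ⟨Int.floor_le_floor (mul_le_mul_of_nonneg_right hx'.1 hN'.le),
      Int.floor_le_floor (mul_le_mul_of_nonneg_right hx'.2 hN'.le)⟩
  have hiT : ((i / N : ℚ) : ℝ) ∈ Icc 0 T := by
    push_cast
    refine ⟨div_nonneg (by exact_mod_cast hi0) hN'.le, ?_⟩
    rw [div_le_iff₀ hN']
    exact (Int.floor_le _).trans (mul_le_mul_of_nonneg_right ht.2 hN'.le)
  have h2 := hK₁ i hiI j hjI hiT k ((le_max_right _ _).trans hk) l ((le_max_right _ _).trans hl)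
  have h1 := hK₀ (φ k) ((le_max_left _ _).trans (hk.trans (hφ.id_le k))) t ht _ hiT x
    ((j / N : ℚ) : ℝ) (by push_cast; exact ht1) (by push_cast; exact hx1)
  have h3 := hK₀ (φ l) ((le_max_left _ _).trans (hl.trans (hφ.id_le l))) t ht _ hiT x
    ((j / N : ℚ) : ℝ) (by push_cast; exact ht1) (by push_cast; exact hx1)
  rw [← dist_eq_norm] at h1 h3 ⊢
  have h4 := dist_triangle4_right (G (φ k) t x) (G (φ l) t x)
    (G (φ k) (i / N : ℚ) (j / N : ℚ)) (G (φ l) (i / N : ℚ) (j / N : ℚ))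
  linarith

/-- A sequence of maps `[0,T] → L²` that is approximated uniformly in time, up to arbitrarily small
errors, by regular sequences has a subsequence converging uniformly to a continuous map. -/
theorem exists_subseq_tendsto_of_approx {T : ℝ} (hT : 0 ≤ T) {F : ℕ → ℝ → ℝ → ℂ}
    (hF : ∀ k, ∀ t ∈ Icc 0 T, MemLp (F k t) 2 volume)
    (happ : ∀ ε, 0 < ε → ∃ G, IsAsymptoticallyRegular T G ∧ ∃ K, ∀ k, K ≤ k → ∀ t ∈ Icc 0 T,
      eLpNorm (F k t - G k t) 2 volume ≤ ENNReal.ofReal ε) :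
    ∃ φ : ℕ → ℕ, StrictMono φ ∧ ∃ U : C(Icc (0 : ℝ) T, Lp ℂ 2 (volume : Measure ℝ)),
      Tendsto (fun k => ⨆ t : Icc (0 : ℝ) T,
        eLpNorm (fun x => F (φ k) t x - U t x) 2 volume) atTop (𝓝 0) := by
  choose G hG K hGF using fun p : ℕ => happ (1 / (p + 1)) Nat.one_div_pos_of_nat
  obtain ⟨φ, hφ, hφc⟩ := exists_subseq_tendsto_rat hT hG
  -- comparison of two values of `F` through an approximating regular sequence
  have hcomp : ∀ p k l s t, s ∈ Icc 0 T → t ∈ Icc 0 T → K p ≤ k → K p ≤ l →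
      eLpNorm (F k s - F l t) 2 volume ≤ ENNReal.ofReal (1 / (p + 1))
        + eLpNorm (G p k s - G p l t) 2 volume + ENNReal.ofReal (1 / (p + 1)) := by
    intro p k l s t hs ht hk hl
    have mF := (hF k s hs).1
    have mF' := (hF l t ht).1
    have mG := (hG p).measurable k s hs
    have mG' := (hG p).measurable l t ht
    refine (eLpNorm_sub_le_add mF mG' mF').trans ?_
    refine add_le_add ((eLpNorm_sub_le_add mF mG mG').trans ?_) ?_
    · gcongr
      exact hGF p k hk s hs
    · rw [eLpNorm_sub_comm]
      exact hGF p l hl t ht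
  have hsmall : ∀ ε : ℝ, 0 < ε → ∃ p : ℕ, ∀ X : ℝ≥0∞, X ≤ ENNReal.ofReal (ε / 3) →
      ENNReal.ofReal (1 / (p + 1)) + X + ENNReal.ofReal (1 / (p + 1)) ≤ ENNReal.ofReal ε := by
    intro ε hε
    obtain ⟨p, hp⟩ := exists_nat_one_div_lt (by positivity : 0 < ε / 3)
    refine ⟨p, fun X hX => ?_⟩
    have h1 := ENNReal.ofReal_le_ofReal hp.le
    calc _ ≤ ENNReal.ofReal (ε / 3) + ENNReal.ofReal (ε / 3) + ENNReal.ofReal (ε / 3) := by gcongr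
      _ = ENNReal.ofReal ε := by
        rw [← ENNReal.ofReal_add (by positivity) (by positivity),
          ← ENNReal.ofReal_add (by positivity) (by positivity)]
        congr 1
        ring
  have hcauchy : ∀ ε : ℝ, 0 < ε → ∃ K', ∀ k, K' ≤ k → ∀ l, K' ≤ l → ∀ t ∈ Icc 0 T,
      eLpNorm (F (φ k) t - F (φ l) t) 2 volume ≤ ENNReal.ofReal ε := by
    intro ε hε
    obtain ⟨p, hp⟩ := hsmall ε hε
    obtain ⟨R, hR0, hR⟩ := (hG p).support
    obtain ⟨K₁, hK₁⟩ := (hG p).uniformCauchy hφ (hφc p) (ε := ε / 3 / (√(2 * R) + 1))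
      (by positivity)
    refine ⟨max (K p) K₁, fun k hk l hl t ht => ?_⟩
    refine (hcomp p _ _ t t ht ht ((le_max_left _ _).trans (hk.trans (hφ.id_le k)))
      ((le_max_left _ _).trans (hl.trans (hφ.id_le l)))).trans (hp _ ?_)
    refine (eLpNorm_le_of_bounded_of_support (S := ε / 3 / (√(2 * R) + 1)) (by positivity) hR0
      (hK₁ k ((le_max_right _ _).trans hk) l ((le_max_right _ _).trans hl) t ht)
      fun x hx => ?_).trans (ENNReal.ofReal_le_ofReal ?_)
    · rw [hR _ t ht x hx, hR _ t ht x hx, sub_zero]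
    · rw [div_mul_eq_mul_div, div_le_iff₀ (by positivity)]
      gcongr
      linarith
  have hequi : ∀ ε : ℝ, 0 < ε → ∃ δ, 0 < δ ∧ ∃ K', ∀ k, K' ≤ k → ∀ s ∈ Icc 0 T, ∀ t ∈ Icc 0 T,
      |s - t| < δ → eLpNorm (F (φ k) s - F (φ k) t) 2 volume ≤ ENNReal.ofReal ε := by
    intro ε hε
    obtain ⟨p, hp⟩ := hsmall ε hε
    obtain ⟨R, hR0, hR⟩ := (hG p).support
    obtain ⟨δ, hδ, K₁, hK₁⟩ := (hG p).equicontinuous (ε / 3 / (√(2 * R) + 1)) (by positivity)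
    refine ⟨δ, hδ, max (K p) K₁, fun k hk s hs t ht hst => ?_⟩
    have hk' := hk.trans (hφ.id_le k)
    refine (hcomp p _ _ s t hs ht ((le_max_left _ _).trans hk')
      ((le_max_left _ _).trans hk')).trans (hp _ ?_)
    refine (eLpNorm_le_of_bounded_of_support (S := ε / 3 / (√(2 * R) + 1)) (by positivity) hR0
      (fun x => hK₁ _ ((le_max_right _ _).trans hk') s hs t ht x x hst (by simpa using hδ))
      fun x hx => ?_).trans (ENNReal.ofReal_le_ofReal ?_)
    · rw [hR _ s hs x hx, hR _ t ht x hx, sub_zero]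
    · rw [div_mul_eq_mul_div, div_le_iff₀ (by positivity)]
      gcongr
      linarith
  let f : ℕ → Icc (0 : ℝ) T → Lp ℂ 2 (volume : Measure ℝ) := fun k t => (hF (φ k) t t.2).toLp _
  have hdist : ∀ k l s t ε, 0 ≤ ε →
      eLpNorm (F (φ k) (s : Icc (0 : ℝ) T) - F (φ l) (t : Icc (0 : ℝ) T)) 2 volume ≤
        ENNReal.ofReal ε → dist (f k s) (f l t) ≤ ε := by
    intro k l s t ε hε h
    rw [← edist_le_ofReal hε, Lp.edist_toLp_toLp]
    exact h
  have hlim : ∀ t, ∃ y, Tendsto (fun k => f k t) atTop (𝓝 y) := by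
    intro t
    refine cauchySeq_tendsto_of_complete (Metric.cauchySeq_iff.2 fun ε hε => ?_)
    obtain ⟨K', hK'⟩ := hcauchy (ε / 2) (by positivity)
    exact ⟨K', fun k hk l hl => (hdist k l t t (ε / 2) (by positivity)
      (hK' k hk l hl t t.2)).trans_lt (half_lt_self hε)⟩
  choose U hU using hlim
  have hunif : ∀ ε : ℝ, 0 < ε → ∃ K', ∀ k, K' ≤ k → ∀ t, dist (f k t) (U t) ≤ ε := by
    intro ε hε
    obtain ⟨K', hK'⟩ := hcauchy ε hε
    refine ⟨K', fun k hk t => ?_⟩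
    refine le_of_tendsto (tendsto_const_nhds.dist (hU t)) ?_
    filter_upwards [eventually_ge_atTop K'] with l hl
    exact hdist k l t t ε hε.le (hK' k hk l hl t t.2)
  have hUcont : Continuous U := by
    rw [Metric.continuous_iff]
    intro t ε hε
    obtain ⟨δ, hδ, K₁, hK₁⟩ := hequi (ε / 4) (by positivity)
    obtain ⟨K₂, hK₂⟩ := hunif (ε / 4) (by positivity)
    refine ⟨δ, hδ, fun s hs => ?_⟩
    set k := max K₁ K₂
    have h1 := hdist k k s t (ε / 4) (by positivity) (hK₁ k (le_max_left _ _) s s.2 t t.2 hs)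
    have h2 := hK₂ k (le_max_right _ _) s
    have h3 := hK₂ k (le_max_right _ _) t
    have h4 := dist_triangle4 (U s) (f k s) (f k t) (U t)
    rw [dist_comm (U s) (f k s)] at h4
    linarith
  refine ⟨φ, hφ, ⟨U, hUcont⟩, ENNReal.tendsto_nhds_zero.2 fun ε hε => ?_⟩
  obtain ⟨ε', hε', hεε'⟩ : ∃ ε' : ℝ, 0 < ε' ∧ ENNReal.ofReal ε' ≤ ε := by
    rcases eq_or_ne ε ⊤ with rfl | h
    · exact ⟨1, one_pos, le_top⟩
    · exact ⟨ε.toReal, ENNReal.toReal_pos hε.ne' h, (ENNReal.ofReal_toReal h).le⟩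
  obtain ⟨K', hK'⟩ := hunif ε' hε'
  filter_upwards [eventually_ge_atTop K'] with k hk
  refine iSup_le fun t => le_trans (le_of_eq ?_) (((edist_le_ofReal hε'.le).2 (hK' k hk t)).trans
    hεε')
  rw [Lp.edist_def]
  refine eLpNorm_congr_ae ?_
  filter_upwards [(hF (φ k) t t.2).coeFn_toLp] with x hx
  rw [Pi.sub_apply, hx]
  rfl

/-! ### Sampled continuous data -/

/-- The cell-constant function sampling `a` at the left end points of the cells. -/
noncomputable def sample (τ : ℝ) (a : ℝ → ℂ) : ℝ → ℂ := cellFun τ fun j => a (j * τ)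

theorem sample_apply_mul {τ : ℝ} (hτ : 0 < τ) (a : ℝ → ℂ) (j : ℤ) :
    sample τ a (j * τ) = a (j * τ) := by
  simp only [sample, cellFun]
  rw [mul_div_cancel_right₀ _ hτ.ne', Int.floor_intCast]

theorem abs_sub_floor_div_mul_le {τ : ℝ} (hτ : 0 < τ) (x : ℝ) : |x - ⌊x / τ⌋ * τ| ≤ τ := by
  have h1 := Int.floor_le (x / τ)
  have h2 := Int.lt_floor_add_one (x / τ)
  rw [le_div_iff₀ hτ] at h1
  rw [div_lt_iff₀ hτ] at h2
  rw [abs_le]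
  constructor <;> linarith

theorem sample_eq_zero {τ τmax R : ℝ} (hτ : 0 < τ) (hτ' : τ ≤ τmax) {a : ℝ → ℂ}
    (ha : ∀ x, R < |x| → a x = 0) (x : ℝ) (hx : R + τmax < |x|) : sample τ a x = 0 := by
  refine ha _ ?_
  have h1 := abs_sub_floor_div_mul_le hτ x
  have h2 := abs_sub_abs_le_abs_sub x (⌊x / τ⌋ * τ)
  linarith

theorem exists_support_bound {a : ℝ → ℂ} (ha : HasCompactSupport a) :
    ∃ R, 0 ≤ R ∧ ∀ x, R < |x| → a x = 0 := by
  obtain ⟨R, hR⟩ := ha.isCompact.isBounded.subset_closedBall 0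
  refine ⟨max R 0, le_max_right _ _, fun x hx => ?_⟩
  by_contra h
  have h1 := hR (subset_tsupport a h)
  rw [mem_closedBall_zero_iff, Real.norm_eq_abs] at h1
  exact absurd (h1.trans (le_max_left R 0)) (not_le.2 hx)

theorem exists_eLpNorm_sample_sub_le {a : ℝ → ℂ} (hac : Continuous a) (ha : HasCompactSupport a)
    {ε : ℝ} (hε : 0 < ε) :
    ∃ δ, 0 < δ ∧ ∀ τ, 0 < τ → τ ≤ δ → eLpNorm (sample τ a - a) 2 volume ≤ ENNReal.ofReal ε := by
  obtain ⟨R, hR0, hR⟩ := exists_support_bound ha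
  have huc := ha.uniformContinuous_of_continuous hac
  obtain ⟨δ, hδ, h⟩ := Metric.uniformContinuous_iff.1 huc (ε / (√(2 * (R + 1)) + 1))
    (by positivity)
  refine ⟨min 1 (δ / 2), by positivity, fun τ hτ hτδ => ?_⟩
  have hτ1 : τ ≤ 1 := hτδ.trans (min_le_left _ _)
  refine (eLpNorm_le_of_bounded_of_support (S := ε / (√(2 * (R + 1)) + 1)) (R := R + 1)
    (by positivity) (by positivity) (fun x => ?_) fun x hx => ?_).trans
    (ENNReal.ofReal_le_ofReal ?_)
  · rw [Pi.sub_apply, ← dist_eq_norm, dist_comm]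
    refine (h ?_).le
    rw [Real.dist_eq]
    have := abs_sub_floor_div_mul_le hτ x
    have := hτδ.trans (min_le_right _ _)
    linarith
  · rw [Pi.sub_apply, sample_eq_zero hτ hτ1 hR x hx, hR x (by linarith), sub_zero]
  · rw [div_mul_eq_mul_div, div_le_iff₀ (by positivity)]
    gcongr
    linarith

theorem exists_eLpNorm_sample_le {a : ℝ → ℂ} (hac : Continuous a) (ha : HasCompactSupport a)
    {τmax : ℝ} (hτmax : 0 ≤ τmax) :
    ∃ r, 0 ≤ r ∧ ∀ τ, 0 < τ → τ ≤ τmax → eLpNorm (sample τ a) 2 volume ≤ ENNReal.ofReal r := by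
  obtain ⟨R, hR0, hR⟩ := exists_support_bound ha
  obtain ⟨S, hS⟩ := ha.exists_bound_of_continuous hac
  have hS0 : 0 ≤ S := (norm_nonneg _).trans (hS 0)
  refine ⟨S * √(2 * (R + τmax)), by positivity, fun τ hτ hτ' => ?_⟩
  exact eLpNorm_le_of_bounded_of_support hS0 (by positivity) (fun x => hS _)
    (sample_eq_zero hτ hτ' hR)

theorem memLp_sample {a : ℝ → ℂ} (hac : Continuous a) (ha : HasCompactSupport a) {τ : ℝ}
    (hτ : 0 < τ) : MemLp (sample τ a) 2 volume := by
  obtain ⟨r, -, hr⟩ := exists_eLpNorm_sample_le hac ha hτ.le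
  exact ⟨(measurable_cellFun _ _).aestronglyMeasurable,
    (hr τ hτ le_rfl).trans_lt ENNReal.ofReal_lt_top⟩

theorem abs_floor_div_sub_mul_le {τ : ℝ} (hτ : 0 < τ) (x y : ℝ) :
    |(⌊x / τ⌋ : ℝ) - ⌊y / τ⌋| * τ ≤ |x - y| + τ := by
  have h1 := Int.floor_le (x / τ)
  have h2 := Int.lt_floor_add_one (x / τ)
  have h3 := Int.floor_le (y / τ)
  have h4 := Int.lt_floor_add_one (y / τ)
  rw [le_div_iff₀ hτ] at h1 h3
  rw [div_lt_iff₀ hτ] at h2 h4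
  have h5 := abs_le.1 (le_refl |x - y|)
  rw [← abs_of_pos hτ, ← abs_mul, abs_of_pos hτ, abs_le]
  constructor <;> linarith [h5.1, h5.2]

theorem abs_natFloor_div_sub_mul_le {τ s t : ℝ} (hτ : 0 < τ) (hs : 0 ≤ s) (ht : 0 ≤ t) :
    |(⌊s / τ⌋₊ : ℝ) - ⌊t / τ⌋₊| * τ ≤ |s - t| + τ := by
  have := abs_floor_div_sub_mul_le hτ s t
  rwa [← natCast_floor_eq_intCast_floor (div_nonneg hs hτ.le),
    ← natCast_floor_eq_intCast_floor (div_nonneg ht hτ.le)] at this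

theorem remainder_mem {τ t : ℝ} (hτ : 0 < τ) (ht : 0 ≤ t) :
    0 ≤ t - ⌊t / τ⌋₊ * τ ∧ t - ⌊t / τ⌋₊ * τ ≤ τ := by
  have h1 := Nat.floor_le (div_nonneg ht hτ.le)
  have h2 := Nat.lt_floor_add_one (t / τ)
  rw [le_div_iff₀ hτ] at h1
  rw [div_lt_iff₀ hτ] at h2
  constructor <;> linarith

/-- Splitting solutions with sampled continuous data of compact support are asymptotically
regular. -/
theorem isAsymptoticallyRegular_splitting_sample (m α β : ℝ) {a b : ℝ → ℂ} (hac : Continuous a)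
    (ha : HasCompactSupport a) (hbc : Continuous b) (hb : HasCompactSupport b) {τmax T : ℝ}
    (hτmax : 0 ≤ τmax) (hT : 0 ≤ T) {τ : ℕ → ℝ} (hτ : ∀ k, τ k ∈ Ioo 0 τmax)
    (hτ0 : Tendsto τ atTop (𝓝 0)) :
    IsAsymptoticallyRegular T (fun k t x =>
      (splitting m α β (τ k) (fun y => (sample (τ k) a y, sample (τ k) b y)) t x).1) ∧
    IsAsymptoticallyRegular T (fun k t x =>
      (splitting m α β (τ k) (fun y => (sample (τ k) a y, sample (τ k) b y)) t x).2) := by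
  obtain ⟨Ra, hRa0, hRa⟩ := exists_support_bound ha
  obtain ⟨Rb, hRb0, hRb⟩ := exists_support_bound hb
  obtain ⟨Sa, hSa⟩ := ha.exists_bound_of_continuous hac
  obtain ⟨Sb, hSb⟩ := hb.exists_bound_of_continuous hbc
  obtain ⟨ra, hra0, hra⟩ := exists_eLpNorm_sample_le hac ha hτmax
  obtain ⟨rb, hrb0, hrb⟩ := exists_eLpNorm_sample_le hbc hb hτmax
  set S := max Sa Sb with hSdef
  have hS0 : 0 ≤ S := ((norm_nonneg _).trans (hSa 0)).trans (le_max_left _ _)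
  set R := max Ra Rb with hRdef
  have hR0 : 0 ≤ R := hRa0.trans (le_max_left _ _)
  set M := ra ^ 2 + rb ^ 2 with hM
  have hM0 : 0 ≤ M := by positivity
  have hτpos : ∀ k, 0 < τ k := fun k => (hτ k).1
  have hτle : ∀ k, τ k ≤ τmax := fun k => (hτ k).2.le
  have hcell : ∀ k c, IsCellConstant (τ k) (sample (τ k) c) := fun k c =>
    isCellConstant_cellFun (hτpos k) _
  have heq := fun k => splitting_eq m α β (hτpos k) (hcell k a) (hcell k b)
  have hsch := fun k => isScheme_cell m α β (τ k)
    (fun j => (sample (τ k) a (j * τ k), sample (τ k) b (j * τ k)))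
  have hmass := fun k => massLE_of_eLpNorm_le (hτpos k) (hcell k a) (hcell k b) hra0 hrb0
    (hra _ (hτpos k) (hτle k)) (hrb _ (hτpos k) (hτle k))
  set u := fun k => cellFst m α β (τ k)
    (fun j => (sample (τ k) a (j * τ k), sample (τ k) b (j * τ k))) with hu
  set v := fun k => cellSnd m α β (τ k)
    (fun j => (sample (τ k) a (j * τ k), sample (τ k) b (j * τ k))) with hv
  have hu0 : ∀ k j, u k 0 j = a (j * τ k) := fun k j => sample_apply_mul (hτpos k) a j
  have hv0 : ∀ k j, v k 0 j = b (j * τ k) := fun k j => sample_apply_mul (hτpos k) b j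
  have hub : ∀ k j, ‖u k 0 j‖ ≤ S := fun k j => by
    rw [hu0]; exact (hSa _).trans (le_max_left _ _)
  have hvb : ∀ k j, ‖v k 0 j‖ ≤ S := fun k j => by
    rw [hv0]; exact (hSb _).trans (le_max_right _ _)
  obtain ⟨S', hS'0, hS'⟩ := IsScheme.exists_norm_le m α β hτmax hM0 hT hS0
  have hbound := fun k => hS' (τ k) (hτpos k) (hτle k) _ _ (hsch k) (hmass k) (hub k) (hvb k)
  have hsupp : ∀ k (n : ℕ), n * τ k ≤ T → ∀ x y : ℝ, |x - y| ≤ τ k → R + T + 2 * τmax < |x| →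
      u k n ⌊y / τ k⌋ = 0 ∧ v k n ⌊y / τ k⌋ = 0 := by
    intro k n hn x y hxy hx
    refine (hsch k).eq_zero_of_lt_abs (hτpos k).le (J := R / τ k) (fun j hj => ?_) n _ ?_
    · have h1 : R < |j * τ k| := by
        rwa [abs_mul, abs_of_pos (hτpos k), ← div_lt_iff₀ (hτpos k)]
      exact ⟨(hu0 k j).trans (hRa _ ((le_max_left _ _).trans_lt h1)),
        (hv0 k j).trans (hRb _ ((le_max_right _ _).trans_lt h1))⟩
    · have h1 := abs_sub_floor_div_mul_le (hτpos k) y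
      have h2 := abs_sub_abs_le_abs_sub y (⌊y / τ k⌋ * τ k)
      have h3 := abs_sub_abs_le_abs_sub x y
      have h4 := hτle k
      have h5 : |(⌊y / τ k⌋ : ℝ) * τ k| = |(⌊y / τ k⌋ : ℝ)| * τ k := by
        rw [abs_mul, abs_of_pos (hτpos k)]
      rw [h5] at h2
      rw [← mul_lt_mul_iff_left₀ (hτpos k), add_mul, div_mul_cancel₀ _ (hτpos k).ne']
      linarith
  have hshift : ∀ k {t : ℝ}, t ∈ Icc 0 T → ∀ x : ℝ,
      |x - (x - (t - ⌊t / τ k⌋₊ * τ k))| ≤ τ k ∧ |x - (x + (t - ⌊t / τ k⌋₊ * τ k))| ≤ τ k := by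
    intro k t ht x
    obtain ⟨h1, h2⟩ := remainder_mem (hτpos k) ht.1
    constructor <;> rw [abs_le] <;> constructor <;> linarith
  -- choice of scales for the moduli of continuity
  have hscale : ∀ L ε : ℝ, 0 ≤ L → 0 < ε → ∃ d δ, 0 < δ ∧ L * (d + 3 * δ) ≤ ε ∧
      ∀ k, ∀ j i : ℤ, |(j : ℝ) - i| * τ k ≤ 2 * (3 * δ) →
        ‖u k 0 j - u k 0 i‖ ≤ d ∧ ‖v k 0 j - v k 0 i‖ ≤ d := by
    intro L ε hL hε
    set d := ε / (2 * (L + 1)) with hd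
    have hd0 : 0 < d := by positivity
    obtain ⟨η₁, hη₁, h₁⟩ := Metric.uniformContinuous_iff.1
      (ha.uniformContinuous_of_continuous hac) d hd0
    obtain ⟨η₂, hη₂, h₂⟩ := Metric.uniformContinuous_iff.1
      (hb.uniformContinuous_of_continuous hbc) d hd0
    refine ⟨d, min (d / 3) (min (η₁ / 7) (η₂ / 7)), by positivity, ?_, ?_⟩
    · have h3 : min (d / 3) (min (η₁ / 7) (η₂ / 7)) ≤ d / 3 := min_le_left _ _
      have h4 : (L + 1) * (2 * d) = ε := by rw [hd]; field_simp
      nlinarith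
    · intro k j i hji
      have h3 : min (d / 3) (min (η₁ / 7) (η₂ / 7)) ≤ η₁ / 7 :=
        (min_le_right _ _).trans (min_le_left _ _)
      have h4 : min (d / 3) (min (η₁ / 7) (η₂ / 7)) ≤ η₂ / 7 :=
        (min_le_right _ _).trans (min_le_right _ _)
      have h5 : dist ((j : ℝ) * τ k) (i * τ k) = |(j : ℝ) - i| * τ k := by
        rw [Real.dist_eq, ← sub_mul, abs_mul, abs_of_pos (hτpos k)]
      rw [hu0, hu0, hv0, hv0, ← dist_eq_norm, ← dist_eq_norm]
      exact ⟨(h₁ (by rw [h5]; linarith)).le, (h₂ (by rw [h5]; linarith)).le⟩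
  have hsmall : ∀ δ : ℝ, 0 < δ → ∃ K, ∀ k, K ≤ k → τ k ≤ δ := fun δ hδ =>
    eventually_atTop.1 (hτ0.eventually_le_const hδ)
  have hfl : ∀ k {δ s t : ℝ}, s ∈ Icc 0 T → t ∈ Icc 0 T → τ k ≤ δ → |s - t| < δ →
      |(⌊s / τ k⌋₊ : ℝ) - ⌊t / τ k⌋₊| * τ k ≤ 3 * δ := by
    intro k δ s t hs ht hkδ hst
    have := abs_natFloor_div_sub_mul_le (hτpos k) hs.1 ht.1
    have := hτpos k
    linarith
  have hrem : ∀ k {δ s t x y : ℝ}, s ∈ Icc 0 T → t ∈ Icc 0 T → τ k ≤ δ → |x - y| < δ →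
      |x - y| + |(s - ⌊s / τ k⌋₊ * τ k) - (t - ⌊t / τ k⌋₊ * τ k)| + τ k ≤ 3 * δ := by
    intro k δ s t x y hs ht hkδ hxy
    obtain ⟨h1, h2⟩ := remainder_mem (hτpos k) hs.1
    obtain ⟨h3, h4⟩ := remainder_mem (hτpos k) ht.1
    have h5 : |(s - ⌊s / τ k⌋₊ * τ k) - (t - ⌊t / τ k⌋₊ * τ k)| ≤ τ k := by
      rw [abs_le]
      constructor <;> linarith
    linarith
  refine ⟨⟨?_, ⟨S', ?_⟩, ⟨R + T + 2 * τmax, by positivity, ?_⟩, ?_⟩,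
    ⟨?_, ⟨S', ?_⟩, ⟨R + T + 2 * τmax, by positivity, ?_⟩, ?_⟩⟩
  · exact fun k t _ => (memLp_splitting m α β (hτpos k) (hcell k a) (hcell k b)
      (memLp_sample hac ha (hτpos k)) (memLp_sample hbc hb (hτpos k)) t).1.1
  · intro k t ht x
    rw [heq]
    exact (hbound k _ (natFloor_div_mul_le (hτpos k) ht) _).1
  · intro k t ht x hx
    rw [heq]
    exact (hsupp k _ (natFloor_div_mul_le (hτpos k) ht) x _ (hshift k ht x).1 hx).1
  · intro ε hε
    obtain ⟨L, hL0, hL⟩ := IsScheme.exists_modulus_fst m α β hτmax hM0 hT hS0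
    obtain ⟨d, δ, hδ, hLd, hmod⟩ := hscale L ε hL0 hε
    obtain ⟨K, hK⟩ := hsmall δ hδ
    refine ⟨δ, hδ, K, fun k hk s hs t ht x y hst hxy => ?_⟩
    rw [heq, heq]
    refine (hL (τ k) (hτpos k) (hτle k) _ _ (hsch k) (hmass k) (hub k) (hvb k) d (3 * δ)
      (hmod k) _ _ (natFloor_div_mul_le (hτpos k) hs) (natFloor_div_mul_le (hτpos k) ht)
      (hfl k hs ht (hK k hk) hst) _ _ ?_).trans hLd
    refine (abs_floor_div_sub_mul_le (hτpos k) _ _).trans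
      (le_trans ?_ (hrem k hs ht (hK k hk) hxy))
    gcongr
    rw [sub_sub_sub_comm]
    exact abs_sub _ _
  · exact fun k t _ => (memLp_splitting m α β (hτpos k) (hcell k a) (hcell k b)
      (memLp_sample hac ha (hτpos k)) (memLp_sample hbc hb (hτpos k)) t).2.1
  · intro k t ht x
    rw [heq]
    exact (hbound k _ (natFloor_div_mul_le (hτpos k) ht) _).2
  · intro k t ht x hx
    rw [heq]
    exact (hsupp k _ (natFloor_div_mul_le (hτpos k) ht) x _ (hshift k ht x).2 hx).2
  · intro ε hε
    obtain ⟨L, hL0, hL⟩ := IsScheme.exists_modulus_snd m α β hτmax hM0 hT hS0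
    obtain ⟨d, δ, hδ, hLd, hmod⟩ := hscale L ε hL0 hε
    obtain ⟨K, hK⟩ := hsmall δ hδ
    refine ⟨δ, hδ, K, fun k hk s hs t ht x y hst hxy => ?_⟩
    rw [heq, heq]
    refine (hL (τ k) (hτpos k) (hτle k) _ _ (hsch k) (hmass k) (hub k) (hvb k) d (3 * δ)
      (hmod k) _ _ (natFloor_div_mul_le (hτpos k) hs) (natFloor_div_mul_le (hτpos k) ht)
      (hfl k hs ht (hK k hk) hst) _ _ ?_).trans hLd
    refine (abs_floor_div_sub_mul_le (hτpos k) _ _).trans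
      (le_trans ?_ (hrem k hs ht (hK k hk) hxy))
    gcongr
    rw [add_sub_add_comm]
    exact abs_add_le _ _

/-- Splitting solutions with data converging in `L²` are approximated, uniformly in time and up to
arbitrarily small errors, by splitting solutions with sampled continuous data. -/
theorem exists_regular_approx (m α β : ℝ) {u₀ v₀ : ℝ → ℂ} (hu₀ : MemLp u₀ 2 volume)
    (hv₀ : MemLp v₀ 2 volume) {τmax T : ℝ} (hτmax : 0 ≤ τmax) (hT : 0 ≤ T) {f g : ℝ → ℝ → ℂ}
    (hf : ∀ τ ∈ Ioo 0 τmax, IsCellConstant τ (f τ) ∧ MemLp (f τ) 2 volume)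
    (hg : ∀ τ ∈ Ioo 0 τmax, IsCellConstant τ (g τ) ∧ MemLp (g τ) 2 volume)
    (hfg : Tendsto (fun τ : ℝ => eLpNorm (f τ - u₀) 2 volume + eLpNorm (g τ - v₀) 2 volume)
      (𝓝[>] 0) (𝓝 0))
    {τ : ℕ → ℝ} (hτ : ∀ k, τ k ∈ Ioo 0 τmax) (hτ0 : Tendsto τ atTop (𝓝 0)) {ε : ℝ} (hε : 0 < ε) :
    ∃ G H, IsAsymptoticallyRegular T G ∧ IsAsymptoticallyRegular T H ∧ ∃ K, ∀ k, K ≤ k →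
      ∀ t ∈ Icc 0 T,
        eLpNorm ((fun x => (splitting m α β (τ k) (fun y => (f (τ k) y, g (τ k) y)) t x).1)
          - G k t) 2 volume ≤ ENNReal.ofReal ε ∧
        eLpNorm ((fun x => (splitting m α β (τ k) (fun y => (f (τ k) y, g (τ k) y)) t x).2)
          - H k t) 2 volume ≤ ENNReal.ofReal ε := by
  obtain ⟨η, hη, τ₀, hτ₀, C, hC, hstab⟩ := exists_splitting_stability m α β hu₀ hv₀ hτmax hT
  set ρ := min (η / 2) (ε / (3 * (C + 1))) with hρ
  have hρ0 : 0 < ρ := by positivity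
  have hρη : ρ + ρ ≤ η := by
    have : ρ ≤ η / 2 := min_le_left _ _
    linarith
  have hρε : C * (ρ + (ρ + ρ)) ≤ ε := by
    have h1 : ρ ≤ ε / (3 * (C + 1)) := min_le_right _ _
    rw [le_div_iff₀ (by positivity)] at h1
    linarith
  have hρne : ENNReal.ofReal ρ ≠ 0 := by simpa using hρ0
  obtain ⟨a, ha, hau, hac, ha2⟩ :=
    hu₀.exists_hasCompactSupport_eLpNorm_sub_le ENNReal.ofNat_ne_top hρne
  obtain ⟨b, hb, hbv, hbc, hb2⟩ :=
    hv₀.exists_hasCompactSupport_eLpNorm_sub_le ENNReal.ofNat_ne_top hρne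
  obtain ⟨δ₁, hδ₁, hsa⟩ := exists_eLpNorm_sample_sub_le hac ha hρ0
  obtain ⟨δ₂, hδ₂, hsb⟩ := exists_eLpNorm_sample_sub_le hbc hb hρ0
  obtain ⟨hG, hH⟩ := isAsymptoticallyRegular_splitting_sample m α β hac ha hbc hb hτmax hT hτ hτ0
  have hτ0' : Tendsto τ atTop (𝓝[>] 0) :=
    tendsto_nhdsWithin_iff.2 ⟨hτ0, Eventually.of_forall fun k => (hτ k).1⟩
  have hev : ∀ᶠ k in atTop, eLpNorm (f (τ k) - u₀) 2 volume + eLpNorm (g (τ k) - v₀) 2 volume ≤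
      ENNReal.ofReal ρ := (hfg.comp hτ0').eventually_le_const (ENNReal.ofReal_pos.2 hρ0)
  obtain ⟨K, hK⟩ := eventually_atTop.1 (hev.and (hτ0.eventually_le_const
    (lt_min hτ₀ (lt_min hδ₁ hδ₂))))
  refine ⟨_, _, hG, hH, K, fun k hk t ht => ?_⟩
  obtain ⟨hk1, hk2⟩ := hK k hk
  have hτk := (hτ k).1
  have hfu : eLpNorm (f (τ k) - u₀) 2 volume ≤ ENNReal.ofReal ρ := le_self_add.trans hk1
  have hgv : eLpNorm (g (τ k) - v₀) 2 volume ≤ ENNReal.ofReal ρ := le_add_self.trans hk1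
  have hsample : ∀ {c w : ℝ → ℂ}, Continuous c → HasCompactSupport c → MemLp c 2 volume →
      MemLp w 2 volume → eLpNorm (w - c) 2 volume ≤ ENNReal.ofReal ρ →
      eLpNorm (sample (τ k) c - c) 2 volume ≤ ENNReal.ofReal ρ →
      eLpNorm (sample (τ k) c - w) 2 volume ≤ ENNReal.ofReal (ρ + ρ) := by
    intro c w hcc hcs hc hw h1 h2
    rw [ENNReal.ofReal_add hρ0.le hρ0.le]
    rw [eLpNorm_sub_comm] at h1
    exact (eLpNorm_sub_le_add (memLp_sample hcc hcs hτk).1 hc.1 hw.1).trans (add_le_add h2 h1)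
  have hau' := hsample hac ha ha2 hu₀ hau
    (hsa _ hτk (hk2.trans ((min_le_right _ _).trans (min_le_left _ _))))
  have hbv' := hsample hbc hb hb2 hv₀ hbv
    (hsb _ hτk (hk2.trans ((min_le_right _ _).trans (min_le_right _ _))))
  have htri : ∀ {c w h : ℝ → ℂ}, MemLp c 2 volume → MemLp w 2 volume → MemLp h 2 volume →
      eLpNorm (h - w) 2 volume ≤ ENNReal.ofReal ρ →
      eLpNorm (c - w) 2 volume ≤ ENNReal.ofReal (ρ + ρ) →
      eLpNorm (h - c) 2 volume ≤ ENNReal.ofReal (ρ + (ρ + ρ)) := by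
    intro c w h hc hw hh h1 h2
    rw [ENNReal.ofReal_add hρ0.le (by positivity)]
    rw [eLpNorm_sub_comm] at h2
    exact (eLpNorm_sub_le_add hh.1 hw.1 hc.1).trans (add_le_add h1 h2)
  have hρη' := ENNReal.ofReal_le_ofReal hρη
  have hρη'' : ENNReal.ofReal ρ ≤ ENNReal.ofReal η := ENNReal.ofReal_le_ofReal (by linarith)
  have hsm1 := memLp_sample hac ha hτk
  have hsm2 := memLp_sample hbc hb hτk
  obtain ⟨h1, h2⟩ := hstab (τ k) hτk (hτ k).2.le (hk2.trans (min_le_left _ _)) _ _ _ _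
    (hf _ (hτ k)).1 (hg _ (hτ k)).1 (isCellConstant_cellFun hτk _) (isCellConstant_cellFun hτk _)
    (hf _ (hτ k)).2 (hg _ (hτ k)).2 hsm1 hsm2
    (hfu.trans hρη'') (hgv.trans hρη'') (hau'.trans hρη') (hbv'.trans hρη')
    _ (by positivity) (htri hsm1 hu₀ (hf _ (hτ k)).2 hfu hau')
    (htri hsm2 hv₀ (hg _ (hτ k)).2 hgv hbv') t ht
  exact ⟨h1.trans (ENNReal.ofReal_le_ofReal hρε), h2.trans (ENNReal.ofReal_le_ofReal hρε)⟩

end NLDirac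

theorem mainTheorem3 (m α β : ℝ) (hm : 0 ≤ m)
    (u₀ v₀ : ℝ → ℂ) (hu₀ : MemLp u₀ 2 volume) (hv₀ : MemLp v₀ 2 volume)
    (τmax : ℝ) (hτmax : 0 < τmax)
    (f g : ℝ → ℝ → ℂ)
    (hf : ∀ τ ∈ Set.Ioo 0 τmax, NLDirac.IsCellConstant τ (f τ) ∧ MemLp (f τ) 2 volume)
    (hg : ∀ τ ∈ Set.Ioo 0 τmax, NLDirac.IsCellConstant τ (g τ) ∧ MemLp (g τ) 2 volume)
    (hfg : Tendsto (fun τ : ℝ => eLpNorm (f τ - u₀) 2 volume + eLpNorm (g τ - v₀) 2 volume)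
      (𝓝[>] 0) (𝓝 0))
    (u v : ℝ → ℝ → ℝ → ℂ)
    (hu : ∀ τ t x, u τ t x = (NLDirac.splitting m α β τ (fun y => (f τ y, g τ y)) t x).1)
    (hv : ∀ τ t x, v τ t x = (NLDirac.splitting m α β τ (fun y => (f τ y, g τ y)) t x).2)
    (T : ℝ) (hT : 0 < T) :
    (∀ τ ∈ Set.Ioo 0 τmax, ∀ t ∈ Set.Icc 0 T,
      MemLp (u τ t) 2 volume ∧ MemLp (v τ t) 2 volume) ∧
    ∀ τ : ℕ → ℝ, (∀ k, τ k ∈ Set.Ioo 0 τmax) → Tendsto τ atTop (𝓝 0) →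
      ∃ φ : ℕ → ℕ, StrictMono φ ∧
        ∃ U V : C(Set.Icc (0 : ℝ) T, Lp ℂ 2 (volume : Measure ℝ)),
          Tendsto
            (fun k : ℕ => ⨆ t : Set.Icc (0 : ℝ) T,
              (eLpNorm (fun x => u (τ (φ k)) t x - U t x) 2 volume
                + eLpNorm (fun x => v (τ (φ k)) t x - V t x) 2 volume))
            atTop (𝓝 0) := by
  have hu' : ∀ τ t, u τ t =
      fun x => (NLDirac.splitting m α β τ (fun y => (f τ y, g τ y)) t x).1 :=
    fun τ t => funext (hu τ t)
  have hv' : ∀ τ t, v τ t =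
      fun x => (NLDirac.splitting m α β τ (fun y => (f τ y, g τ y)) t x).2 :=
    fun τ t => funext (hv τ t)
  have hmem : ∀ τ ∈ Set.Ioo 0 τmax, ∀ t ∈ Set.Icc 0 T,
      MemLp (u τ t) 2 volume ∧ MemLp (v τ t) 2 volume := by
    intro τ hτ t _
    rw [hu', hv']
    exact NLDirac.memLp_splitting m α β hτ.1 (hf τ hτ).1 (hg τ hτ).1 (hf τ hτ).2 (hg τ hτ).2 t
  refine ⟨hmem, fun τ hτ hτ0 => ?_⟩
  obtain ⟨φ, hφ, U, hU⟩ := NLDirac.exists_subseq_tendsto_of_approx hT.le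
    (F := fun k => u (τ k)) (fun k t ht => (hmem _ (hτ k) t ht).1) (fun ε hε => by
      obtain ⟨G, _, hG, _, K, hK⟩ := NLDirac.exists_regular_approx m α β hu₀ hv₀ hτmax.le hT.le
        hf hg hfg hτ hτ0 hε
      refine ⟨G, hG, K, fun k hk t ht => ?_⟩
      rw [hu']
      exact (hK k hk t ht).1)
  have hτφ : Tendsto (τ ∘ φ) atTop (𝓝 0) := hτ0.comp hφ.tendsto_atTop
  obtain ⟨ψ, hψ, V, hV⟩ := NLDirac.exists_subseq_tendsto_of_approx hT.le
    (F := fun k => v (τ (φ k))) (fun k t ht => (hmem _ (hτ _) t ht).2) (fun ε hε => by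
      obtain ⟨_, H, _, hH, K, hK⟩ := NLDirac.exists_regular_approx m α β hu₀ hv₀ hτmax.le hT.le
        hf hg hfg (fun k => hτ (φ k)) hτφ hε
      refine ⟨H, hH, K, fun k hk t ht => ?_⟩
      rw [hv']
      exact (hK k hk t ht).2)
  refine ⟨φ ∘ ψ, hφ.comp hψ, U, V, ?_⟩
  have hsum := (hU.comp hψ.tendsto_atTop).add hV
  rw [add_zero] at hsum
  refine tendsto_of_tendsto_of_tendsto_of_le_of_le tendsto_const_nhds hsum
    (fun k => zero_le) fun k => iSup_le fun t => ?_
  exact add_le_add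
    (le_iSup (fun t : Set.Icc (0 : ℝ) T =>
      eLpNorm (fun x => u (τ (φ (ψ k))) t x - U t x) 2 volume) t)
    (le_iSup (fun t : Set.Icc (0 : ℝ) T =>
      eLpNorm (fun x => v (τ (φ (ψ k))) t x - V t x) 2 volume) t)
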